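/- Let $T>0$, let $U\subset\mathbb R^d$ and $S\subset\mathbb R^m$ be open, and let $(\mathbb T_n)_{n}$ be a fixed refining sequence of partitions of $[0,T]$: finite sets $\mathbb T_1\subset\mathbb T_2\subset\cdots\subset[0,T]$ containing $0$ and $T$, with mesh tending to $0$. For $s\in\mathbb T_n$ let $s'$ be the successor of $s$ in $\mathbb T_n$, with $T'=T$. **Paths.** $D([0,T],V)$ is the set of $V$-valued càdlàg paths whose left limits lie in $V$, with the supremum norm; $CBV([0,T],S)$ is the set of continuous $S$-valued paths with components of bounded variation. $X^t=X(t\wedge\cdot)$ is the stopped path, and $A_0(r):=r$. **Functionals.** A functional $F:[0,T]\times D([0,T],U)\times CBV([0,T],S)\to\mathbb R$ is *non-anticipative* if $F(t,X,A)=F(t,X^t,A^t)$; *boundedness-preserving* if for all $A$ and all compact $K\subset U$ it is bounded on $[0,T]\times D([0,T],K)\times\{A\}$; *continuous at fixed times* if for all $\varepsilon,t,X,A$ there is $\delta>0$ with $|F(t,X,A)-F(t,Z,A)|<\varepsilon$ whenever $\|X^t-Z^t\|_\infty<\delta$; *left-continuous* if for all $t\in(0,T]$, $\varepsilon,X,A$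 there is $\delta>0$ with $|F(t,X,A)-F(t-h,Z,A)|<\varepsilon$ whenever $0\le h<\delta$, $h\le t$ and $\|X^t-Z^{t-h}\|_\infty<\delta$; *continuous in $X$ locally uniformly in $t$* if for all $\varepsilon,t,X,A$ there is $\delta>0$ with $|F(u,X,A)-F(u,Z,A)|<\varepsilon$ whenever $|t-u|<\delta$ and $\|X-Z\|_\infty<\delta$. A *horizontal derivative* of $F$ is a tuple $\mathscr DF=(\mathscr D_0F,\dots,\mathscr D_mF)$ of non-anticipative, boundedness-preserving functionals such that, for all $0\le s<t\le T$, $X$ and $A$, the maps $[s,t]\ni r\mapsto\mathscr D_iF(r,X^s,A)$ are Borel measurable and $$F(t,X^s,A)-F(s,X^s,A)=\sum_{i=0}^m\int_s^t\mathscr D_iF(r,X^s,A)\,dA_i(r).$$ The *vertical derivative* $\nabla_XF(t,X,A)=(\partial_iF(t,X,A))_{i=1,\dots,d}$ is the gradient at $v=0$ of $v\mapsto F(t,X+v\mathbf 1_{[t,T]},A^t)$, and $\partial_{ij}F=\partial_i(\partial_jF)$. $\mathbb C^{1,2}_c(U,S)$ is the class of non-anticipative $F$ that are left-continuous, boundedness-preserving,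 continuous in $X$ locally uniformly in $t$, have a horizontal derivative that is continuous at fixed times, and are twice vertically differentiable with all $\partial_iF$ and $\partial_{ij}F$ left-continuous and boundedness-preserving. For $F\in\mathbb C^{1,2}_c(U,S)$, $\mathscr DF$ denotes any horizontal derivative that is continuous at fixed times. **Integrands and integrals.** $\xi:[0,T]\times D([0,T],U)\to\mathbb R^d$ is an *admissible functional integrand* if $\xi(t,X)=\nabla_XG(t,X,B)$ for some $p\in\mathbb N$, open $W\subset\mathbb R^p$, $B\in CBV([0,T],W)$ and $G\in\mathbb C^{1,2}_c(U,W)$. For $X\in C([0,T],U)$ put $X^n=\sum_{s\in\mathbb T_n}X(s')\mathbf 1_{[s,s')}+X(T)\mathbf 1_{\{T\}}$, let $X^{n,s-}$ be $X^n$ on $[0,s)$ and constant equal to $X(s)$ on $[s,T]$, and $$\int_0^t\xi(s,X)\,dX(s):=\lim_{n\to\infty}\sum_{s\in\mathbb T_n,\,s\le t}\xi(s,X^{n,s-})\cdot(X(s')-X(s))$$ when the limit exists. A continuous real path $x$ has the *continuous quadratic variation* $[x]$ if $\sum_{s\in\mathbb T_n,s\le t}(x(s')-x(s))^2\to[x](t)$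 for all $t\in(0,T]$ and $[x]$, with $[x](0)=0$, is continuous; an $\mathbb R^d$-valued path $X$ has the continuous quadratic variation $([X_i,X_j])_{i,j}$ if all $X_i+X_j$ have one, with $[X_i,X_j]=\frac12([X_i+X_j]-[X_i]-[X_j])$. **Statement.** Let $X\in C([0,T],U)$ have the continuous quadratic variation $[X]$, let $A\in CBV([0,T],S)$ and $F_1,\dots,F_\nu\in\mathbb C^{1,2}_c(U,S)$, write $F=(F_1,\dots,F_\nu)$, and suppose that $Y(t):=F(t,X,A)$ admits the continuous quadratic variation $$[Y_i,Y_j](t)=\sum_{k,\ell=1}^d\int_0^t\partial_kF_i(s,X,A)\,\partial_\ell F_j(s,X,A)\,d[X_k,X_\ell](s),\qquad i,j=1,\dots,\nu.$$ Let $\eta:[0,T]\times D([0,T],\mathbb R^\nu)\to\mathbb R^\nu$ be an admissible functional integrand. Then $$(t,Z)\longmapsto\sum_{\ell=1}^\nu\eta_\ell\big(t,F(\cdot,Z,A)\big)\nabla_XF_\ell(t,Z,A),\qquad Z\in D([0,T],U),$$ is an admissible functional integrand and, for every $t\in[0,T]$ (in particular for $t=T$), the two Itô integrals below exist, the Lebesgue–Stieltjes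 integrands are integrable, and $$\begin{aligned}\int_0^t\eta(s,Y)\,dY(s)&=\int_0^t\sum_{\ell=1}^\nu\eta_\ell\big(s,F(\cdot,X,A)\big)\nabla_XF_\ell(s,X,A)\,dX(s)\\&\quad+\sum_{\ell=1}^\nu\bigg(\sum_{i=0}^m\int_0^t\eta_\ell(s,Y)\,\mathscr D_iF_\ell(s,X,A)\,dA_i(s)+\frac12\sum_{i,j=1}^d\int_0^t\eta_\ell(s,Y)\,\partial_{ij}F_\ell(s,X,A)\,d[X_i,X_j](s)\bigg).\end{aligned}$$ -/

import Mathlib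

open MeasureTheory Filter Topology

noncomputable section

namespace FunctionalIto

/-- The time interval `[0,T]`. -/
abbrev Time (T : ℝ) : Type := Set.Icc (0 : ℝ) T

/-- Euclidean space `ℝ^d`. -/
abbrev E (d : ℕ) : Type := EuclideanSpace ℝ (Fin d)

/-- Arbitrary functions `[0,T] → ℝ^d`; the path spaces are singled out by predicates below. -/
abbrev PathFn (T : ℝ) (d : ℕ) : Type := Time T → E d

/-- Functionals of `(t, X, A)`. Only the values at `X ∈ D([0,T],U)` and `A ∈ CBV([0,T],S)` matter:
every notion below refers to these values only. -/
abbrev Functional (T : ℝ) (d m : ℕ) : Type := Time T → PathFn T d → PathFn T m → ℝ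

variable {T : ℝ} {d m ν : ℕ}

/-! ### Path spaces -/

/-- `X ∈ D([0,T],V)`: càdlàg and `V`-valued, with left limits in `V`. (At time `0` the condition on
the left limit is void as soon as `V` is non-empty, because `𝓝[<] 0 = ⊥`.) -/
structure IsCadlag (V : Set (E d)) (X : PathFn T d) : Prop where
  mem : ∀ t, X t ∈ V
  right : ∀ t, ContinuousWithinAt X (Set.Ici t) t
  left : ∀ t, ∃ l ∈ V, Tendsto X (𝓝[<] t) (𝓝 l)

/-- `A ∈ CBV([0,T],S)`: continuous, `S`-valued, with components of bounded variation. -/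
structure IsCBV (S : Set (E m)) (A : PathFn T m) : Prop where
  mem : ∀ t, A t ∈ S
  cont : Continuous A
  bv : ∀ i, BoundedVariationOn (fun t => A t i) Set.univ

/-- The path `X^t` stopped at `t`. -/
def stopped (X : PathFn T d) (t : Time T) : PathFn T d := fun s => X (min t s)

/-- The path `X + v 1_{[t,T]}`. -/
def bump (X : PathFn T d) (t : Time T) (v : E d) : PathFn T d :=
  fun s => X s + if t ≤ s then v else 0

/-- The supremum norm (the paths it is applied to are bounded). -/
def supNorm (X : PathFn T d) : ℝ := ⨆ u, ‖X u‖

/-! ### Regularity of functionals -/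

section Regularity

variable (U : Set (E d)) (S : Set (E m)) (F : Functional T d m)

def NonAnticipative : Prop :=
  ∀ t X A, IsCadlag U X → IsCBV S A → F t X A = F t (stopped X t) (stopped A t)

def BoundednessPreserving : Prop :=
  ∀ A, IsCBV S A → ∀ K ⊆ U, IsCompact K →
    ∃ C : ℝ, ∀ t X, IsCadlag K X → |F t X A| ≤ C

def ContinuousAtFixedTimes : Prop :=
  ∀ ε > (0 : ℝ), ∀ t X A, IsCadlag U X → IsCBV S A →
    ∃ δ > (0 : ℝ), ∀ Y, IsCadlag U Y → supNorm (stopped X t - stopped Y t) < δ →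
      |F t X A - F t Y A| < ε

/-- Left-continuity; the time `s` below is `t - h` with `0 ≤ h < δ`. -/
def LeftContinuous : Prop :=
  ∀ t : Time T, (0 : ℝ) < t → ∀ ε > (0 : ℝ), ∀ X A, IsCadlag U X → IsCBV S A →
    ∃ δ > (0 : ℝ), ∀ s ≤ t, (t : ℝ) - s < δ → ∀ Y, IsCadlag U Y →
      supNorm (stopped X t - stopped Y s) < δ → |F t X A - F s Y A| < ε

/-- Continuity in `X` locally uniformly in `t`. -/
def ContinuousLocallyUniformly : Prop :=
  ∀ ε > (0 : ℝ), ∀ (t : Time T) X A, IsCadlag U X → IsCBV S A →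
    ∃ δ > (0 : ℝ), ∀ (u : Time T) Y, IsCadlag U Y → supNorm (X - Y) < δ → |(t : ℝ) - u| < δ →
      |F u X A - F u Y A| < ε

end Regularity

/-! ### Lebesgue–Stieltjes integrals -/

instance : CompactIccSpace (Time T) where
  isCompact_Icc {_ _} := IsClosed.isCompact isClosed_Icc

open Classical in
/-- The signed measure `dg` on `[0,T]` of a function `g` of bounded variation. -/
def stieltjes (g : Time T → ℝ) : SignedMeasure (Time T) :=
  if h : BoundedVariationOn g Set.univ then h.vectorMeasure else 0

/-- The Lebesgue–Stieltjes integral `∫_J f dg`. All integrators below are continuous, so the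
end points of the interval `J` do not matter. -/
def lsIntegral (f g : Time T → ℝ) (J : Set (Time T)) : ℝ :=
  ((stieltjes g).restrict J).integral f (ContinuousLinearMap.lsmul ℝ ℝ)

/-- `f` is integrable over `J` with respect to (the total variation of) `dg`. -/
def LSIntegrable (f g : Time T → ℝ) (J : Set (Time T)) : Prop :=
  (stieltjes g).IntegrableOn f J

/-! ### Functional derivatives -/

/-- The integrators `A_0, A_1, …, A_m`, where `A_0(r) = r`. -/
def withTime (A : PathFn T m) : Fin (m + 1) → Time T → ℝ :=
  Fin.cons (fun r => (r : ℝ)) (fun i r => A r i)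

/-- `D = (D_0, …, D_m)` is a horizontal derivative of `F`. -/
structure IsHorizontalDeriv (U : Set (E d)) (S : Set (E m)) (F : Functional T d m)
    (D : Fin (m + 1) → Functional T d m) : Prop where
  nonAnticipative : ∀ i, NonAnticipative U S (D i)
  boundednessPreserving : ∀ i, BoundednessPreserving U S (D i)
  measurable : ∀ i s t X A, s < t → IsCadlag U X → IsCBV S A →
    Measurable fun r : Set.Icc s t => D i r (stopped X s) A
  integral_eq : ∀ s t X A, s < t → IsCadlag U X → IsCBV S A →
    F t (stopped X s) A - F s (stopped X s) A
      = ∑ i, lsIntegral (fun r => D i r (stopped X s) A) (withTime A i) (Set.Ioc s t)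

/-- `F` is vertically differentiable at all `(t, X, A)`. Since `U` is open and the range of a
path in `D([0,T],U)` is relatively compact in `U`, the perturbed path stays in `D([0,T],U)` for
small `v`. -/
def VerticallyDifferentiable (U : Set (E d)) (S : Set (E m)) (F : Functional T d m) : Prop :=
  ∀ t X A, IsCadlag U X → IsCBV S A →
    DifferentiableAt ℝ (fun v : E d => F t (bump X t v) (stopped A t)) 0

/-- The vertical derivative `∇_X F`. -/
def vgrad (F : Functional T d m) (t : Time T) (X : PathFn T d) (A : PathFn T m) : E d :=
  gradient (fun v : E d => F t (bump X t v) (stopped A t)) 0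

/-- The partial vertical derivative `∂_i F`; second derivatives are `∂_{ij} F = ∂_i (∂_j F)`. -/
def vpartial (i : Fin d) (F : Functional T d m) : Functional T d m :=
  fun t X A => vgrad F t X A i

/-- The class `ℂ^{1,2}_b(U,S)`. -/
structure MemC12b (U : Set (E d)) (S : Set (E m)) (F : Functional T d m) : Prop where
  nonAnticipative : NonAnticipative U S F
  leftContinuous : LeftContinuous U S F
  horizontal : ∃ D : Fin (m + 1) → Functional T d m,
    IsHorizontalDeriv U S F D ∧ ∀ i, ContinuousAtFixedTimes U S (D i)
  vertical : VerticallyDifferentiable U S F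
  vertical₂ : ∀ j, VerticallyDifferentiable U S (vpartial j F)
  vpartial_leftContinuous : ∀ i, LeftContinuous U S (vpartial i F)
  vpartial_boundednessPreserving : ∀ i, BoundednessPreserving U S (vpartial i F)
  vpartial₂_leftContinuous : ∀ i j, LeftContinuous U S (vpartial i (vpartial j F))
  vpartial₂_boundednessPreserving :
    ∀ i j, BoundednessPreserving U S (vpartial i (vpartial j F))

/-- The class `ℂ^{1,2}_c(U,S)`. -/
structure MemC12c (U : Set (E d)) (S : Set (E m)) (F : Functional T d m) : Prop
    extends MemC12b U S F where
  continuousLocallyUniformly : ContinuousLocallyUniformly U S F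
  boundednessPreserving : BoundednessPreserving U S F

/-- `ξ : [0,T] × D([0,T],U) → ℝ^d` is an admissible functional integrand. -/
def IsAdmissible (U : Set (E d)) (ξ : Time T → PathFn T d → E d) : Prop :=
  ∃ (m : ℕ) (S : Set (E m)) (A : PathFn T m) (F : Functional T d m),
    IsOpen S ∧ IsCBV S A ∧ MemC12c U S F ∧
      ∀ t X, IsCadlag U X → ξ t X = vgrad F t X A

/-! ### Partitions, quadratic variation and the pathwise Itô integral -/

/-- The smallest point of the partition `P` that is larger than `t` (and `t` if there is none). For
`t ∈ P` this is the successor `t'`, with `T' = T`. -/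
def succPt (P : Finset (Time T)) (t : Time T) : Time T :=
  if h : (P.filter (t < ·)).Nonempty then (P.filter (t < ·)).min' h else t

/-- A refining sequence of partitions of `[0,T]` with mesh tending to zero. -/
structure PartitionSeq (T : ℝ) where
  pts : ℕ → Finset (Time T)
  zero_mem : ∀ n, ∃ s ∈ pts n, (s : ℝ) = 0
  top_mem : ∀ n, ∃ s ∈ pts n, (s : ℝ) = T
  mono : Monotone pts
  mesh : ∀ ε > (0 : ℝ), ∀ᶠ n in atTop, ∀ s ∈ pts n, (succPt (pts n) s : ℝ) - s < ε

/-- The real-valued function `x` admits the continuous quadratic variation `q`. -/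
def HasQV (P : PartitionSeq T) (x q : Time T → ℝ) : Prop :=
  (∀ t : Time T, (0 : ℝ) < t → Tendsto
    (fun n => ∑ s ∈ (P.pts n).filter (· ≤ t), (x (succPt (P.pts n) s) - x s) ^ 2) atTop (𝓝 (q t)))
  ∧ (∀ t : Time T, (t : ℝ) = 0 → q t = 0) ∧ Continuous q

/-- The path `X` admits the continuous quadratic variation `Q = ([X_i,X_j])_{i,j}`: all `X_i + X_j`
and all `X_i` admit a continuous quadratic variation, and `Q` is given by polarization. -/
def HasCovariation (P : PartitionSeq T) (X : PathFn T d) (Q : Fin d → Fin d → Time T → ℝ) : Prop :=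
  ∃ (q₂ : Fin d → Fin d → Time T → ℝ) (q₁ : Fin d → Time T → ℝ),
    (∀ i j, HasQV P (fun t => X t i + X t j) (q₂ i j)) ∧
    (∀ i, HasQV P (fun t => X t i) (q₁ i)) ∧
    ∀ i j t, Q i j t = (1 / 2) * (q₂ i j t - q₁ i t - q₁ j t)

/-- The approximating path `X^n = ∑_{s} X(s') 1_{[s,s')} + X(T) 1_{{T}}`: for `t ∈ [s,s')` the
point `s'` is the smallest partition point larger than `t`. -/
def approx (P : Finset (Time T)) (X : PathFn T d) : PathFn T d := fun t => X (succPt P t)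

/-- The path `X^{n,s-}` for a partition point `s`: it equals `X^n` before `s` and stays from `s` on
at the left limit `X^n(s-)`, which is `X(s)`. (For `s = 0` it is the constant path `X(0)`.) -/
def approxLeft (P : Finset (Time T)) (X : PathFn T d) (s : Time T) : PathFn T d :=
  fun u => if u < s then approx P X u else X s

/-- The pathwise Itô integral `∫_0^t ξ(s,X) dX(s)` along `P` exists and equals `L`. -/
def HasItoIntegral (P : PartitionSeq T) (ξ : Time T → PathFn T d → E d) (X : PathFn T d)
    (t : Time T) (L : ℝ) : Prop :=
  Tendsto (fun n => ∑ s ∈ (P.pts n).filter (· ≤ t),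
    inner ℝ (ξ s (approxLeft (P.pts n) X s)) (X (succPt (P.pts n) s) - X s)) atTop (𝓝 L)

/-! ### Composition -/

/-- The path `t ↦ F(t,X,A) = (F_1(t,X,A), …, F_ν(t,X,A))`. -/
def imagePath (F : Fin ν → Functional T d m) (X : PathFn T d) (A : PathFn T m) : PathFn T ν :=
  fun t => WithLp.toLp 2 fun l => F l t X A

/-- The functional `(t,X) ↦ ∑_ℓ η_ℓ(t, F(·,X,A)) ∇_X F_ℓ(t,X,A)`. -/
def pullbackIntegrand (η : Time T → PathFn T ν → E ν) (F : Fin ν → Functional T d m) (A : PathFn T m) :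
    Time T → PathFn T d → E d :=
  fun t X => ∑ l, η t (imagePath F X A) l • vgrad (F l) t X A

end FunctionalIto

end

open FunctionalIto

noncomputable section

namespace FunctionalIto

variable {T : ℝ}

/-! ### Lebesgue–Stieltjes integrals with continuous integrators -/

/-! An admissible integrand is η = ∇G(·,·,B), so everything reduces to the composed functional
H(t,X,(A,B)) = G(t,F(·,X,A),B), whose values along X are those of G along Y. Once H is known to lie
in ℂ^{1,2}_c, the functional Itô formula applies to G along Y and to H along X, and both expand the
same increment G(t,Y,B) − G(0,Y,B). The vertical chain rule ∇H = ∑ ∂_l G ∇F_l identifies the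
gradient of H with the pulled-back integrand, and comparing the two expansions gives the correction
terms. The integrals of the horizontal derivatives of G occur in both and drop out; the terms with
∂_{kl}G drop out by the assumed formula for [Y] and associativity of Stieltjes integrals
(`lsIntegral_covariation_imagePath`, `sum_rearrange`).

The Itô formula (`ito_formula`) telescopes the functional along the approximating paths. Each step
is a jump at a partition point r, expanded by Taylor with Lagrange remainder, followed by a
horizontal move over (r, r'] along a path that is constant from r on. The second-order integrands
are only controlled from the left, so their sums against squared increments do not converge by weak
convergence alone; `LeftUniformTendsto.tendsto_sum_weights` shows instead that the coarse intervals
on which they oscillate carry vanishing mass.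

That H is regular is `MemC12c.comp`. Vertically this is the ordinary chain rule, because up to time
t a bump of X at t becomes a bump of the image path at t. Horizontally it is subtler: when X is
stopped at s, the image path u ↦ F(u,X^s,A) keeps moving after s. From s on it is continuous and of
bounded variation, so it has no quadratic variation there and the Itô formula becomes a Stieltjes
change of variables (`comp_frozen_eq`). Before s the image path is merely càdlàg, which is why
`ito_formula` only asks for continuity from a time s₀ on that belongs to all partitions. -/

instance isFiniteMeasure_variation {X : Type*} [MeasurableSpace X] (μ : SignedMeasure X) :
    IsFiniteMeasure μ.variation := by
  rw [← SignedMeasure.totalVariation_eq_variation]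
  infer_instance

/-- A continuous function of bounded variation on `[0,T]`. -/
structure IsContBV (g : Time T → ℝ) : Prop where
  cont : Continuous g
  bv : BoundedVariationOn g Set.univ

theorem stieltjes_Ioc {g : Time T → ℝ} (hg : IsContBV g) {a b : Time T} (h : a ≤ b) :
    stieltjes g (Set.Ioc a b) = g b - g a := by
  rw [stieltjes, dif_pos hg.bv, hg.bv.vectorMeasure_Ioc h]
  rw [hg.cont.continuousAt.continuousWithinAt.rightLim_eq,
    hg.cont.continuousAt.continuousWithinAt.rightLim_eq]

theorem stieltjes_singleton {g : Time T → ℝ} (hg : IsContBV g) (a : Time T) :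
    stieltjes g {a} = 0 := by
  rw [stieltjes, dif_pos hg.bv, hg.bv.vectorMeasure_singleton]
  rw [hg.cont.continuousAt.continuousWithinAt.rightLim_eq,
    hg.cont.continuousAt.continuousWithinAt.leftLim_eq, sub_self]

theorem variation_singleton_eq_zero {X : Type*} [MeasurableSpace X] [MeasurableSingletonClass X]
    {μ : SignedMeasure X} {a : X} (h : μ {a} = 0) : μ.variation {a} = 0 := by
  have h1 := VectorMeasure.variation_restrict (μ := μ) (MeasurableSet.singleton a)
  rw [VectorMeasure.restrict_singleton, h, VectorMeasure.variation_dirac] at h1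
  have h2 := congrArg (fun ν : Measure X => ν {a}) h1
  simpa using h2.symm

/-- Continuity of the integrator excludes atoms. Hence convergence of integrands may fail at
countably many times, and end points of intervals can be ignored. -/
theorem variation_stieltjes_countable {g : Time T → ℝ} (hg : IsContBV g) {N : Set (Time T)}
    (hN : N.Countable) : (stieltjes g).variation N = 0 := by
  rw [← Set.biUnion_of_singleton N, measure_biUnion_null_iff hN]
  exact fun a _ => variation_singleton_eq_zero (stieltjes_singleton hg a)

/-- The rays (−∞, b] form a generating π-system, the whole interval is the ray ending at T, and each
ray is the bottom point together with some (o, b]. -/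
theorem signedMeasure_ext_of_Ioc {μ ν : SignedMeasure (Time T)} {o : Time T} (ho : IsBot o)
    (h₀ : μ {o} = ν {o}) (h : ∀ b, μ (Set.Ioc o b) = ν (Set.Ioc o b)) : μ = ν := by
  have hI : ∀ b, Set.Iic b = {o} ∪ Set.Ioc o b := by
    intro b; ext x
    simp only [Set.mem_Iic, Set.mem_union, Set.mem_singleton_iff, Set.mem_Ioc]
    constructor
    · intro hx
      rcases eq_or_lt_of_le (ho x) with h | h
      · exact Or.inl h.symm
      · exact Or.inr ⟨h, hx⟩
    · rintro (rfl | h)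
      · exact ho b
      · exact h.2
  have hb : ∀ b, μ (Set.Iic b) = ν (Set.Iic b) := by
    intro b
    rw [hI b, VectorMeasure.of_union (by simp) (by simp) measurableSet_Ioc,
      VectorMeasure.of_union (by simp) (by simp) measurableSet_Ioc, h₀, h]
  refine VectorMeasure.ext_of_generateFrom (Set.range Set.Iic) ?_ ?_ isPiSystem_Iic ?_
  · rintro _ ⟨b, rfl⟩; exact hb b
  · rw [← borel_eq_generateFrom_Iic]; exact BorelSpace.measurable_eq
  · have hT : 0 ≤ T := o.2.1.trans o.2.2
    have : (Set.univ : Set (Time T)) = Set.Iic ⟨T, hT, le_rfl⟩ := by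
      ext x; simpa using Subtype.coe_le_coe.1 x.2.2
    rw [this, hb]

/-! ### Bounded Borel integrands -/

/-- `f` is Borel measurable and bounded on `J`. -/
structure BddMeasOn (f : Time T → ℝ) (J : Set (Time T)) : Prop where
  meas : Measurable (J.indicator f)
  bdd : ∃ C, ∀ x ∈ J, |f x| ≤ C

namespace BddMeasOn

variable {f f₁ f₂ : Time T → ℝ} {J J' : Set (Time T)}

theorem mono (h : BddMeasOn f J) (hJ' : MeasurableSet J') (hJJ : J' ⊆ J) : BddMeasOn f J' := by
  refine ⟨?_, h.bdd.imp fun C hC x hx => hC x (hJJ hx)⟩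
  have := h.meas.indicator hJ'
  rwa [Set.indicator_indicator, Set.inter_eq_left.2 hJJ] at this

theorem congr (h : BddMeasOn f₁ J) (he : Set.EqOn f₁ f₂ J) : BddMeasOn f₂ J := by
  obtain ⟨C, hC⟩ := h.bdd
  exact ⟨by rw [← Set.indicator_congr he]; exact h.meas, C, fun x hx => he hx ▸ hC x hx⟩

theorem const (hJ : MeasurableSet J) (c : ℝ) : BddMeasOn (fun _ => c) J :=
  ⟨measurable_const.indicator hJ, |c|, fun _ _ => le_rfl⟩

theorem add (h₁ : BddMeasOn f₁ J) (h₂ : BddMeasOn f₂ J) :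
    BddMeasOn (fun x => f₁ x + f₂ x) J := by
  obtain ⟨C₁, hC₁⟩ := h₁.bdd
  obtain ⟨C₂, hC₂⟩ := h₂.bdd
  refine ⟨?_, C₁ + C₂, fun x hx => (abs_add_le _ _).trans (add_le_add (hC₁ x hx) (hC₂ x hx))⟩
  have := h₁.meas.add h₂.meas
  rwa [← Set.indicator_add'] at this

theorem mul (h₁ : BddMeasOn f₁ J) (h₂ : BddMeasOn f₂ J) :
    BddMeasOn (fun x => f₁ x * f₂ x) J := by
  obtain ⟨C₁, hC₁⟩ := h₁.bdd
  obtain ⟨C₂, hC₂⟩ := h₂.bdd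
  refine ⟨?_, C₁ * C₂, fun x hx => ?_⟩
  · have := h₁.meas.mul h₂.meas
    convert this using 1
    rw [Set.indicator_mul]; rfl
  · rw [abs_mul]
    exact mul_le_mul (hC₁ x hx) (hC₂ x hx) (abs_nonneg _) ((abs_nonneg _).trans (hC₁ x hx))

theorem sum {ι : Type*} (s : Finset ι) {f : ι → Time T → ℝ} (hJ : MeasurableSet J)
    (h : ∀ i ∈ s, BddMeasOn (f i) J) : BddMeasOn (fun x => ∑ i ∈ s, f i x) J := by
  classical
  induction s using Finset.induction_on with
  | empty => simpa using const hJ 0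
  | insert a s ha ih =>
    simp only [Finset.sum_insert ha]
    exact (h a (by simp)).add (ih fun i hi => h i (by simp [hi]))

theorem integrable_indicator (h : BddMeasOn f J) (μ : SignedMeasure (Time T)) :
    μ.Integrable (J.indicator f) := by
  obtain ⟨C, hC⟩ := h.bdd
  refine Integrable.of_bound h.meas.aestronglyMeasurable |C| (Eventually.of_forall fun x => ?_)
  by_cases hx : x ∈ J
  · simpa [hx] using (hC x hx).trans (le_abs_self C)
  · simp [hx]

theorem integrableOn (h : BddMeasOn f J) (hJ : MeasurableSet J) (μ : SignedMeasure (Time T)) :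
    μ.IntegrableOn f J :=
  (VectorMeasure.integrable_indicator_iff hJ).1 (h.integrable_indicator μ)

/-- Adding one point to the domain preserves measurability and boundedness. -/
theorem insert (h : BddMeasOn f J) (a : Time T) : BddMeasOn f (insert a J) := by
  obtain ⟨C, hC⟩ := h.bdd
  refine ⟨?_, max C |f a|, ?_⟩
  · have : (Insert.insert a J).indicator f
        = ({a} : Set (Time T)).piecewise (fun _ => f a) (J.indicator f) := by
      ext x
      by_cases hx : x = a
      · subst hx; simp
      · by_cases hJ : x ∈ J <;> simp [hx, hJ]
    rw [this]
    exact Measurable.piecewise (by simp) measurable_const h.meas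
  · rintro x (rfl | hx)
    · exact le_max_right _ _
    · exact (hC x hx).trans (le_max_left _ _)

/-- Restriction of a function that is measurable on `J` to a subtype inside `J`. -/
theorem measurable_comp {J' : Set (Time T)} (h : BddMeasOn f J) (hJ : J' ⊆ J) :
    Measurable fun x : J' => f x := by
  have := h.meas.comp (measurable_subtype_coe (p := (· ∈ J')))
  convert this using 1
  ext x
  simp [hJ x.2]

end BddMeasOn

theorem lsIntegral_eq_indicator (f g : Time T → ℝ) {J : Set (Time T)} (hJ : MeasurableSet J) :
    lsIntegral f g J
      = (stieltjes g).integral (J.indicator f) (ContinuousLinearMap.lsmul ℝ ℝ) :=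
  (VectorMeasure.integral_indicator hJ).symm

theorem lsIntegral_congr {f₁ f₂ : Time T → ℝ} (g : Time T → ℝ) {J : Set (Time T)}
    (h : Set.EqOn f₁ f₂ J) : lsIntegral f₁ g J = lsIntegral f₂ g J :=
  VectorMeasure.setIntegral_congr_fun h

theorem lsIntegral_add {f₁ f₂ : Time T → ℝ} (g : Time T → ℝ) {J : Set (Time T)}
    (hJ : MeasurableSet J) (h₁ : BddMeasOn f₁ J) (h₂ : BddMeasOn f₂ J) :
    lsIntegral (fun x => f₁ x + f₂ x) g J = lsIntegral f₁ g J + lsIntegral f₂ g J :=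
  VectorMeasure.integral_fun_add (h₁.integrableOn hJ _) (h₂.integrableOn hJ _)

theorem lsIntegral_sum {ι : Type*} (s : Finset ι) {f : ι → Time T → ℝ} (g : Time T → ℝ)
    {J : Set (Time T)} (hJ : MeasurableSet J) (h : ∀ i ∈ s, BddMeasOn (f i) J) :
    lsIntegral (fun x => ∑ i ∈ s, f i x) g J = ∑ i ∈ s, lsIntegral (f i) g J :=
  VectorMeasure.integral_finsetSum s fun i hi => (h i hi).integrableOn hJ _

theorem lsIntegral_const_mul (c : ℝ) (f g : Time T → ℝ) (J : Set (Time T)) :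
    lsIntegral (fun x => c * f x) g J = c * lsIntegral f g J :=
  VectorMeasure.integral_fun_smul _ _ c f

theorem lsIntegral_zero_left (g : Time T → ℝ) (J : Set (Time T)) :
    lsIntegral (fun _ => 0) g J = 0 :=
  VectorMeasure.integral_zero

theorem lsIntegral_Ioc_one {g : Time T → ℝ} (hg : IsContBV g) {a b : Time T} (h : a ≤ b) :
    lsIntegral (fun _ => 1) g (Set.Ioc a b) = g b - g a := by
  rw [lsIntegral, VectorMeasure.integral_const]
  simp [VectorMeasure.restrict_apply, measurableSet_Ioc, stieltjes_Ioc hg h]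

theorem lsIntegral_congr_set {f g : Time T → ℝ} (hg : IsContBV g) {J J' : Set (Time T)}
    (hJ : MeasurableSet J) (hJ' : MeasurableSet J') {N : Set (Time T)} (hN : N.Countable)
    (h : ∀ x ∉ N, x ∈ J ↔ x ∈ J') : lsIntegral f g J = lsIntegral f g J' := by
  refine VectorMeasure.setIntegral_congr_set hJ hJ' ?_
  filter_upwards [measure_eq_zero_iff_ae_notMem.1 (variation_stieltjes_countable hg hN)]
    with x hx using propext (h x hx)

theorem lsIntegral_indicator {f g : Time T → ℝ} {J J' : Set (Time T)}
    (hJ : MeasurableSet J) (hJ' : MeasurableSet J') :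
    lsIntegral (J'.indicator f) g J = lsIntegral f g (J ∩ J') :=
  VectorMeasure.setIntegral_indicator hJ hJ'

/-- Dominated convergence, allowing a countable exceptional set. -/
theorem tendsto_lsIntegral {ι : Type*} {l : Filter ι} [l.IsCountablyGenerated]
    {f : ι → Time T → ℝ} {f' g : Time T → ℝ} (hg : IsContBV g) {J N : Set (Time T)}
    (hJ : MeasurableSet J) (hN : N.Countable)
    (hf : ∀ᶠ n in l, Measurable (J.indicator (f n))) {C : ℝ}
    (hC : ∀ᶠ n in l, ∀ x ∈ J, |f n x| ≤ C)
    (h : ∀ x ∈ J, x ∉ N → Tendsto (fun n => f n x) l (𝓝 (f' x))) :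
    Tendsto (fun n => lsIntegral (f n) g J) l (𝓝 (lsIntegral f' g J)) := by
  simp only [lsIntegral_eq_indicator _ g hJ]
  refine VectorMeasure.tendsto_integral_filter_of_norm_le_const
    (hf.mono fun n hn => hn.aestronglyMeasurable)
    ⟨|C|, hC.mono fun n hn => Eventually.of_forall fun x => ?_⟩ ?_
  · by_cases hx : x ∈ J
    · simpa [hx] using (hn x hx).trans (le_abs_self C)
    · simp [hx]
  · filter_upwards [measure_eq_zero_iff_ae_notMem.1 (variation_stieltjes_countable hg hN)]
      with x hx
    by_cases hxJ : x ∈ J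
    · simpa [hxJ] using h x hxJ hx
    · simpa [hxJ] using tendsto_const_nhds

/-- For indicators this is the definition of the density; linearity extends it to simple functions,
and dominated convergence along bounded simple approximations to bounded measurable f. -/
theorem integral_withDensity_lsmul {X : Type*} [MeasurableSpace X] (μ : SignedMeasure X)
    {f k : X → ℝ} (hk : μ.Integrable k) (hf : Measurable f) {C : ℝ} (hC : ∀ x, |f x| ≤ C) :
    (μ.withDensity k (ContinuousLinearMap.lsmul ℝ ℝ)).integral f (ContinuousLinearMap.lsmul ℝ ℝ)
      = μ.integral (fun x => f x * k x) (ContinuousLinearMap.lsmul ℝ ℝ) := by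
  have hbi : ∀ (g : X → ℝ), Measurable g → (∃ c, ∀ x, |g x| ≤ c) →
      μ.Integrable (fun x => g x * k x) := by
    rintro g hg ⟨c, hc⟩
    exact hk.bdd_mul hg.aestronglyMeasurable (Eventually.of_forall hc)
  have hbi' : ∀ (ν : SignedMeasure X) (g : X → ℝ), Measurable g → (∃ c, ∀ x, |g x| ≤ c) →
      ν.Integrable g := by
    rintro ν g hg ⟨c, hc⟩
    exact Integrable.of_bound hg.aestronglyMeasurable c (Eventually.of_forall hc)
  have hbs : ∀ g : SimpleFunc X ℝ, ∃ c, ∀ x, |g x| ≤ c := by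
    intro g
    exact g.exists_forall_norm_le
  have hsimple : ∀ g : SimpleFunc X ℝ,
      (μ.withDensity k (ContinuousLinearMap.lsmul ℝ ℝ)).integral g (ContinuousLinearMap.lsmul ℝ ℝ)
      = μ.integral (fun x => g x * k x) (ContinuousLinearMap.lsmul ℝ ℝ) := by
    intro g
    induction g using SimpleFunc.induction with
    | const c hs =>
      rename_i s
      have h1 : (⇑(SimpleFunc.piecewise s hs (SimpleFunc.const X c) (SimpleFunc.const X 0)))
          = s.indicator (fun _ => c) := by
        ext x; by_cases hx : x ∈ s <;> simp [hx]
      have h2 : (fun x => s.indicator (fun _ => c) x * k x)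
          = s.indicator (fun x => c * k x) := by
        ext x; by_cases hx : x ∈ s <;> simp [hx]
      rw [h1, h2, VectorMeasure.integral_indicator hs, VectorMeasure.integral_indicator hs,
        VectorMeasure.integral_const, VectorMeasure.restrict_apply _ hs MeasurableSet.univ,
        Set.univ_inter, VectorMeasure.withDensity_apply hk]
      exact (VectorMeasure.integral_fun_smul _ _ c k).symm
    | @add g₁ g₂ _ h₁ h₂ =>
      have e1 : (⇑(g₁ + g₂) : X → ℝ) = fun x => g₁ x + g₂ x := rfl
      rw [e1, VectorMeasure.integral_fun_add (hbi' _ _ g₁.measurable (hbs g₁))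
        (hbi' _ _ g₂.measurable (hbs g₂)), h₁, h₂]
      simp only [add_mul]
      rw [VectorMeasure.integral_fun_add (hbi _ g₁.measurable (hbs g₁))
        (hbi _ g₂.measurable (hbs g₂))]
  have hsm := hf.stronglyMeasurable
  have hlim : ∀ x, Tendsto (fun n => hsm.approxBounded C n x) atTop (𝓝 (f x)) := fun x =>
    hsm.tendsto_approxBounded_of_norm_le (hC x)
  have hle : ∀ n x, ‖hsm.approxBounded C n x‖ ≤ |C| := fun n x =>
    (hsm.norm_approxBounded_le (f := f)
      ((abs_nonneg (f x)).trans (hC x)) n x).trans (le_abs_self C)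
  have L1 : Tendsto (fun n => (μ.withDensity k (ContinuousLinearMap.lsmul ℝ ℝ)).integral
      (hsm.approxBounded C n) (ContinuousLinearMap.lsmul ℝ ℝ)) atTop
      (𝓝 ((μ.withDensity k (ContinuousLinearMap.lsmul ℝ ℝ)).integral f
        (ContinuousLinearMap.lsmul ℝ ℝ))) :=
    VectorMeasure.tendsto_integral_of_dominated_convergence (fun _ => |C|)
      (fun n => (hsm.approxBounded C n).measurable.aestronglyMeasurable)
      (integrable_const _) (fun n => Eventually.of_forall (hle n)) (Eventually.of_forall hlim)
  have L2 : Tendsto (fun n => μ.integral (fun x => hsm.approxBounded C n x * k x)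
      (ContinuousLinearMap.lsmul ℝ ℝ)) atTop
      (𝓝 (μ.integral (fun x => f x * k x) (ContinuousLinearMap.lsmul ℝ ℝ))) :=
    VectorMeasure.tendsto_integral_of_dominated_convergence (fun x => |C| * ‖k x‖)
      (fun n => ((hsm.approxBounded C n).measurable.aestronglyMeasurable).mul
        hk.aestronglyMeasurable)
      (hk.norm.const_mul _) (fun n => Eventually.of_forall fun x => by
        rw [norm_mul]; exact mul_le_mul_of_nonneg_right (hle n x) (norm_nonneg _))
      (Eventually.of_forall fun x => (hlim x).mul_const _)
  simp only [hsimple] at L1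
  exact tendsto_nhds_unique L1 L2

/-- Associativity of the Lebesgue–Stieltjes integral. -/
theorem lsIntegral_assoc {ι : Type*} {s : Finset ι} {h : Time T → ℝ} {k g : ι → Time T → ℝ}
    {o : Time T} (ho : IsBot o) (hh : IsContBV h) (hg : ∀ i ∈ s, IsContBV (g i))
    (hk : ∀ i ∈ s, BddMeasOn (k i) Set.univ)
    (hint : ∀ b, h b - h o = ∑ i ∈ s, lsIntegral (k i) (g i) (Set.Ioc o b))
    {f : Time T → ℝ} {J : Set (Time T)} (hJ : MeasurableSet J) (hf : BddMeasOn f J) :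
    lsIntegral f h J = ∑ i ∈ s, lsIntegral (fun x => f x * k i x) (g i) J := by
  have hki : ∀ i ∈ s, (stieltjes (g i)).Integrable (k i) := fun i hi => by
    simpa using (hk i hi).integrable_indicator (stieltjes (g i))
  -- The hypothesis on increments becomes an identity of measures, dh = ∑ k_i dg_i, since both sides
  -- agree on {o} and on every (o, b].
  have hs : stieltjes h = ∑ i ∈ s,
      (stieltjes (g i)).withDensity (k i) (ContinuousLinearMap.lsmul ℝ ℝ) := by
    refine signedMeasure_ext_of_Ioc ho ?_ ?_
    · rw [stieltjes_singleton hh, FunLike.coe_sum, Finset.sum_apply]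
      refine (Finset.sum_eq_zero fun i hi => ?_).symm
      rw [VectorMeasure.withDensity_apply (hki i hi), VectorMeasure.integral_singleton,
        stieltjes_singleton (hg i hi)]
      simp
    · intro b
      rw [stieltjes_Ioc hh (ho b), hint, FunLike.coe_sum, Finset.sum_apply]
      refine Finset.sum_congr rfl fun i hi => ?_
      rw [VectorMeasure.withDensity_apply (hki i hi)]; rfl
  obtain ⟨C, hC⟩ := hf.bdd
  have hC' : ∀ x, |J.indicator f x| ≤ |C| := fun x => by
    by_cases hx : x ∈ J
    · simpa [hx] using (hC x hx).trans (le_abs_self C)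
    · simp [hx]
  rw [lsIntegral_eq_indicator _ _ hJ, hs, VectorMeasure.integral_finsetSum_vectorMeasure
    (fun i _ => hf.integrable_indicator _)]
  refine Finset.sum_congr rfl fun i hi => ?_
  rw [integral_withDensity_lsmul _ (hki i hi) hf.meas hC', lsIntegral_eq_indicator _ _ hJ]
  congr 1
  ext x
  by_cases hx : x ∈ J <;> simp [hx]

/-- Every variation sum of h is at most the corresponding sum of M, and a monotone function on a
compact interval has finite variation. -/
theorem bv_of_dominated {h M : Time T → ℝ} (hM : Monotone M)
    (hle : ∀ a b, a ≤ b → |h b - h a| ≤ M b - M a) : BoundedVariationOn h Set.univ := by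
  -- For T < 0 the time interval is empty.
  by_cases hT : 0 ≤ T
  swap
  · exact BoundedVariationOn.of_subsingleton fun a => absurd (a.2.1.trans a.2.2) hT
  have hMv : eVariationOn M Set.univ ≠ ⊤ := by
    have h1 := (hM.monotoneOn Set.univ).eVariationOn_eq (a := ⟨0, le_rfl, hT⟩)
      (b := ⟨T, hT, le_rfl⟩) trivial trivial
    have h2 : (Set.univ ∩ Set.Icc (⟨0, le_rfl, hT⟩ : Time T) ⟨T, hT, le_rfl⟩) = Set.univ := by
      ext x
      simpa using ⟨Subtype.coe_le_coe.1 x.2.1, Subtype.coe_le_coe.1 x.2.2⟩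
    rw [h2] at h1
    rw [h1]
    exact ENNReal.ofReal_ne_top
  refine ne_top_of_le_ne_top hMv (iSup_mono fun p => Finset.sum_le_sum fun i _ => ?_)
  rw [edist_dist, edist_dist, Real.dist_eq, Real.dist_eq]
  exact ENNReal.ofReal_le_ofReal ((hle _ _ (p.2.2.1 (Nat.le_succ i))).trans (le_abs_self _))

theorem isContBV_of_monotone {g : Time T → ℝ} (hg : Monotone g) (hc : Continuous g) : IsContBV g :=
  ⟨hc, bv_of_dominated hg fun _ _ hab => (abs_of_nonneg (sub_nonneg.2 (hg hab))).le⟩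

/-- The total variation of `g` on `[0,b]` dominates the increments of `g`. -/
theorem IsContBV.exists_dominating {g : Time T → ℝ} (hg : IsContBV g) :
    ∃ M : Time T → ℝ, Monotone M ∧ ∀ a b, a ≤ b → |g b - g a| ≤ M b - M a := by
  refine ⟨fun b => (stieltjes g).variation.real (Set.Iic b), fun a b hab =>
    measureReal_mono (Set.Iic_subset_Iic.2 hab), fun a b hab => ?_⟩
  have h1 : (stieltjes g).variation.real (Set.Ioc a b) = (stieltjes g).variation.real (Set.Iic b)
      - (stieltjes g).variation.real (Set.Iic a) := by
    rw [← Set.Iic_union_Ioc_eq_Iic hab, measureReal_union _ measurableSet_Ioc]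
    · ring
    · exact Set.disjoint_left.2 fun x hx hx' => hx'.1.not_ge hx
  rw [← h1, ← stieltjes_Ioc hg hab]
  exact VectorMeasure.norm_measure_le_variation (μ := stieltjes g) (measure_ne_top _ _)

theorem isContBV_sum {ι : Type*} (s : Finset ι) {g : ι → Time T → ℝ}
    (hg : ∀ i ∈ s, IsContBV (g i)) : IsContBV fun t => ∑ i ∈ s, g i t := by
  refine ⟨continuous_finsetSum _ fun i hi => (hg i hi).cont, ?_⟩
  choose! M hM hle using fun i (hi : i ∈ s) => (hg i hi).exists_dominating
  refine bv_of_dominated (M := fun t => ∑ i ∈ s, M i t)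
    (fun a b hab => Finset.sum_le_sum fun i hi => hM i hi hab) fun a b hab => ?_
  rw [← Finset.sum_sub_distrib, ← Finset.sum_sub_distrib]
  exact (Finset.abs_sum_le_sum_abs _ _).trans (Finset.sum_le_sum fun i hi => hle i hi a b hab)

/-- As c → b, the indicators of (o, c] converge to that of (o, b] except at b, which is a null
point; this gives continuity. Increments are dominated by the variation measure of k dg. -/
theorem isContBV_lsIntegral {k g : Time T → ℝ} (hg : IsContBV g) (hk : BddMeasOn k Set.univ)
    {o : Time T} (ho : IsBot o) : IsContBV fun b => lsIntegral k g (Set.Ioc o b) := by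
  obtain ⟨C, hC⟩ := hk.bdd
  constructor
  · rw [continuous_iff_continuousAt]
    intro b
    have : ∀ b, lsIntegral k g (Set.Ioc o b)
        = lsIntegral ((Set.Ioc o b).indicator k) g Set.univ := fun b => by
      rw [lsIntegral_indicator MeasurableSet.univ measurableSet_Ioc, Set.univ_inter]
    simp only [ContinuousAt, this]
    refine tendsto_lsIntegral hg MeasurableSet.univ (Set.countable_singleton b) ?_
      (C := |C|) ?_ ?_
    · refine Eventually.of_forall fun b => ?_
      simpa using (hk.mono measurableSet_Ioc (Set.subset_univ (Set.Ioc o b))).meas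
    · refine Eventually.of_forall fun b x _ => ?_
      by_cases hx : x ∈ Set.Ioc o b
      · simpa [Set.indicator_of_mem hx] using (hC x trivial).trans (le_abs_self C)
      · simp [Set.indicator_of_notMem hx]
    · intro x _ hx
      have hx : x ≠ b := hx
      refine tendsto_const_nhds.congr' ?_
      rcases lt_or_gt_of_ne hx with h | h
      · filter_upwards [lt_mem_nhds h] with c hc
        simp [Set.indicator_apply, h.le, hc.le]
      · filter_upwards [gt_mem_nhds h] with c hc
        simp [h.not_ge, hc.not_ge]
  · have hki : (stieltjes g).Integrable k := by
      simpa using hk.integrable_indicator (stieltjes g)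
    set ν := (stieltjes g).withDensity k (ContinuousLinearMap.lsmul ℝ ℝ) with hν
    refine bv_of_dominated (M := fun b => ν.variation.real (Set.Ioc o b))
      (fun a b hab => measureReal_mono (Set.Ioc_subset_Ioc_right hab)) fun a b hab => ?_
    have h0 : ∀ b, lsIntegral k g (Set.Ioc o b) = ν (Set.Ioc o b) := fun b => by
      rw [hν, VectorMeasure.withDensity_apply hki]; rfl
    have hd : Disjoint (Set.Ioc o a) (Set.Ioc a b) :=
      Set.disjoint_left.2 fun x hx hx' => hx'.1.not_ge hx.2
    rw [h0, h0, ← Set.Ioc_union_Ioc_eq_Ioc (ho a) hab, measureReal_union hd measurableSet_Ioc,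
      VectorMeasure.of_union hd measurableSet_Ioc measurableSet_Ioc, add_sub_cancel_left,
      add_sub_cancel_left]
    exact VectorMeasure.norm_measure_le_variation (μ := ν) (measure_ne_top _ _)

/-- An integral function is continuous and of bounded variation. -/
theorem isContBV_of_integral {ι : Type*} {s : Finset ι} {h : Time T → ℝ} {k g : ι → Time T → ℝ}
    (hg : ∀ i ∈ s, IsContBV (g i)) (hk : ∀ i ∈ s, BddMeasOn (k i) Set.univ) {o : Time T}
    (ho : IsBot o)
    (hint : ∀ b, h b - h o = ∑ i ∈ s, lsIntegral (k i) (g i) (Set.Ioc o b)) : IsContBV h := by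
  have h1 := isContBV_sum s fun i hi => isContBV_lsIntegral (hg i hi) (hk i hi) ho
  have h2 : h = fun b => h o + ∑ i ∈ s, lsIntegral (k i) (g i) (Set.Ioc o b) := by
    ext b; rw [← hint]; ring
  obtain ⟨M, hM, hle⟩ := h1.exists_dominating
  rw [h2]
  refine ⟨continuous_const.add h1.cont, bv_of_dominated hM fun a b hab => ?_⟩
  rw [add_sub_add_left_eq_sub]
  exact hle a b hab

end FunctionalIto

namespace FunctionalIto

variable {T : ℝ} {d m : ℕ}

/-! ### Paths -/

theorem supNorm_le {X : PathFn T d} {C : ℝ} (hC : 0 ≤ C) (h : ∀ u, ‖X u‖ ≤ C) : supNorm X ≤ C :=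
  Real.iSup_le h hC

theorem norm_le_supNorm {X : PathFn T d} {C : ℝ} (h : ∀ u, ‖X u‖ ≤ C) (u : Time T) :
    ‖X u‖ ≤ supNorm X :=
  le_ciSup (f := fun u => ‖X u‖) ⟨C, by rintro _ ⟨v, rfl⟩; exact h v⟩ u

theorem nhdsLT_sup_nhdsGE_time (t : Time T) : 𝓝[<] t ⊔ 𝓝[≥] t = 𝓝 t := nhdsLT_sup_nhdsGE t

namespace IsCadlag

variable {U V : Set (E d)} {X Y : PathFn T d}

theorem mono (h : IsCadlag V X) (hVU : V ⊆ U) : IsCadlag U X :=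
  ⟨fun t => hVU (h.mem t), h.right, fun t => (h.left t).imp fun _ hl => ⟨hVU hl.1, hl.2⟩⟩

theorem of_continuous (hX : Continuous X) (h : ∀ t, X t ∈ U) : IsCadlag U X :=
  ⟨h, fun _ => hX.continuousAt.continuousWithinAt, fun t =>
    ⟨X t, h t, hX.continuousAt.continuousWithinAt.tendsto⟩⟩

theorem const {x : E d} (h : x ∈ U) : IsCadlag (T := T) U (fun _ => x) :=
  of_continuous continuous_const fun _ => h

/-- An ultrafilter of times converges to some t either from the left or from the right. Along it X
tends to its left limit or to its value at t, and both lie in U; this puts all limit points of the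
range in U. Compactness itself comes from local boundedness and a finite cover of the time interval.
-/
theorem isCompact_closure_range (h : IsCadlag U X) :
    IsCompact (closure (Set.range X)) ∧ closure (Set.range X) ⊆ U := by
  have key : ∀ 𝓕 : Ultrafilter (Time T), ∃ x ∈ U, Tendsto X 𝓕 (𝓝 x) := by
    intro 𝓕
    obtain ⟨t, -, ht⟩ := isCompact_univ.ultrafilter_le_nhds (X := Time T) 𝓕 (by simp)
    rw [← nhdsLT_sup_nhdsGE_time t, Ultrafilter.le_sup_iff] at ht
    rcases ht with ht | ht
    · obtain ⟨l, hl, hl'⟩ := h.left t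
      exact ⟨l, hl, hl'.mono_left ht⟩
    · exact ⟨X t, h.mem t, (h.right t).tendsto.mono_left ht⟩
  constructor
  · refine IsCompact.closure_of_subset (K := closure (Set.range X)) ?_ subset_closure
    refine Metric.isCompact_of_isClosed_isBounded isClosed_closure (Bornology.IsBounded.closure ?_)
    rw [← Set.image_univ]
    refine isCompact_univ.induction_on (p := fun s => Bornology.IsBounded (X '' s)) (by simp)
      (fun s t hst ht => ht.subset (Set.image_mono hst))
      (fun s t hs ht => by rw [Set.image_union]; exact hs.union ht) fun t _ => ?_
    obtain ⟨l, -, hl⟩ := h.left t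
    have h1 := hl (Metric.ball_mem_nhds l one_pos)
    have h2 := (h.right t).tendsto (Metric.ball_mem_nhds (X t) one_pos)
    refine ⟨X ⁻¹' (Metric.ball l 1) ∪ X ⁻¹' (Metric.ball (X t) 1), ?_, ?_⟩
    · rw [nhdsWithin_univ, ← nhdsLT_sup_nhdsGE_time t]
      exact ⟨mem_of_superset h1 Set.subset_union_left,
        mem_of_superset h2 Set.subset_union_right⟩
    · rw [Set.image_union]
      exact (Metric.isBounded_ball.subset (Set.image_preimage_subset _ _)).union
        (Metric.isBounded_ball.subset (Set.image_preimage_subset _ _))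
  · intro x hx
    rw [mem_closure_iff_comap_neBot] at hx
    have hx' : (comap X (𝓝 x)).NeBot := by
      rw [comap_neBot_iff] at hx ⊢
      intro s hs
      obtain ⟨⟨_, t, rfl⟩, ht⟩ := hx s hs
      exact ⟨t, ht⟩
    obtain ⟨y, hy, hy'⟩ := key (Ultrafilter.of (comap X (𝓝 x)))
    have : Tendsto X (Ultrafilter.of (comap X (𝓝 x)) : Filter (Time T)) (𝓝 x) :=
      tendsto_comap.mono_left (Ultrafilter.of_le _)
    exact tendsto_nhds_unique this hy' ▸ hy

theorem exists_compact (h : IsCadlag U X) : ∃ K ⊆ U, IsCompact K ∧ IsCadlag K X := by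
  obtain ⟨h1, h2⟩ := h.isCompact_closure_range
  refine ⟨_, h2, h1, fun t => subset_closure ⟨t, rfl⟩, h.right, fun t => ?_⟩
  obtain ⟨l, -, hl⟩ := h.left t
  rcases (𝓝[<] t).eq_or_neBot with hb | hb
  · exact ⟨X t, subset_closure ⟨t, rfl⟩, by rw [hb]; exact tendsto_bot⟩
  · exact ⟨l, mem_closure_of_tendsto hl (Eventually.of_forall fun u => ⟨u, rfl⟩), hl⟩

theorem exists_bound (h : IsCadlag U X) : ∃ C, ∀ u, ‖X u‖ ≤ C := by
  obtain ⟨C, hC⟩ := h.isCompact_closure_range.1.isBounded.exists_norm_le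
  exact ⟨C, fun u => hC _ (subset_closure ⟨u, rfl⟩)⟩

/-- Gluing two càdlàg paths at time `r`. -/
theorem ite_lt (hX : IsCadlag U X) (hY : IsCadlag U Y) (r : Time T) :
    IsCadlag U (fun u => if u < r then X u else Y u) where
  mem t := by split_ifs; exacts [hX.mem t, hY.mem t]
  right t := by
    by_cases ht : t < r
    · refine (hX.right t).congr_of_eventuallyEq ?_ (by simp [ht])
      filter_upwards [mem_nhdsWithin_of_mem_nhds (Iio_mem_nhds ht)] with u hu
      simp [Set.mem_Iio.1 hu]
    · refine (hY.right t).congr (fun u hu => ?_) (by simp [ht])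
      simp [not_lt.2 ((not_lt.1 ht).trans hu)]
  left t := by
    by_cases ht : t ≤ r
    · obtain ⟨l, hl, h⟩ := hX.left t
      refine ⟨l, hl, h.congr' ?_⟩
      filter_upwards [self_mem_nhdsWithin] with u hu
      simp [lt_of_lt_of_le hu ht]
    · obtain ⟨l, hl, h⟩ := hY.left t
      refine ⟨l, hl, h.congr' ?_⟩
      filter_upwards [mem_nhdsWithin_of_mem_nhds (Ioi_mem_nhds (not_le.1 ht))] with u hu
      simp [not_lt.2 (Set.mem_Ioi.1 hu).le]

theorem stopped (h : IsCadlag U X) (t : Time T) : IsCadlag U (stopped X t) := by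
  convert h.ite_lt (const (h.mem t)) t using 1
  ext u : 1
  by_cases hu : u < t
  · simp [FunctionalIto.stopped, hu, hu.le]
  · simp [FunctionalIto.stopped, hu, not_lt.1 hu]

theorem add_const (h : IsCadlag V X) (v : E d) (hU : ∀ x ∈ V, x + v ∈ U) :
    IsCadlag U (fun u => X u + v) :=
  ⟨fun t => hU _ (h.mem t), fun t => (h.right t).add continuousWithinAt_const, fun t =>
    let ⟨l, hl, hl'⟩ := h.left t
    ⟨l + v, hU l hl, hl'.add_const v⟩⟩

theorem bump (h : IsCadlag V X) (t : Time T) (v : E d) (hVU : V ⊆ U) (hU : ∀ x ∈ V, x + v ∈ U) :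
    IsCadlag U (bump X t v) := by
  convert (h.mono hVU).ite_lt (h.add_const v hU) t using 1
  ext u : 1
  by_cases hu : u < t
  · simp [FunctionalIto.bump, hu, hu.not_ge]
  · simp [FunctionalIto.bump, hu, not_lt.1 hu]

theorem bump_cthickening {δ : ℝ} (h : IsCadlag V X) (t : Time T) {v : E d} (hv : ‖v‖ ≤ δ) :
    IsCadlag (Metric.cthickening δ V) (FunctionalIto.bump X t v) :=
  h.bump t v (Metric.self_subset_cthickening V) fun x hx =>
    Metric.mem_cthickening_of_dist_le (x + v) x δ V hx (by simpa using hv)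

theorem exists_bump (hU : IsOpen U) (h : IsCadlag U X) (t : Time T) :
    ∃ δ > 0, ∀ v, ‖v‖ ≤ δ → IsCadlag U (FunctionalIto.bump X t v) := by
  obtain ⟨K, hKU, hK, hX⟩ := h.exists_compact
  obtain ⟨δ, hδ, hδU⟩ := hK.exists_cthickening_subset_open hU hKU
  exact ⟨δ, hδ, fun v hv => (hX.bump_cthickening t hv).mono hδU⟩

theorem eventually_bump (hU : IsOpen U) (h : IsCadlag U X) (t : Time T) :
    ∀ᶠ v in 𝓝 (0 : E d), IsCadlag U (FunctionalIto.bump X t v) := by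
  obtain ⟨δ, hδ, h⟩ := h.exists_bump hU t
  filter_upwards [Metric.ball_mem_nhds 0 hδ] with v hv
  exact h v (by simpa using (Metric.mem_ball.1 hv).le)

theorem norm_sub_le_supNorm (hX : IsCadlag U X) (hY : IsCadlag V Y) (u : Time T) :
    ‖X u - Y u‖ ≤ supNorm (X - Y) := by
  obtain ⟨C, hC⟩ := hX.exists_bound
  obtain ⟨C', hC'⟩ := hY.exists_bound
  exact norm_le_supNorm (X := X - Y) (C := C + C')
    (fun u => (norm_sub_le _ _).trans (add_le_add (hC u) (hC' u))) u

end IsCadlag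

theorem stopped_stopped (X : PathFn T d) (s t : Time T) :
    stopped (stopped X s) t = stopped X (min s t) := by
  ext u : 1
  simp [stopped, min_assoc]

theorem stopped_stopped_self (X : PathFn T d) (t : Time T) :
    stopped (stopped X t) t = stopped X t := by
  rw [stopped_stopped, min_self]

theorem stopped_bump (X : PathFn T d) (t : Time T) (v : E d) :
    stopped (bump X t v) t = bump (stopped X t) t v := by
  ext u : 1
  by_cases h : t ≤ u <;> simp [stopped, bump, h]

theorem bump_zero (X : PathFn T d) (t : Time T) : bump X t 0 = X := by
  ext u : 1
  simp [bump]

theorem bump_bump (X : PathFn T d) (t : Time T) (v w : E d) :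
    bump (bump X t v) t w = bump X t (v + w) := by
  ext u : 1
  by_cases h : t ≤ u <;> simp [bump, h, add_assoc]

theorem IsCBV.stopped {S : Set (E m)} {A : PathFn T m} (h : IsCBV S A) (t : Time T) :
    IsCBV S (stopped A t) where
  mem _ := h.mem _
  cont := h.cont.comp (continuous_const.min continuous_id)
  bv i := ne_top_of_le_ne_top (h.bv i) (eVariationOn.comp_le_of_monotoneOn (fun t => A t i)
    (fun u => min t u) (fun _ _ _ _ hab => min_le_min_left t hab) (fun _ _ => trivial))

theorem IsCBV.isContBV_withTime {S : Set (E m)} {A : PathFn T m} (h : IsCBV S A)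
    (i : Fin (m + 1)) : IsContBV (withTime A i) := by
  refine Fin.cases ?_ (fun j => ?_) i
  · exact isContBV_of_monotone (fun a b hab => hab) continuous_subtype_val
  · exact ⟨(EuclideanSpace.proj (𝕜 := ℝ) j).continuous.comp h.cont, h.bv j⟩

/-! ### Partitions -/

/-- `P` is a partition of `[0,T]`, whose end points are called `o` and `e`. -/
structure IsPartition (P : Finset (Time T)) (o e : Time T) : Prop where
  bot : IsBot o
  top : IsTop e
  bot_mem : o ∈ P
  top_mem : e ∈ P

theorem PartitionSeq.isPartition (P : PartitionSeq T) {o e : Time T} (ho : IsBot o) (he : IsTop e)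
    (n : ℕ) : IsPartition (P.pts n) o e := by
  refine ⟨ho, he, ?_, ?_⟩
  · obtain ⟨s, hs, hs0⟩ := P.zero_mem n
    have : s = o := le_antisymm (Subtype.coe_le_coe.1 (hs0.trans_le o.2.1)) (ho s)
    exact this ▸ hs
  · obtain ⟨s, hs, hsT⟩ := P.top_mem n
    have : s = e := le_antisymm (he s) (Subtype.coe_le_coe.1 (e.2.2.trans_eq hsT.symm))
    exact this ▸ hs

/-- The largest point of `P` that is smaller than `t` (and `t` if there is none). -/
def prevPt (P : Finset (Time T)) (t : Time T) : Time T :=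
  if h : (P.filter (· < t)).Nonempty then (P.filter (· < t)).max' h else t

theorem le_succPt (P : Finset (Time T)) (u : Time T) : u ≤ succPt P u := by
  unfold succPt
  split_ifs with h
  · exact (Finset.mem_filter.1 (Finset.min'_mem _ h)).2.le
  · exact le_rfl

theorem succPt_le {P : Finset (Time T)} {u r : Time T} (hr : r ∈ P) (hur : u < r) :
    succPt P u ≤ r := by
  have hm : r ∈ P.filter (u < ·) := Finset.mem_filter.2 ⟨hr, hur⟩
  rw [succPt, dif_pos ⟨r, hm⟩]
  exact Finset.min'_le _ _ hm

theorem succPt_mem_and_lt {P : Finset (Time T)} {u r : Time T} (hr : r ∈ P) (hur : u < r) :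
    succPt P u ∈ P ∧ u < succPt P u := by
  have hm : r ∈ P.filter (u < ·) := Finset.mem_filter.2 ⟨hr, hur⟩
  rw [succPt, dif_pos ⟨r, hm⟩]
  exact Finset.mem_filter.1 (Finset.min'_mem _ _)

theorem prevPt_le (P : Finset (Time T)) (u : Time T) : prevPt P u ≤ u := by
  unfold prevPt
  split_ifs with h
  · exact (Finset.mem_filter.1 (Finset.max'_mem _ h)).2.le
  · exact le_rfl

theorem le_prevPt {P : Finset (Time T)} {u r : Time T} (hr : r ∈ P) (hur : r < u) :
    r ≤ prevPt P u := by
  have hm : r ∈ P.filter (· < u) := Finset.mem_filter.2 ⟨hr, hur⟩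
  rw [prevPt, dif_pos ⟨r, hm⟩]
  exact Finset.le_max' _ _ hm

theorem prevPt_mem_and_lt {P : Finset (Time T)} {u r : Time T} (hr : r ∈ P) (hur : r < u) :
    prevPt P u ∈ P ∧ prevPt P u < u := by
  have hm : r ∈ P.filter (· < u) := Finset.mem_filter.2 ⟨hr, hur⟩
  rw [prevPt, dif_pos ⟨r, hm⟩]
  exact Finset.mem_filter.1 (Finset.max'_mem _ _)

theorem succPt_eq {P : Finset (Time T)} {r u : Time T} (h₁ : r ≤ u) (h₂ : u < succPt P r) :
    succPt P u = succPt P r := by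
  have hr : ∃ q ∈ P, r < q := by
    by_contra! h
    have : succPt P r = r := by
      rw [succPt, dif_neg]
      rintro ⟨q, hq⟩
      exact (h q (Finset.mem_filter.1 hq).1).not_gt (Finset.mem_filter.1 hq).2
    exact (h₁.trans_lt h₂).ne' this
  obtain ⟨q, hq, hrq⟩ := hr
  have h3 := (succPt_mem_and_lt hq hrq).1
  refine le_antisymm (succPt_le h3 h₂) ?_
  have h4 := succPt_mem_and_lt h3 h₂
  exact succPt_le h4.1 (h₁.trans_lt h4.2)

namespace IsPartition

variable {P : Finset (Time T)} {o e : Time T}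

theorem succPt_mem (hP : IsPartition P o e) (u : Time T) : succPt P u ∈ P := by
  rcases eq_or_lt_of_le (hP.top u) with h | h
  · have : succPt P u = u := le_antisymm (h ▸ hP.top _) (le_succPt P u)
    rw [this, h]; exact hP.top_mem
  · exact (succPt_mem_and_lt hP.top_mem h).1

theorem lt_succPt (hP : IsPartition P o e) {u : Time T} (h : u < e) : u < succPt P u :=
  (succPt_mem_and_lt hP.top_mem h).2

theorem succPt_top (hP : IsPartition P o e) : succPt P e = e :=
  le_antisymm (hP.top _) (le_succPt P e)

theorem prevPt_mem (hP : IsPartition P o e) (u : Time T) : prevPt P u ∈ P := by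
  rcases eq_or_lt_of_le (hP.bot u) with h | h
  · have : prevPt P u = u := le_antisymm (prevPt_le P u) (h ▸ hP.bot _)
    rw [this, ← h]; exact hP.bot_mem
  · exact (prevPt_mem_and_lt hP.bot_mem h).1

theorem prevPt_lt (hP : IsPartition P o e) {u : Time T} (h : o < u) : prevPt P u < u :=
  (prevPt_mem_and_lt hP.bot_mem h).2

theorem prevPt_bot (hP : IsPartition P o e) : prevPt P o = o :=
  le_antisymm (prevPt_le P o) (hP.bot _)

theorem le_succPt_prevPt (hP : IsPartition P o e) (u : Time T) : u ≤ succPt P (prevPt P u) := by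
  rcases eq_or_lt_of_le (hP.bot u) with h | h
  · exact h ▸ hP.bot _
  · by_contra! hlt
    have h1 := le_prevPt (hP.succPt_mem (prevPt P u)) hlt
    exact (hP.lt_succPt ((hP.prevPt_lt h).trans_le (hP.top u))).not_ge h1

theorem prevPt_eq_iff (hP : IsPartition P o e) {r u : Time T} (hr : r ∈ P) :
    u ∈ Set.Ioc r (succPt P r) ↔ o < u ∧ prevPt P u = r := by
  constructor
  · rintro ⟨h1, h2⟩
    have hou : o < u := (hP.bot r).trans_lt h1
    refine ⟨hou, le_antisymm ?_ (le_prevPt hr h1)⟩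
    by_contra! h
    exact (hP.prevPt_lt hou).not_ge (h2.trans (succPt_le (hP.prevPt_mem u) h))
  · rintro ⟨h1, rfl⟩
    exact ⟨hP.prevPt_lt h1, hP.le_succPt_prevPt u⟩

/-- The intervals (r, r'] with r in P tile (o, T], and `prevPt` names the tile containing u. The
tiles are open on the left, so an integrand on a tile is sampled strictly before u, as
left-continuity requires. -/
theorem indicator_piecewise (hP : IsPartition P o e) (F : Time T → Time T → ℝ) (u : Time T) :
    (Set.Ioi o).indicator (fun u => F (prevPt P u) u) u
      = ∑ r ∈ P, (Set.Ioc r (succPt P r)).indicator (F r) u := by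
  by_cases hu : o < u
  · rw [Finset.sum_eq_single (prevPt P u)]
    · rw [Set.indicator_of_mem (show u ∈ Set.Ioi o from hu),
        Set.indicator_of_mem ((hP.prevPt_eq_iff (hP.prevPt_mem u)).2 ⟨hu, rfl⟩)]
    · intro r hr hne
      refine Set.indicator_of_notMem (fun h => hne ?_) _
      exact ((hP.prevPt_eq_iff hr).1 h).2.symm
    · exact fun h => absurd (hP.prevPt_mem u) h
  · rw [Set.indicator_of_notMem (by simpa using hu)]
    refine (Finset.sum_eq_zero fun r hr => Set.indicator_of_notMem (fun h => hu ?_) _).symm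
    exact ((hP.prevPt_eq_iff hr).1 h).1

theorem measurable_piecewise (hP : IsPartition P o e) {F : Time T → Time T → ℝ}
    (h : ∀ r ∈ P, Measurable ((Set.Ioc r (succPt P r)).indicator (F r))) :
    Measurable ((Set.Ioi o).indicator fun u => F (prevPt P u) u) := by
  have : (Set.Ioi o).indicator (fun u => F (prevPt P u) u)
      = fun u => ∑ r ∈ P, (Set.Ioc r (succPt P r)).indicator (F r) u :=
    funext fun u => hP.indicator_piecewise F u
  rw [this]
  exact Finset.measurable_fun_sum _ h

theorem lsIntegral_piecewise (hP : IsPartition P o e) {F : Time T → Time T → ℝ}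
    (h : ∀ r ∈ P, BddMeasOn (F r) (Set.Ioc r (succPt P r))) (g : Time T → ℝ) :
    lsIntegral (fun u => F (prevPt P u) u) g (Set.Ioi o)
      = ∑ r ∈ P, lsIntegral (F r) g (Set.Ioc r (succPt P r)) := by
  rw [lsIntegral_eq_indicator _ _ measurableSet_Ioi,
    show (Set.Ioi o).indicator (fun u => F (prevPt P u) u)
      = fun u => ∑ r ∈ P, (Set.Ioc r (succPt P r)).indicator (F r) u from
    funext fun u => hP.indicator_piecewise F u]
  rw [VectorMeasure.integral_finsetSum _ fun r hr => (h r hr).integrable_indicator _]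
  exact Finset.sum_congr rfl fun r _ => (lsIntegral_eq_indicator _ _ measurableSet_Ioc).symm

theorem measurable_step (hP : IsPartition P o e) (φ : Time T → ℝ) :
    Measurable ((Set.Ioi o).indicator fun u => φ (prevPt P u)) :=
  hP.measurable_piecewise (F := fun r _ => φ r) fun _ _ =>
    measurable_const.indicator measurableSet_Ioc

theorem lsIntegral_step (hP : IsPartition P o e) (φ : Time T → ℝ) {g : Time T → ℝ}
    (hg : IsContBV g) :
    lsIntegral (fun u => φ (prevPt P u)) g (Set.Ioi o)
      = ∑ r ∈ P, φ r * (g (succPt P r) - g r) := by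
  rw [hP.lsIntegral_piecewise (F := fun r _ => φ r)
    (fun r _ => BddMeasOn.const measurableSet_Ioc _)]
  refine Finset.sum_congr rfl fun r _ => ?_
  rw [← lsIntegral_Ioc_one hg (le_succPt P r), ← lsIntegral_const_mul]
  simp

end IsPartition

theorem PartitionSeq.mesh_all (P : PartitionSeq T) {ε : ℝ} (hε : 0 < ε) :
    ∀ᶠ n in atTop, ∀ u, (succPt (P.pts n) u : ℝ) - u < ε ∧ (u : ℝ) - prevPt (P.pts n) u < ε := by
  filter_upwards [P.mesh ε hε] with n hn u
  have hT : 0 ≤ T := u.2.1.trans u.2.2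
  have hP := P.isPartition (o := ⟨0, le_rfl, hT⟩) (e := ⟨T, hT, le_rfl⟩) (fun x => x.2.1)
    (fun x => x.2.2) n
  constructor
  · by_cases hu : u ∈ P.pts n
    · exact hn u hu
    -- A point outside the partition shares its successor with the partition point preceding it.
    · have h1 := hn _ (hP.prevPt_mem u)
      have h2 : u < succPt (P.pts n) (prevPt (P.pts n) u) := by
        refine lt_of_le_of_ne (hP.le_succPt_prevPt u) fun h => hu ?_
        rw [h]; exact hP.succPt_mem _
      have h3 := succPt_eq (prevPt_le _ u) h2
      have h4 : (prevPt (P.pts n) u : ℝ) ≤ u := prevPt_le _ u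
      rw [h3]
      linarith
  · have h1 := hn _ (hP.prevPt_mem u)
    have h2 : (u : ℝ) ≤ succPt (P.pts n) (prevPt (P.pts n) u) := hP.le_succPt_prevPt u
    linarith

theorem PartitionSeq.tendsto_succPt (P : PartitionSeq T) (u : Time T) :
    Tendsto (fun n => succPt (P.pts n) u) atTop (𝓝 u) := by
  rw [Metric.tendsto_atTop']
  intro ε hε
  obtain ⟨N, hN⟩ := eventually_atTop.1 (P.mesh_all hε)
  refine ⟨N, fun n hn => ?_⟩
  rw [Subtype.dist_eq, Real.dist_eq, abs_of_nonneg (sub_nonneg.2 (Subtype.coe_le_coe.2 (le_succPt _ u)))]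
  exact (hN n hn.le u).1

theorem PartitionSeq.tendsto_prevPt (P : PartitionSeq T) (u : Time T) :
    Tendsto (fun n => prevPt (P.pts n) u) atTop (𝓝 u) := by
  rw [Metric.tendsto_atTop']
  intro ε hε
  obtain ⟨N, hN⟩ := eventually_atTop.1 (P.mesh_all hε)
  refine ⟨N, fun n hn => ?_⟩
  rw [dist_comm, Subtype.dist_eq, Real.dist_eq, abs_of_nonneg (sub_nonneg.2 (Subtype.coe_le_coe.2 (prevPt_le _ u)))]
  exact (hN n hn.le u).2

theorem IsCadlag.approx {P : Finset (Time T)} {o e : Time T} (hP : IsPartition P o e)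
    {U : Set (E d)} {X : PathFn T d} (h : ∀ t, X t ∈ U) : IsCadlag U (approx P X) where
  mem t := h _
  right t := by
    rcases eq_or_lt_of_le (hP.top t) with ht | ht
    · refine (continuousWithinAt_const (b := FunctionalIto.approx P X t)).congr (fun u hu => ?_) rfl
      have hut : u = t := le_antisymm (ht ▸ hP.top u) hu
      rw [hut]
    · refine (continuousWithinAt_const (b := FunctionalIto.approx P X t)).congr_of_eventuallyEq ?_
        rfl
      filter_upwards [self_mem_nhdsWithin,
        mem_nhdsWithin_of_mem_nhds (Iio_mem_nhds (hP.lt_succPt ht))] with u hu hu'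
      rw [FunctionalIto.approx, FunctionalIto.approx, succPt_eq hu hu']
  left t := by
    rcases eq_or_lt_of_le (hP.bot t) with ht | ht
    · refine ⟨X t, h t, ?_⟩
      have : 𝓝[<] t = ⊥ := by
        rw [← ht, (by ext x; simpa using hP.bot x : Set.Iio o = ∅), nhdsWithin_empty]
      rw [this]; exact tendsto_bot
    · refine ⟨X (succPt P (prevPt P t)), h _, tendsto_const_nhds.congr' ?_⟩
      filter_upwards [self_mem_nhdsWithin,
        mem_nhdsWithin_of_mem_nhds (Ioi_mem_nhds (hP.prevPt_lt ht))] with u hu hu'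
      rw [FunctionalIto.approx, succPt_eq (le_of_lt hu')
        (lt_of_lt_of_le hu (hP.le_succPt_prevPt t))]

end FunctionalIto

namespace FunctionalIto

variable {T : ℝ}

/-! ### Convergence of Riemann sums along left-continuous integrands -/

/-- The functions `f n` on the partition points converge to `f'`, uniformly from the left near every
time outside of `N`. -/
def LeftUniformTendsto (P : PartitionSeq T) (N : Set (Time T)) (f : ℕ → Time T → ℝ)
    (f' : Time T → ℝ) : Prop :=
  ∀ t ∉ N, ∀ ε > (0 : ℝ), ∃ δ > (0 : ℝ), ∃ n₀, ∀ n ≥ n₀, ∀ r ∈ P.pts n, r ≤ t → (t : ℝ) - r < δ →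
    |f n r - f' t| < ε

namespace LeftUniformTendsto

variable {P : PartitionSeq T} {N : Set (Time T)} {f : ℕ → Time T → ℝ} {f' : Time T → ℝ}
  {o e : Time T}

theorem tendsto_prevPt (h : LeftUniformTendsto P N f f') (ho : IsBot o) (he : IsTop e)
    {t : Time T} (ht : t ∉ N) :
    Tendsto (fun n => f n (prevPt (P.pts n) t)) atTop (𝓝 (f' t)) := by
  rw [Metric.tendsto_nhds]
  intro ε hε
  obtain ⟨δ, hδ, n₀, hn₀⟩ := h t ht ε hε
  filter_upwards [P.mesh_all hδ, eventually_ge_atTop n₀] with n hn hnn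
  exact hn₀ n hnn _ ((P.isPartition ho he n).prevPt_mem t) (prevPt_le _ t) (hn t).2

/-- Cutting off at time `t`. -/
theorem cutoff (h : LeftUniformTendsto P N f f') (t : Time T) :
    LeftUniformTendsto P N (fun n r => if r ≤ t then f n r else 0)
      (fun u => if u ≤ t then f' u else 0) := by
  intro u hu ε hε
  by_cases hut : u ≤ t
  · obtain ⟨δ, hδ, n₀, hn₀⟩ := h u hu ε hε
    refine ⟨δ, hδ, n₀, fun n hn r hr hru hd => ?_⟩
    simp only [hut, hru.trans hut, if_true]
    exact hn₀ n hn r hr hru hd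
  -- This radius keeps r to the right of t, where both functions are cut to zero.
  · refine ⟨u - t, sub_pos.2 (not_le.1 hut), 0, fun n _ r _ hru hd => ?_⟩
    have : ¬ r ≤ t := fun hrt => by
      have : (r : ℝ) ≤ t := hrt
      linarith
    simp [hut, this, hε]

/-- The limit is a pointwise limit of step functions, sampled at the preceding partition point.
Measurability of vertical derivatives along a path, which is not part of their definition, comes
from here. -/
theorem bddMeasOn (h : LeftUniformTendsto P N f f') (ho : IsBot o) (he : IsTop e)
    {J : Set (Time T)} (hJ : MeasurableSet J) (hJN : ∀ u ∈ J, u ∉ N) (hJo : ∀ u ∈ J, o < u) {C : ℝ}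
    (hC : ∀ᶠ n in atTop, ∀ r ∈ P.pts n, |f n r| ≤ C) : BddMeasOn f' J := by
  constructor
  · have hm : ∀ n, Measurable (J.indicator fun u => f n (prevPt (P.pts n) u)) := fun n => by
      have := ((P.isPartition ho he n).measurable_step (f n)).indicator hJ
      rwa [Set.indicator_indicator, Set.inter_eq_left.2 (show J ⊆ Set.Ioi o from hJo)] at this
    refine measurable_of_tendsto_metrizable hm (tendsto_pi_nhds.2 fun u => ?_)
    by_cases hu : u ∈ J
    · simpa [hu] using h.tendsto_prevPt ho he (hJN u hu)
    · simp [hu]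
  · refine ⟨C, fun u hu => ?_⟩
    refine le_of_tendsto (h.tendsto_prevPt ho he (hJN u hu)).abs ?_
    filter_upwards [hC] with n hn
    exact hn _ ((P.isPartition ho he n).prevPt_mem u)

/-- Convergence of Riemann–Stieltjes sums. -/
theorem tendsto_sum_stieltjes (h : LeftUniformTendsto P N f f') (hN : N.Countable) (ho : IsBot o)
    (he : IsTop e) {C : ℝ} (hC : ∀ᶠ n in atTop, ∀ r ∈ P.pts n, |f n r| ≤ C) {g : Time T → ℝ}
    (hg : IsContBV g) :
    Tendsto (fun n => ∑ r ∈ P.pts n, f n r * (g (succPt (P.pts n) r) - g r)) atTop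
      (𝓝 (lsIntegral f' g (Set.Ioi o))) := by
  simp only [← fun n => (P.isPartition ho he n).lsIntegral_step (f n) hg]
  refine tendsto_lsIntegral hg measurableSet_Ioi hN
    (Eventually.of_forall fun n => (P.isPartition ho he n).measurable_step (f n)) (C := C) ?_
    fun u _ huN => h.tendsto_prevPt ho he huN
  filter_upwards [hC] with n hn u _
  exact hn _ ((P.isPartition ho he n).prevPt_mem u)

end LeftUniformTendsto

/-! ### Sums against weights with converging distribution functions -/

section Weights

variable {P : PartitionSeq T} {o e : Time T} {w : ℕ → Time T → ℝ} {q : Time T → ℝ}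

/-- Sums of step functions against converging weights. -/
theorem tendsto_sum_step (ho : IsBot o) (he : IsTop e)
    (hq : ∀ u, Tendsto (fun n => ∑ r ∈ (P.pts n).filter (· ≤ u), w n r) atTop (𝓝 (q u)))
    (hq0 : q o = 0) (hqc : IsContBV q) (k : ℕ) (φ : Time T → ℝ) :
    Tendsto (fun n => ∑ r ∈ P.pts n, φ (prevPt (P.pts k) r) * w n r) atTop
      (𝓝 (lsIntegral (fun u => φ (prevPt (P.pts k) u)) q (Set.Ioi o))) := by
  have hPk := P.isPartition ho he k
  -- The fine sum is grouped by coarse tiles, each contributing an increment of the distribution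
  -- function of the weights. The point o lies in no tile and gives a separate term, which vanishes
  -- in the limit because q(o) = 0.
  have hsplit : ∀ n, ∑ r ∈ P.pts n, φ (prevPt (P.pts k) r) * w n r
      = φ o * (∑ r ∈ (P.pts n).filter (· ≤ o), w n r)
        + ∑ s ∈ P.pts k, φ s * ((∑ r ∈ (P.pts n).filter (· ≤ succPt (P.pts k) s), w n r)
          - ∑ r ∈ (P.pts n).filter (· ≤ s), w n r) := by
    intro n
    have h1 : ∀ r, φ (prevPt (P.pts k) r) = (if r ≤ o then φ o else 0)
        + ∑ s ∈ P.pts k, (Set.Ioc s (succPt (P.pts k) s)).indicator (fun _ => φ s) r := by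
      intro r
      rw [← hPk.indicator_piecewise (fun r _ => φ r) r]
      by_cases hr : o < r
      · simp [hr]
      · have : r = o := le_antisymm (not_lt.1 hr) (ho r)
        simp [this, hPk.prevPt_bot]
    have h2 : ∀ s, (∑ r ∈ (P.pts n).filter (· ≤ succPt (P.pts k) s), w n r)
        - ∑ r ∈ (P.pts n).filter (· ≤ s), w n r
        = ∑ r ∈ P.pts n, (Set.Ioc s (succPt (P.pts k) s)).indicator (fun r => w n r) r := by
      intro s
      rw [Finset.sum_filter, Finset.sum_filter, ← Finset.sum_sub_distrib]
      refine Finset.sum_congr rfl fun r _ => ?_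
      have hs := le_succPt (P.pts k) s
      by_cases h3 : r ≤ s
      · simp [h3, h3.trans hs, h3.not_gt]
      · by_cases h4 : r ≤ succPt (P.pts k) s <;> simp [h3, h4, not_le.1 h3]
    simp only [h2, Finset.mul_sum]
    rw [Finset.sum_comm, Finset.sum_filter, ← Finset.sum_add_distrib]
    refine Finset.sum_congr rfl fun r _ => ?_
    rw [h1 r, add_mul, Finset.sum_mul]
    congr 1
    · split_ifs <;> simp
    · refine Finset.sum_congr rfl fun s _ => ?_
      by_cases h3 : r ∈ Set.Ioc s (succPt (P.pts k) s)
      · simp [Set.indicator_of_mem h3]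
      · simp [Set.indicator_of_notMem h3]
  simp only [hsplit, hPk.lsIntegral_step φ hqc]
  have := ((hq o).const_mul (φ o)).add (tendsto_finsetSum (P.pts k) fun s _ =>
    ((hq (succPt (P.pts k) s)).sub (hq s)).const_mul (φ s))
  rwa [hq0, mul_zero, zero_add] at this

/-- Left neighbourhoods cover all but countably many points. -/
theorem countable_compl_iUnion_left {N : Set (Time T)} (hN : N.Countable) {o : Time T}
    (ho : IsBot o) (δ : Time T → ℝ) (hδ : ∀ t ∉ N, 0 < δ t) :
    {u : Time T | ∀ t ∉ N, u < t → δ t ≤ (t : ℝ) - u}.Countable := by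
  set B := {u : Time T | ∀ t ∉ N, u < t → δ t ≤ (t : ℝ) - u} with hB
  suffices h : (B \ (N ∪ {o})).Countable by
    refine (h.union (hN.union (Set.countable_singleton o))).mono fun u hu => ?_
    by_cases h' : u ∈ N ∪ {o}
    · exact Or.inr h'
    · exact Or.inl ⟨hu, h'⟩
  -- Each uncovered t outside N ∪ {o} gets its own left neighbourhood. Two of these are disjoint,
  -- since otherwise the earlier point would be covered by the neighbourhood of the later one.
  -- Disjoint nonempty open sets in a separable space are countably many.
  refine Set.PairwiseDisjoint.countable_of_isOpen
    (s := fun t : Time T => {u : Time T | u < t ∧ (t : ℝ) - u < δ t}) ?_ ?_ ?_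
  · have key : ∀ t₁ ∈ B \ (N ∪ {o}), ∀ t₂ ∈ B \ (N ∪ {o}), t₁ < t₂ → ∀ u : Time T,
        u < t₁ → (t₂ : ℝ) - u < δ t₂ → False := by
      intro t₁ h₁ t₂ h₂ h12 u hu1 hu2
      have h3 := h₁.1 t₂ (fun h => h₂.2 (Or.inl h)) h12
      have h4 : (u : ℝ) < t₁ := hu1
      linarith
    intro t₁ h₁ t₂ h₂ hne
    refine Set.disjoint_left.2 fun u hu1 hu2 => ?_
    rcases lt_or_gt_of_ne hne with h | h
    · exact key t₁ h₁ t₂ h₂ h u hu1.1 hu2.2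
    · exact key t₂ h₂ t₁ h₁ h u hu2.1 hu1.2
  · intro t _
    exact (isOpen_lt continuous_id continuous_const).inter
      (isOpen_lt (continuous_const.sub continuous_subtype_val) continuous_const)
  · intro t ht
    have htδ := hδ t fun h => ht.2 (Or.inl h)
    have hot : (o : ℝ) < t := lt_of_le_of_ne (ho t) fun h => ht.2 (Or.inr (Subtype.ext h.symm))
    refine ⟨⟨max o (t - δ t / 2), o.2.1.trans (le_max_left _ _), max_le o.2.2 ?_⟩, ?_, ?_⟩
    · linarith [t.2.2]
    · exact Subtype.coe_lt_coe.1 (max_lt hot (by linarith))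
    · have : (t : ℝ) - δ t / 2 ≤ max (o : ℝ) (t - δ t / 2) := le_max_right _ _
      change (t : ℝ) - max (o : ℝ) (t - δ t / 2) < δ t
      linarith

/-- Sums of left-uniformly converging functions against non-negative weights whose distribution
functions converge to a continuous one. -/
theorem LeftUniformTendsto.tendsto_sum_weights {N : Set (Time T)} {f : ℕ → Time T → ℝ}
    {f' : Time T → ℝ} (h : LeftUniformTendsto P N f f') (hN : N.Countable) (ho : IsBot o)
    (he : IsTop e) {C : ℝ} (hC : ∀ᶠ n in atTop, ∀ r ∈ P.pts n, |f n r| ≤ C)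
    (hw : ∀ n r, 0 ≤ w n r)
    (hq : ∀ u, Tendsto (fun n => ∑ r ∈ (P.pts n).filter (· ≤ u), w n r) atTop (𝓝 (q u)))
    (hq0 : q o = 0) (hqc : IsContBV q) :
    Tendsto (fun n => ∑ r ∈ P.pts n, f n r * w n r) atTop
      (𝓝 (lsIntegral f' q (Set.Ioi o))) := by
  classical
  have hP := P.isPartition ho he
  have hqe : Tendsto (fun n => ∑ r ∈ P.pts n, w n r) atTop (𝓝 (q e)) := by
    have := hq e
    simpa only [Finset.filter_true_of_mem fun r (_ : r ∈ P.pts _) => he r] using this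
  have hW : 0 ≤ q e := ge_of_tendsto' hqe fun n => Finset.sum_nonneg fun r _ => hw n r
  rw [Metric.tendsto_nhds]
  intro ε₀ hε₀
  -- Error allowed per unit of weight; the added 1 covers total weight 0.
  set ε := ε₀ / (2 * (q e + 1)) with hε_def
  have hε : 0 < ε := by positivity
  have hεW : ε * q e < ε₀ / 2 := by
    rw [hε_def, div_mul_eq_mul_div, div_lt_div_iff₀ (by positivity) (by norm_num)]
    nlinarith
  -- A coarse point s is bad at level k if some later integrand leaves the ε-band around f k s on
  -- the tile following s. Convergence is uniform only from the left, so bad points need not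
  -- disappear; only their mass does.
  let B : ℕ → Time T → Prop := fun k s =>
    ∃ n ≥ k, ∃ r ∈ P.pts n, prevPt (P.pts k) r = s ∧ ε < |f n r - f k s|
  let b : ℕ → Time T → ℝ := fun k s => if B k s then 1 else 0
  have hI : Tendsto (fun k => lsIntegral (fun u => f k (prevPt (P.pts k) u)) q (Set.Ioi o)) atTop
      (𝓝 (lsIntegral f' q (Set.Ioi o))) := by
    refine tendsto_lsIntegral hqc measurableSet_Ioi hN
      (Eventually.of_forall fun n => (hP n).measurable_step (f n)) (C := C) ?_
      fun u _ huN => h.tendsto_prevPt ho he huN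
    filter_upwards [hC] with n hn u _
    exact hn _ ((hP n).prevPt_mem u)
  -- Outside a countable set, u lies in the left neighbourhood of some later t. For large k the
  -- whole tile around u lies there too, where all later integrands are within ε/2 of f' t, so the
  -- tile is not bad.
  have hβ : Tendsto (fun k => lsIntegral (fun u => b k (prevPt (P.pts k) u)) q (Set.Ioi o)) atTop
      (𝓝 0) := by
    choose! δ hδ n₀ hn₀ using fun t (ht : t ∉ N) => h t ht (ε / 2) (half_pos hε)
    have hcount := countable_compl_iUnion_left hN ho δ hδ
    suffices hz : Tendsto (fun k => lsIntegral (fun u => b k (prevPt (P.pts k) u)) q (Set.Ioi o))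
        atTop (𝓝 (lsIntegral (fun _ => 0) q (Set.Ioi o))) by
      rwa [lsIntegral_zero_left] at hz
    refine tendsto_lsIntegral hqc measurableSet_Ioi hcount
      (Eventually.of_forall fun n => (hP n).measurable_step (b n)) (C := 1) ?_ ?_
    · refine Eventually.of_forall fun k u _ => ?_
      simp only [b]
      split_ifs <;> simp
    · intro u _ hu
      simp only [Set.mem_ofPred_eq, not_forall, not_le] at hu
      obtain ⟨t, htN, hut, hd⟩ := hu
      refine tendsto_const_nhds.congr' ?_
      have hd' : 0 < δ t - ((t : ℝ) - u) := sub_pos.2 hd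
      filter_upwards [P.mesh_all hd', (P.tendsto_succPt u).eventually (gt_mem_nhds hut),
        eventually_ge_atTop (n₀ t)] with k hk hks hkn
      have hs1 : (t : ℝ) - prevPt (P.pts k) u < δ t := by linarith [(hk u).2]
      have hsu := prevPt_le (P.pts k) u
      have hss : succPt (P.pts k) (prevPt (P.pts k) u) ≤ succPt (P.pts k) u := by
        by_cases h3 : u < succPt (P.pts k) (prevPt (P.pts k) u)
        · rw [succPt_eq hsu h3]
        · exact (not_lt.1 h3).trans (le_succPt _ _)
      have hnB : ¬ B k (prevPt (P.pts k) u) := by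
        rintro ⟨n, hnk, r, hr, hrs, hlt⟩
        have h4 : prevPt (P.pts k) u ≤ r := hrs ▸ prevPt_le _ r
        have h5 : r ≤ t :=
          ((hP k).le_succPt_prevPt r).trans ((hrs ▸ hss).trans hks.le)
        have h4' : (prevPt (P.pts k) u : ℝ) ≤ r := h4
        have h6 := hn₀ t htN n (hkn.trans hnk) r hr h5 (by linarith)
        have h7 := hn₀ t htN k hkn _ ((hP k).prevPt_mem u) (hsu.trans hut.le) hs1
        have h8 := abs_sub_le (f n r) (f' t) (f k (prevPt (P.pts k) u))
        rw [abs_sub_comm (f' t)] at h8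
        linarith
      simp [b, hnB]
  obtain ⟨n₀, hn₀⟩ := eventually_atTop.1 hC
  have hsmall : ∀ᶠ k in atTop,
      2 * C * lsIntegral (fun u => b k (prevPt (P.pts k) u)) q (Set.Ioi o)
      + |lsIntegral (fun u => f k (prevPt (P.pts k) u)) q (Set.Ioi o)
        - lsIntegral f' q (Set.Ioi o)| < ε₀ / 2 := by
    have := (hβ.const_mul (2 * C)).add (hI.sub_const (lsIntegral f' q (Set.Ioi o))).abs
    rw [mul_zero, sub_self, abs_zero, add_zero] at this
    exact this.eventually (gt_mem_nhds (half_pos hε₀))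
  obtain ⟨k, hk, hkn⟩ := (hsmall.and (eventually_ge_atTop n₀)).exists
  -- With k fixed and n growing, good tiles cost at most ε times the total weight, bad tiles at most
  -- 2C times their weight, and the remaining step-function sum converges.
  have hlim := ((hqe.const_mul ε).add
    ((tendsto_sum_step ho he hq hq0 hqc k (b k)).const_mul (2 * C))).add
    (((tendsto_sum_step ho he hq hq0 hqc k (f k)).sub_const
      (lsIntegral f' q (Set.Ioi o))).abs)
  filter_upwards [hlim.eventually (gt_mem_nhds (show _ < ε₀ by linarith)),
    eventually_ge_atTop k] with n hn hnk
  refine lt_of_le_of_lt ?_ hn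
  rw [Real.dist_eq]
  refine (abs_sub_le _ (∑ r ∈ P.pts n, f k (prevPt (P.pts k) r) * w n r) _).trans ?_
  refine add_le_add ?_ le_rfl
  rw [← Finset.sum_sub_distrib, Finset.mul_sum, Finset.mul_sum, ← Finset.sum_add_distrib]
  refine (Finset.abs_sum_le_sum_abs _ _).trans (Finset.sum_le_sum fun r hr => ?_)
  rw [← sub_mul, abs_mul, abs_of_nonneg (hw n r), ← mul_assoc, ← add_mul]
  refine mul_le_mul_of_nonneg_right ?_ (hw n r)
  by_cases hB : B k (prevPt (P.pts k) r)
  · have h1 := hn₀ n (hkn.trans hnk) r hr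
    have h2 := hn₀ k hkn _ ((hP k).prevPt_mem r)
    have h3 := abs_sub (f n r) (f k (prevPt (P.pts k) r))
    simp only [b, hB, if_true]
    linarith
  · have : ¬ ε < |f n r - f k (prevPt (P.pts k) r)| := fun hlt => hB ⟨n, hnk, r, hr, rfl, hlt⟩
    simp only [b, hB, if_false]
    linarith [not_lt.1 this]

end Weights

end FunctionalIto

namespace FunctionalIto

variable {T : ℝ} {d m : ℕ}

/-- Peeling off the largest partition point p ≤ t gives the induction. The sum ends at the successor
of p, which is `succPt P t` even when t is not a partition point; it therefore overshoots t in
general. -/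
theorem IsPartition.sum_telescope {P : Finset (Time T)} {o e : Time T} (hP : IsPartition P o e)
    {s t : Time T} (hs : s ∈ P) (hst : s ≤ t) (a : Time T → ℝ) :
    ∑ r ∈ P.filter (fun r => s ≤ r ∧ r ≤ t), (a (succPt P r) - a r) = a (succPt P t) - a s := by
  induction hn : (P.filter (fun r => s ≤ r ∧ r ≤ t)).card using Nat.strong_induction_on
    generalizing t with
  | _ n ih =>
    have hne : (P.filter (fun r => s ≤ r ∧ r ≤ t)).Nonempty :=
      ⟨s, Finset.mem_filter.2 ⟨hs, le_rfl, hst⟩⟩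
    set p := (P.filter (fun r => s ≤ r ∧ r ≤ t)).max' hne with hp
    obtain ⟨hpP, hsp, hpt⟩ := Finset.mem_filter.1 (Finset.max'_mem _ hne)
    rw [← hp] at hpP hsp hpt
    have hmax : ∀ r ∈ P, s ≤ r → r ≤ t → r ≤ p := fun r hr h1 h2 =>
      Finset.le_max' _ _ (Finset.mem_filter.2 ⟨hr, h1, h2⟩)
    have hsucc : succPt P t = succPt P p := by
      rcases eq_or_lt_of_le (hP.top p) with h | h
      · rw [le_antisymm hpt (h ▸ hP.top t)]
      · refine succPt_eq hpt (not_le.1 fun hle => ?_)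
        exact (hP.lt_succPt h).not_ge
          (hmax _ (hP.succPt_mem p) (hsp.trans (le_succPt P p)) hle)
    rcases eq_or_lt_of_le hsp with h | h
    · have : P.filter (fun r => s ≤ r ∧ r ≤ t) = {s} := by
        ext r
        simp only [Finset.mem_filter, Finset.mem_singleton]
        constructor
        · exact fun hr => le_antisymm (h ▸ hmax r hr.1 hr.2.1 hr.2.2) hr.2.1
        · rintro rfl
          exact ⟨hs, le_rfl, hst⟩
      rw [this, Finset.sum_singleton, hsucc, h]
    · obtain ⟨hqP, hqp⟩ := prevPt_mem_and_lt hs h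
      have hsq := le_prevPt hs h
      have hsplit : P.filter (fun r => s ≤ r ∧ r ≤ t)
          = insert p (P.filter (fun r => s ≤ r ∧ r ≤ prevPt P p)) := by
        ext r
        simp only [Finset.mem_filter, Finset.mem_insert]
        constructor
        · rintro ⟨h1, h2, h3⟩
          rcases eq_or_lt_of_le (hmax r h1 h2 h3) with h4 | h4
          · exact Or.inl h4
          · exact Or.inr ⟨h1, h2, le_prevPt h1 h4⟩
        · rintro (rfl | ⟨h1, h2, h3⟩)
          · exact ⟨hpP, hsp, hpt⟩
          · exact ⟨h1, h2, (h3.trans hqp.le).trans hpt⟩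
      have hnot : p ∉ P.filter (fun r => s ≤ r ∧ r ≤ prevPt P p) := fun h' =>
        (Finset.mem_filter.1 h').2.2.not_gt hqp
      have hq' : succPt P (prevPt P p) = p :=
        le_antisymm (succPt_le hpP hqp) (hP.le_succPt_prevPt p)
      rw [hsplit, Finset.sum_insert hnot, ih _ ?_ hsq rfl, hq', hsucc]
      · ring
      · rw [← hn, hsplit, Finset.card_insert_of_notMem hnot]
        exact Nat.lt_succ_self _

/-! ### Quadratic variation -/

section QuadraticVariation

variable {P : PartitionSeq T} {o e : Time T}

/-- The definition prescribes no limit of sums at time 0. There the sum is the single term (x(o') −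
x(o))², which tends to 0 by continuity. -/
theorem HasQV.tendsto_sum {x q : Time T → ℝ} (h : HasQV P x q) (hx : Continuous x)
    (ho : IsBot o) (he : IsTop e) (u : Time T) :
    Tendsto (fun n => ∑ r ∈ (P.pts n).filter (· ≤ u), (x (succPt (P.pts n) r) - x r) ^ 2) atTop
      (𝓝 (q u)) := by
  by_cases hu : (0 : ℝ) < u
  · exact h.1 u hu
  · have hu0 : (u : ℝ) = 0 := le_antisymm (not_lt.1 hu) u.2.1
    have huo : u = o := le_antisymm (Subtype.coe_le_coe.1 (hu0.trans_le o.2.1)) (ho u)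
    have : ∀ n, (P.pts n).filter (· ≤ u) = {o} := by
      intro n
      ext r
      simp only [Finset.mem_filter, Finset.mem_singleton, huo]
      constructor
      · exact fun h => le_antisymm h.2 (ho r)
      · rintro rfl
        exact ⟨(P.isPartition ho he n).bot_mem, le_rfl⟩
    simp only [this, Finset.sum_singleton]
    rw [h.2.1 u hu0]
    have h1 : Tendsto (fun n => x (succPt (P.pts n) o)) atTop (𝓝 (x o)) :=
      (hx.tendsto o).comp (P.tendsto_succPt o)
    simpa using (h1.sub_const (x o)).pow 2

theorem HasQV.isContBV {x q : Time T → ℝ} (h : HasQV P x q) (hx : Continuous x)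
    (ho : IsBot o) (he : IsTop e) : IsContBV q := by
  refine isContBV_of_monotone (fun a b hab => ?_) h.2.2
  refine le_of_tendsto_of_tendsto' (h.tendsto_sum hx ho he a) (h.tendsto_sum hx ho he b)
    fun n => ?_
  refine Finset.sum_le_sum_of_subset_of_nonneg (fun r hr => ?_) fun _ _ _ => sq_nonneg _
  rw [Finset.mem_filter] at hr ⊢
  exact ⟨hr.1, hr.2.trans hab⟩

theorem HasQV.zero {x q : Time T → ℝ} (h : HasQV P x q) {o : Time T} (ho : IsBot o) : q o = 0 :=
  h.2.1 o (le_antisymm (ho ⟨0, le_rfl, o.2.1.trans o.2.2⟩) o.2.1)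

/-- Polarization holds for increments, hence for measures. Integrals against a covariation thus
reduce to three integrals against quadratic variations, where the weights are non-negative. -/
theorem stieltjes_polarization {Q q₂ q₁ q₁' : Time T → ℝ} (h₂ : IsContBV q₂) (h₁ : IsContBV q₁)
    (h₁' : IsContBV q₁') (h : ∀ t, Q t = (1 / 2) * (q₂ t - q₁ t - q₁' t)) (ho : IsBot o) :
    IsContBV Q ∧
    stieltjes Q = (1 / 2 : ℝ) • (stieltjes q₂ - stieltjes q₁ - stieltjes q₁') := by
  obtain ⟨M₂, hM₂, hd₂⟩ := h₂.exists_dominating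
  obtain ⟨M₁, hM₁, hd₁⟩ := h₁.exists_dominating
  obtain ⟨M₁', hM₁', hd₁'⟩ := h₁'.exists_dominating
  have hQ : IsContBV Q := by
    constructor
    · rw [funext h]
      exact continuous_const.mul ((h₂.cont.sub h₁.cont).sub h₁'.cont)
    · refine bv_of_dominated (M := fun t => M₂ t + M₁ t + M₁' t)
        (fun a b hab => add_le_add (add_le_add (hM₂ hab) (hM₁ hab)) (hM₁' hab)) fun a b hab => ?_
      have e1 := abs_le.1 (hd₂ a b hab)
      have e2 := abs_le.1 (hd₁ a b hab)
      have e3 := abs_le.1 (hd₁' a b hab)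
      rw [h, h, abs_le]
      have := hM₂ hab
      have := hM₁ hab
      have := hM₁' hab
      constructor <;> linarith
  refine ⟨hQ, signedMeasure_ext_of_Ioc ho ?_ fun b => ?_⟩
  · simp [stieltjes_singleton, hQ, h₂, h₁, h₁']
  · simp only [FunLike.coe_smul, FunLike.coe_sub, Pi.smul_apply, Pi.sub_apply]
    rw [stieltjes_Ioc hQ (ho b), stieltjes_Ioc h₂ (ho b), stieltjes_Ioc h₁ (ho b),
      stieltjes_Ioc h₁' (ho b), h, h, smul_eq_mul]
    ring

theorem continuous_coord {X : PathFn T d} (hX : Continuous X) (i : Fin d) :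
    Continuous fun t => X t i :=
  (EuclideanSpace.proj (𝕜 := ℝ) i).continuous.comp hX

theorem HasCovariation.isContBV {X : PathFn T d} {Q : Fin d → Fin d → Time T → ℝ}
    (h : HasCovariation P X Q) (hX : Continuous X) (ho : IsBot o) (he : IsTop e) (i j : Fin d) :
    IsContBV (Q i j) := by
  obtain ⟨q₂, q₁, h₂, h₁, hQ⟩ := h
  exact (stieltjes_polarization ((h₂ i j).isContBV
    ((continuous_coord hX i).add (continuous_coord hX j)) ho he)
    ((h₁ i).isContBV (continuous_coord hX i) ho he)
    ((h₁ j).isContBV (continuous_coord hX j) ho he) (hQ i j) ho).1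

/-- Convergence of weighted sums of products of increments. -/
theorem HasCovariation.tendsto_sum {X : PathFn T d} {Q : Fin d → Fin d → Time T → ℝ}
    (h : HasCovariation P X Q) (hX : Continuous X) (ho : IsBot o) (he : IsTop e)
    {N : Set (Time T)} (hN : N.Countable) {f : ℕ → Time T → ℝ} {f' : Time T → ℝ}
    (hf : LeftUniformTendsto P N f f') {C : ℝ}
    (hC : ∀ᶠ n in atTop, ∀ r ∈ P.pts n, |f n r| ≤ C) (hf' : BddMeasOn f' (Set.Ioi o))
    (i j : Fin d) :
    Tendsto (fun n => ∑ r ∈ P.pts n, f n r *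
      ((X (succPt (P.pts n) r) - X r) i * (X (succPt (P.pts n) r) - X r) j)) atTop
      (𝓝 (lsIntegral f' (Q i j) (Set.Ioi o))) := by
  obtain ⟨q₂, q₁, h₂, h₁, hQ⟩ := h
  have hXi := continuous_coord hX i
  have hXj := continuous_coord hX j
  have c₂ := (h₂ i j).isContBV (hXi.add hXj) ho he
  have ci := (h₁ i).isContBV hXi ho he
  have cj := (h₁ j).isContBV hXj ho he
  have L₂ := hf.tendsto_sum_weights hN ho he hC (fun _ _ => sq_nonneg _)
    ((h₂ i j).tendsto_sum (hXi.add hXj) ho he) ((h₂ i j).zero ho) c₂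
  have Li := hf.tendsto_sum_weights hN ho he hC (fun _ _ => sq_nonneg _)
    ((h₁ i).tendsto_sum hXi ho he) ((h₁ i).zero ho) ci
  have Lj := hf.tendsto_sum_weights hN ho he hC (fun _ _ => sq_nonneg _)
    ((h₁ j).tendsto_sum hXj ho he) ((h₁ j).zero ho) cj
  have hst := (stieltjes_polarization c₂ ci cj (hQ i j) ho).2
  have hint : lsIntegral f' (Q i j) (Set.Ioi o) = (1 / 2) * (lsIntegral f' (q₂ i j) (Set.Ioi o)
      - lsIntegral f' (q₁ i) (Set.Ioi o) - lsIntegral f' (q₁ j) (Set.Ioi o)) := by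
    simp only [lsIntegral_eq_indicator _ _ measurableSet_Ioi, hst]
    rw [VectorMeasure.integral_smul_vectorMeasure, VectorMeasure.integral_sub_vectorMeasure
      (VectorMeasure.Integrable.sub_vectorMeasure (hf'.integrable_indicator _)
        (hf'.integrable_indicator _)) (hf'.integrable_indicator _),
      VectorMeasure.integral_sub_vectorMeasure (hf'.integrable_indicator _)
        (hf'.integrable_indicator _), smul_eq_mul]
  rw [hint]
  refine (((L₂.sub Li).sub Lj).const_mul (1 / 2)).congr fun n => ?_
  rw [← Finset.sum_sub_distrib, ← Finset.sum_sub_distrib, Finset.mul_sum]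
  refine Finset.sum_congr rfl fun r _ => ?_
  simp only [PiLp.sub_apply]
  ring

/-- Continuous paths of bounded variation have zero quadratic variation. -/
theorem hasQV_zero_of_isContBV {x : Time T → ℝ} (hx : IsContBV x) (ho : IsBot o) (he : IsTop e) :
    HasQV P x (fun _ => 0) := by
  refine ⟨fun t _ => ?_, fun _ _ => rfl, continuous_const⟩
  obtain ⟨M, hM, hd⟩ := hx.exists_dominating
  have huc := CompactSpace.uniformContinuous_of_continuous hx.cont
  rw [Metric.uniformContinuous_iff] at huc
  rw [Metric.tendsto_nhds]
  intro ε hε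
  -- The squares sum to at most the largest increment times the total variation; the added 1 avoids
  -- dividing by zero when M is constant.
  obtain ⟨δ, hδ, hδ'⟩ := huc (ε / (M e - M o + 1)) (div_pos hε (by linarith [hM (ho e)]))
  filter_upwards [P.mesh_all hδ] with n hn
  have hP := P.isPartition ho he n
  have h1 : ∑ r ∈ P.pts n, (M (succPt (P.pts n) r) - M r) = M e - M o := by
    have := hP.sum_telescope hP.bot_mem (ho e) M
    rw [hP.succPt_top] at this
    rwa [Finset.filter_true_of_mem fun r _ => ⟨ho r, he r⟩] at this
  set η := ε / (M e - M o + 1) with hη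
  have hMe : 0 ≤ M e - M o := sub_nonneg.2 (hM (ho e))
  have hηp : 0 < η := div_pos hε (by linarith)
  have h2 : ∑ r ∈ (P.pts n).filter (· ≤ t), (x (succPt (P.pts n) r) - x r) ^ 2
      ≤ ∑ r ∈ P.pts n, η * (M (succPt (P.pts n) r) - M r) := by
    refine (Finset.sum_le_sum_of_subset_of_nonneg (Finset.filter_subset _ _)
      fun _ _ _ => sq_nonneg _).trans (Finset.sum_le_sum fun r _ => ?_)
    have hle := le_succPt (P.pts n) r
    have h3 : |x (succPt (P.pts n) r) - x r| ≤ η := by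
      rw [← Real.dist_eq]
      refine (hδ' ?_).le
      rw [Subtype.dist_eq, Real.dist_eq, abs_of_nonneg (sub_nonneg.2 (Subtype.coe_le_coe.2 hle))]
      exact (hn r).1
    rw [← sq_abs, sq]
    exact mul_le_mul h3 (hd r _ hle) (abs_nonneg _) hηp.le
  rw [← Finset.mul_sum, h1] at h2
  rw [Real.dist_eq, sub_zero, abs_of_nonneg (Finset.sum_nonneg fun _ _ => sq_nonneg _)]
  refine h2.trans_lt ?_
  rw [hη, div_mul_eq_mul_div, div_lt_iff₀ (by linarith)]
  nlinarith

theorem hasCovariation_zero_of_isContBV {X : PathFn T d} (hX : ∀ i, IsContBV fun t => X t i)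
    (ho : IsBot o) (he : IsTop e) : HasCovariation P X (fun _ _ _ => 0) := by
  refine ⟨fun _ _ _ => 0, fun _ _ => 0, fun i j => hasQV_zero_of_isContBV ?_ ho he,
    fun i => hasQV_zero_of_isContBV (hX i) ho he, fun _ _ _ => by simp⟩
  have := isContBV_sum Finset.univ (g := fun k : Fin 2 => fun t => X t (![i, j] k))
    fun k _ => hX _
  simpa [Fin.sum_univ_two] using this

end QuadraticVariation

end FunctionalIto

namespace FunctionalIto

variable {T : ℝ} {d m : ℕ} {U : Set (E d)} {S : Set (E m)}

/-! ### Vertical derivatives -/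

theorem NonAnticipative.stopped_right {F : Functional T d m} (hF : NonAnticipative U S F)
    {t : Time T} {X : PathFn T d} {A : PathFn T m} (hX : IsCadlag U X) (hA : IsCBV S A) :
    F t X (stopped A t) = F t X A := by
  rw [hF t X _ hX (hA.stopped t), stopped_stopped_self, ← hF t X A hX hA]

theorem NonAnticipative.congr {F : Functional T d m} (hF : NonAnticipative U S F)
    {t : Time T} {X Y : PathFn T d} {A : PathFn T m} (hX : IsCadlag U X) (hY : IsCadlag U Y)
    (hA : IsCBV S A) (h : stopped X t = stopped Y t) : F t X A = F t Y A := by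
  rw [hF t X A hX hA, hF t Y A hY hA, h]

theorem NonAnticipative.stopped_left {F : Functional T d m} (hF : NonAnticipative U S F)
    {t : Time T} {X : PathFn T d} {A : PathFn T m} (hX : IsCadlag U X) (hA : IsCBV S A) :
    F t (stopped X t) A = F t X A :=
  hF.congr (hX.stopped t) hX hA (stopped_stopped_self X t)

theorem vgrad_stopped_right (F : Functional T d m) (t : Time T) (X : PathFn T d)
    (A : PathFn T m) : vgrad F t X (stopped A t) = vgrad F t X A := by
  simp only [vgrad, stopped_stopped_self]

theorem vpartial_stopped_right (i : Fin d) (F : Functional T d m) (t : Time T) (X : PathFn T d)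
    (A : PathFn T m) : vpartial i F t X (stopped A t) = vpartial i F t X A := by
  simp only [vpartial, vgrad_stopped_right]

theorem inner_eq_sum (x y : E d) : inner ℝ x y = ∑ i, x i * y i := by
  simp [PiLp.inner_apply, mul_comm]

/-- Bumping at t commutes with stopping at t, so the two functions of v agree. They need agree only
near 0, where the bumped paths stay in U. -/
theorem NonAnticipative.vpartial (hU : IsOpen U) {F : Functional T d m}
    (hF : NonAnticipative U S F) (i : Fin d) : NonAnticipative U S (vpartial i F) := by
  intro t X A hX hA
  rw [vpartial_stopped_right]
  simp only [FunctionalIto.vpartial, vgrad]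
  rw [Filter.EventuallyEq.gradient_eq (f := fun v : E d => F t (bump (stopped X t) t v) (stopped A t))
    (f₁ := fun v : E d => F t (bump X t v) (stopped A t)) ?_]
  filter_upwards [hX.eventually_bump hU t, (hX.stopped t).eventually_bump hU t] with v h1 h2
  refine hF.congr h1 h2 (hA.stopped t) ?_
  rw [stopped_bump, stopped_bump, stopped_stopped_self]

/-- Bumps at the same time add up, so differentiating along v at θ is differentiating at 0 from the
path already bumped by θ v. -/
theorem VerticallyDifferentiable.hasDerivAt {F : Functional T d m}
    (hF : VerticallyDifferentiable U S F) {t : Time T} {X : PathFn T d} {A : PathFn T m}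
    (hA : IsCBV S A) (v : E d) (θ : ℝ) (hX : IsCadlag U (bump X t (θ • v))) :
    HasDerivAt (fun θ : ℝ => F t (bump X t (θ • v)) (stopped A t))
      (∑ i, vpartial i F t (bump X t (θ • v)) A * v i) θ := by
  have h1 := (hF t _ A hX hA).hasGradientAt.hasFDerivAt
  have h2 : HasDerivAt (fun x : ℝ => (x - θ) • v) v θ := by
    simpa using ((hasDerivAt_id θ).sub_const θ).smul_const v
  have h3 : HasFDerivAt (fun w : E d => F t (bump (bump X t (θ • v)) t w) (stopped A t))
      (InnerProductSpace.toDual ℝ (E d) (gradient (fun w : E d =>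
        F t (bump (bump X t (θ • v)) t w) (stopped A t)) 0)) ((θ - θ) • v) := by
    simpa using h1
  have h4 := h3.comp_hasDerivAt θ h2
  have h5 : (fun w : E d => F t (bump (bump X t (θ • v)) t w) (stopped A t))
      ∘ (fun x : ℝ => (x - θ) • v) = fun x : ℝ => F t (bump X t (x • v)) (stopped A t) := by
    ext x
    simp only [Function.comp, bump_bump, ← add_smul]
    congr 3
    ring_nf
  rw [h5, InnerProductSpace.toDual_apply_apply, inner_eq_sum] at h4
  exact h4

/-- Rolle's theorem used twice; the second derivative only has to exist, not to be continuous. -/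
theorem exists_second_order_mean_value {φ φ' φ'' : ℝ → ℝ}
    (h : ∀ x ∈ Set.Icc (0 : ℝ) 1, HasDerivAt φ (φ' x) x)
    (h' : ∀ x ∈ Set.Icc (0 : ℝ) 1, HasDerivAt φ' (φ'' x) x) :
    ∃ θ ∈ Set.Ioo (0 : ℝ) 1, φ 1 - φ 0 = φ' 0 + (1 / 2) * φ'' θ := by
  -- Chosen so that φ(x) − φ'(0)x − cx² has equal values at 0 and 1. Its derivative then vanishes at
  -- 0 and at some x₁, which forces φ''(θ) = 2c in between.
  set c := φ 1 - φ 0 - φ' 0 with hc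
  have d1 : ∀ x ∈ Set.Icc (0 : ℝ) 1, HasDerivAt (fun x => φ x - φ' 0 * x - c * x ^ 2)
      (φ' x - φ' 0 - c * (2 * x)) x := fun x hx => by
    simpa using ((h x hx).fun_sub ((hasDerivAt_id x).const_mul (φ' 0))).fun_sub
      ((hasDerivAt_pow 2 x).const_mul c)
  obtain ⟨x₁, hx₁, hx₁'⟩ := exists_hasDerivAt_eq_zero (zero_lt_one' ℝ)
    (fun x hx => (d1 x hx).continuousAt.continuousWithinAt)
    (by simp only [hc]; ring) (fun x hx => d1 x (Set.Ioo_subset_Icc_self hx))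
  have hsub : ∀ x ∈ Set.Icc (0 : ℝ) x₁, x ∈ Set.Icc (0 : ℝ) 1 := fun x hx =>
    ⟨hx.1, hx.2.trans hx₁.2.le⟩
  have d2 : ∀ x ∈ Set.Icc (0 : ℝ) x₁, HasDerivAt (fun x => φ' x - φ' 0 - c * (2 * x))
      (φ'' x - c * 2) x := fun x hx => by
    simpa using ((h' x (hsub x hx)).sub_const (φ' 0)).fun_sub
      (((hasDerivAt_id x).const_mul 2).const_mul c)
  obtain ⟨θ, hθ, hθ'⟩ := exists_hasDerivAt_eq_zero hx₁.1
    (fun x hx => (d2 x hx).continuousAt.continuousWithinAt)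
    (by rw [hx₁']; ring) (fun x hx => d2 x (Set.Ioo_subset_Icc_self hx))
  refine ⟨θ, ⟨hθ.1, hθ.2.trans hx₁.2⟩, ?_⟩
  linarith

/-- Second order Taylor expansion in the vertical direction. -/
theorem exists_vertical_taylor {F : Functional T d m} (hF : VerticallyDifferentiable U S F)
    (hF₂ : ∀ j, VerticallyDifferentiable U S (vpartial j F)) {t : Time T} {X : PathFn T d}
    {A : PathFn T m} (hA : IsCBV S A) (v : E d)
    (hX : ∀ θ ∈ Set.Icc (0 : ℝ) 1, IsCadlag U (bump X t (θ • v))) :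
    ∃ θ ∈ Set.Ioo (0 : ℝ) 1, F t (bump X t v) (stopped A t) - F t X (stopped A t)
      = inner ℝ (vgrad F t X A) v + (1 / 2) * ∑ i, ∑ j,
        vpartial i (vpartial j F) t (bump X t (θ • v)) A * (v i * v j) := by
  have d1 : ∀ x ∈ Set.Icc (0 : ℝ) 1, HasDerivAt
      (fun θ : ℝ => F t (bump X t (θ • v)) (stopped A t))
      (∑ i, vpartial i F t (bump X t (x • v)) A * v i) x := fun x hx =>
    hF.hasDerivAt hA v x (hX x hx)
  have d2 : ∀ x ∈ Set.Icc (0 : ℝ) 1, HasDerivAt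
      (fun θ : ℝ => ∑ i, vpartial i F t (bump X t (θ • v)) A * v i)
      (∑ j, (∑ i, vpartial i (vpartial j F) t (bump X t (x • v)) A * v i) * v j) x := by
    intro x hx
    refine HasDerivAt.fun_sum fun j _ => ?_
    have := (hF₂ j).hasDerivAt hA v x (hX x hx)
    simp only [vpartial_stopped_right] at this
    exact this.mul_const (v j)
  obtain ⟨θ, hθ, h⟩ := exists_second_order_mean_value d1 d2
  refine ⟨θ, hθ, ?_⟩
  simp only [one_smul, zero_smul, bump_zero] at h
  rw [h, inner_eq_sum, Finset.sum_comm]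
  congr 2
  refine Finset.sum_congr rfl fun j _ => ?_
  rw [Finset.sum_mul]
  exact Finset.sum_congr rfl fun i _ => by ring

/-! ### Approximating paths started at a later time -/

/-- The path that equals `Z` before `s₀` and the approximating path stopped before `r` from `s₀`
on. -/
def approxFrom (s₀ : Time T) (P : Finset (Time T)) (Z : PathFn T d) (r : Time T) : PathFn T d :=
  fun u => if u < s₀ then Z u else approxLeft P Z r u

section ApproxFrom

variable {P : Finset (Time T)} {o e s₀ : Time T} {Z : PathFn T d}

theorem approxFrom_bot (ho : IsBot s₀) (r : Time T) :
    approxFrom s₀ P Z r = approxLeft P Z r := by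
  ext u : 1
  simp [approxFrom, (ho u).not_gt]

theorem isCadlag_approxLeft (hP : IsPartition P o e) {V : Set (E d)} {X : PathFn T d}
    (hX : ∀ t, X t ∈ V) (r : Time T) : IsCadlag V (approxLeft P X r) :=
  (IsCadlag.approx hP hX).ite_lt (IsCadlag.const (hX r)) r

theorem isCadlag_approxFrom (hP : IsPartition P o e) {V : Set (E d)} (hZ : IsCadlag V Z)
    (r : Time T) : IsCadlag V (approxFrom s₀ P Z r) :=
  hZ.ite_lt (isCadlag_approxLeft hP hZ.mem r) s₀

/-- On [r, r') the approximating path already takes the value Z(r'), so moving the cut-off from r to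
r' is one jump at r. This is what makes the increments of a functional vertical at r and horizontal
on (r, r']. -/
theorem approxFrom_succPt {r : Time T} (hr : s₀ ≤ r) :
    approxFrom s₀ P Z (succPt P r) = bump (approxFrom s₀ P Z r) r (Z (succPt P r) - Z r) := by
  ext u : 1
  simp only [approxFrom, bump, approxLeft, approx]
  by_cases h1 : u < s₀
  · simp [h1, (h1.trans_le hr).not_ge]
  · by_cases h2 : u < r
    · simp [h1, h2, h2.not_ge, h2.trans_le (le_succPt P r)]
    · by_cases h3 : u < succPt P r
      · simp [h1, h2, h3, not_lt.1 h2, succPt_eq (not_lt.1 h2) h3]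
      · simp [h1, h2, h3, not_lt.1 h2]

theorem stopped_approxFrom {r : Time T} (hr : s₀ ≤ r) :
    stopped (approxFrom s₀ P Z r) r = approxFrom s₀ P Z r := by
  ext u : 1
  rcases le_total r u with h | h
  · simp [stopped, approxFrom, approxLeft, h, hr.not_gt, (hr.trans h).not_gt, h.not_gt]
  · simp [stopped, h]

/-- The path cut at r' is already constant from r on, so the integral formula for the horizontal
derivative applies to it on (r, r']. -/
theorem stopped_approxFrom_succPt {r : Time T} (hr : s₀ ≤ r) :
    stopped (approxFrom s₀ P Z (succPt P r)) r = approxFrom s₀ P Z (succPt P r) := by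
  rw [approxFrom_succPt hr, stopped_bump, stopped_approxFrom hr]

/-- The two paths evaluate Z at times less than 2δ apart: one δ for the mesh, one for |t − r|.
Before s₀ they coincide. -/
theorem norm_stopped_sub_approxFrom_le {δ ε : ℝ} (hε : 0 ≤ ε)
    (hω : ∀ u v : Time T, s₀ ≤ u → s₀ ≤ v → |(u : ℝ) - v| < 2 * δ → ‖Z u - Z v‖ ≤ ε)
    (hmesh : ∀ u, (succPt P u : ℝ) - u < δ) {t r : Time T} (ht : s₀ ≤ t) (hr : s₀ ≤ r)
    (htr : |(t : ℝ) - r| < δ) (u : Time T) :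
    ‖stopped Z t u - approxFrom s₀ P Z r u‖ ≤ ε := by
  have hδ : 0 < δ := (abs_nonneg _).trans_lt htr
  have htr' := abs_lt.1 htr
  simp only [stopped, approxFrom, approxLeft, approx]
  by_cases h1 : u < s₀
  · simpa [h1, (h1.trans_le ht).le] using hε
  · have h1' := not_lt.1 h1
    simp only [h1, if_false]
    by_cases h2 : u < r
    · simp only [h2, if_true]
      have h3 : (u : ℝ) ≤ succPt P u := le_succPt P u
      have h4 := hmesh u
      have h2' : (u : ℝ) < r := h2
      refine hω _ _ (le_min ht h1') (h1'.trans (le_succPt P u)) ?_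
      rcases le_total t u with h | h
      · have h' : (t : ℝ) ≤ u := h
        rw [min_eq_left h, abs_lt]
        constructor <;> linarith
      · rw [min_eq_right h, abs_lt]
        constructor <;> linarith
    · simp only [h2, if_false]
      have h2' : (r : ℝ) ≤ u := not_lt.1 h2
      refine hω _ _ (le_min ht h1') hr ?_
      rcases le_total t u with h | h
      · rw [min_eq_left h, abs_lt]
        constructor <;> linarith
      · have h' : (u : ℝ) ≤ t := h
        rw [min_eq_right h, abs_lt]
        constructor <;> linarith

/-- Stopping both paths at t ≤ r leaves only the mesh error, so this form fits continuity at fixed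
times. -/
theorem norm_stopped_sub_stopped_approxFrom_le {δ ε : ℝ} (hδ : 0 < δ) (hε : 0 ≤ ε)
    (hω : ∀ u v : Time T, s₀ ≤ u → s₀ ≤ v → |(u : ℝ) - v| < 2 * δ → ‖Z u - Z v‖ ≤ ε)
    (hmesh : ∀ u, (succPt P u : ℝ) - u < δ) {t r : Time T} (htr : t ≤ r) (u : Time T) :
    ‖stopped Z t u - stopped (approxFrom s₀ P Z r) t u‖ ≤ ε := by
  simp only [stopped]
  have hv : min t u ≤ r := (min_le_left t u).trans htr
  generalize min t u = v at hv
  simp only [approxFrom, approxLeft, approx]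
  by_cases h1 : v < s₀
  · simpa [h1] using hε
  · by_cases h2 : v < r
    · have h3 : (v : ℝ) ≤ succPt P v := le_succPt P v
      have h4 := hmesh v
      simp only [h1, h2, if_true, if_false]
      refine hω _ _ (not_lt.1 h1) ((not_lt.1 h1).trans (le_succPt P v)) ?_
      rw [abs_lt]
      constructor <;> linarith
    · simpa [h1, h2, le_antisymm hv (not_lt.1 h2)] using hε

theorem exists_modulus (hZ : Continuous fun u => Z (max s₀ u)) {ε : ℝ} (hε : 0 < ε) :
    ∃ δ > 0, ∀ u v : Time T, s₀ ≤ u → s₀ ≤ v → |(u : ℝ) - v| < 2 * δ → ‖Z u - Z v‖ ≤ ε := by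
  have huc := CompactSpace.uniformContinuous_of_continuous hZ
  rw [Metric.uniformContinuous_iff] at huc
  obtain ⟨δ, hδ, h⟩ := huc ε hε
  refine ⟨δ / 2, half_pos hδ, fun u v hu hv huv => ?_⟩
  have := h (a := u) (b := v) (by rw [Subtype.dist_eq, Real.dist_eq]; linarith)
  rw [max_eq_right hu, max_eq_right hv, dist_eq_norm] at this
  exact this.le

end ApproxFrom

end FunctionalIto

namespace FunctionalIto

variable {T : ℝ} {d m : ℕ} {U : Set (E d)} {S : Set (E m)}

/-! ### The functional Itô formula -/

section Ito

variable {P : PartitionSeq T} {o e s₀ : Time T} {Z : PathFn T d} {B : PathFn T m}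

theorem eventually_norm_increment_le (hZc : Continuous fun u => Z (max s₀ u)) {ε : ℝ}
    (hε : 0 < ε) :
    ∀ᶠ n in atTop, ∀ r, s₀ ≤ r → ‖Z (succPt (P.pts n) r) - Z r‖ ≤ ε := by
  obtain ⟨δ, hδ, hω⟩ := exists_modulus hZc hε
  filter_upwards [P.mesh_all hδ] with n hn r hr
  refine hω _ _ (hr.trans (le_succPt _ r)) hr ?_
  have h1 : (r : ℝ) ≤ succPt (P.pts n) r := le_succPt _ r
  rw [abs_of_nonneg (by linarith)]
  linarith [(hn r).1]

/-- The approximating paths take only values of Z, whose range sits in a compact set; small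
increments stay in a compact thickening of it. One K thus serves all n, r and θ, as dominated
convergence needs. -/
theorem exists_compact_approxFrom (hU : IsOpen U) (ho : IsBot o) (he : IsTop e)
    (hZ : IsCadlag U Z) (hZc : Continuous fun u => Z (max s₀ u)) :
    ∃ K ⊆ U, IsCompact K ∧ IsCadlag K Z ∧ (∀ n r, IsCadlag K (approxFrom s₀ (P.pts n) Z r)) ∧
      ∀ᶠ n in atTop, ∀ r, s₀ ≤ r → ∀ θ ∈ Set.Icc (0 : ℝ) 1, IsCadlag K
        (bump (approxFrom s₀ (P.pts n) Z r) r (θ • (Z (succPt (P.pts n) r) - Z r))) := by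
  obtain ⟨K, hKU, hK, hZK⟩ := hZ.exists_compact
  obtain ⟨δ, hδ, hδU⟩ := hK.exists_cthickening_subset_open hU hKU
  have hsub := Metric.self_subset_cthickening (δ := δ) K
  refine ⟨Metric.cthickening δ K, hδU, hK.cthickening, hZK.mono hsub,
    fun n r => (isCadlag_approxFrom (P.isPartition ho he n) hZK r).mono hsub, ?_⟩
  filter_upwards [eventually_norm_increment_le (P := P) hZc hδ] with n hn r hr θ hθ
  refine (isCadlag_approxFrom (P.isPartition ho he n) hZK r).bump_cthickening r ?_
  rw [norm_smul, Real.norm_eq_abs, abs_of_nonneg hθ.1]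
  exact (mul_le_of_le_one_left (norm_nonneg _) hθ.2).trans (hn r hr)

/-- Left-continuous functionals evaluated along the approximating paths. -/
theorem LeftContinuous.leftUniformTendsto {Φ : Functional T d m} (hΦ : LeftContinuous U S Φ)
    (hU : IsOpen U) (ho : IsBot o) (he : IsTop e)
    (hZ : IsCadlag U Z) (hZc : Continuous fun u => Z (max s₀ u)) (hB : IsCBV S B)
    {θ : ℕ → Time T → ℝ} (hθ : ∀ n r, θ n r ∈ Set.Icc (0 : ℝ) 1) :
    LeftUniformTendsto P {s₀} (fun n r => if s₀ ≤ r then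
      Φ r (bump (approxFrom s₀ (P.pts n) Z r) r (θ n r • (Z (succPt (P.pts n) r) - Z r))) B else 0)
      ((Set.Ioi s₀).indicator fun u => Φ u Z B) := by
  intro t ht ε hε
  rcases lt_or_gt_of_ne (show t ≠ s₀ from ht) with hlt | hgt
  · refine ⟨1, one_pos, 0, fun n _ r _ hrt _ => ?_⟩
    simp [(hrt.trans_lt hlt).not_ge, hlt.le, hε]
  · have hgt' : (s₀ : ℝ) < t := hgt
    have ht0 : (0 : ℝ) < t := s₀.2.1.trans_lt hgt
    obtain ⟨δ₁, hδ₁, h1⟩ := hΦ t ht0 ε hε Z B hZ hB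
    have hδ3 : 0 < δ₁ / 3 := by positivity
    obtain ⟨δ₂, hδ₂, hω⟩ := exists_modulus hZc hδ3
    obtain ⟨K, hKU, -, -, -, hK⟩ := exists_compact_approxFrom (P := P) hU ho he hZ hZc
    obtain ⟨n₀, hn₀⟩ := eventually_atTop.1
      ((hK.and (eventually_norm_increment_le (P := P) hZc hδ3)).and (P.mesh_all hδ₂))
    -- The bound t − s₀ keeps r beyond s₀. The path error and the bump cost δ₁/3 each.
    refine ⟨min (min δ₁ δ₂) (t - s₀), lt_min (lt_min hδ₁ hδ₂) (sub_pos.2 hgt'), n₀,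
      fun n hn r hr hrt hd => ?_⟩
    obtain ⟨⟨hK', hinc⟩, hmesh⟩ := hn₀ n hn
    have hd1 : (t : ℝ) - r < δ₁ := hd.trans_le ((min_le_left _ _).trans (min_le_left _ _))
    have hd2 : (t : ℝ) - r < δ₂ := hd.trans_le ((min_le_left _ _).trans (min_le_right _ _))
    have hd3 : (t : ℝ) - r < t - s₀ := hd.trans_le (min_le_right _ _)
    have hsr : s₀ ≤ r := Subtype.coe_le_coe.1 (by linarith)
    beta_reduce
    rw [if_pos hsr, Set.indicator_of_mem (show t ∈ Set.Ioi s₀ from hgt), abs_sub_comm]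
    refine h1 r hrt hd1 _ ((hK' r hsr _ (hθ n r)).mono hKU) ?_
    refine (supNorm_le (C := δ₁ / 3 + δ₁ / 3) (by positivity) fun u => ?_).trans_lt (by linarith)
    rw [stopped_bump, stopped_approxFrom hsr]
    have hrt' : (r : ℝ) ≤ t := hrt
    have h2 := norm_stopped_sub_approxFrom_le hδ3.le hω (fun u => (hmesh u).1) hgt.le hsr
      (by rw [abs_of_nonneg (by linarith)]; exact hd2) u
    have h3 : ‖θ n r • (Z (succPt (P.pts n) r) - Z r)‖ ≤ δ₁ / 3 := by
      rw [norm_smul, Real.norm_eq_abs, abs_of_nonneg (hθ n r).1]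
      exact (mul_le_of_le_one_left (norm_nonneg _) (hθ n r).2).trans (hinc r hsr)
    have h4 : ‖(if r ≤ u then θ n r • (Z (succPt (P.pts n) r) - Z r) else 0 : E d)‖ ≤ δ₁ / 3 := by
      split_ifs
      · exact h3
      · simpa using hδ3.le
    simp only [Pi.sub_apply, bump, ← sub_sub]
    exact (norm_sub_le _ _).trans (add_le_add h2 h4)

theorem BoundednessPreserving.exists_bound_approxFrom {Φ : Functional T d m}
    (hΦ : BoundednessPreserving U S Φ) (hU : IsOpen U) (ho : IsBot o) (he : IsTop e)
    (hZ : IsCadlag U Z) (hZc : Continuous fun u => Z (max s₀ u)) (hB : IsCBV S B)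
    {θ : ℕ → Time T → ℝ} (hθ : ∀ n r, θ n r ∈ Set.Icc (0 : ℝ) 1) :
    ∃ C, ∀ᶠ n in atTop, ∀ r ∈ P.pts n, |if s₀ ≤ r then
      Φ r (bump (approxFrom s₀ (P.pts n) Z r) r (θ n r • (Z (succPt (P.pts n) r) - Z r))) B
        else 0| ≤ C := by
  obtain ⟨K, hKU, hKc, -, -, hK⟩ := exists_compact_approxFrom (P := P) hU ho he hZ hZc
  obtain ⟨C, hC⟩ := hΦ B hB K hKU hKc
  refine ⟨max C 0, ?_⟩
  filter_upwards [hK] with n hn r _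
  split_ifs with hr
  · exact (hC r _ (hn r hr _ (hθ n r))).trans (le_max_left _ _)
  · simp

/-- The approximating paths with θ = 0 present the integrand as a left-uniform limit, and such
limits are measurable and bounded. -/
theorem bddMeasOn_of_leftContinuous {Φ : Functional T d m} (hΦ : LeftContinuous U S Φ)
    (hΦb : BoundednessPreserving U S Φ) (P : PartitionSeq T) (hU : IsOpen U) (ho : IsBot o)
    (he : IsTop e) (hZ : IsCadlag U Z) (hZc : Continuous fun u => Z (max s₀ u)) (hB : IsCBV S B) :
    BddMeasOn (fun u => Φ u Z B) (Set.Ioi s₀) := by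
  have hθ : ∀ (n : ℕ) (r : Time T), (0 : ℝ) ∈ Set.Icc (0 : ℝ) 1 := fun _ _ => by simp
  obtain ⟨C, hC⟩ := hΦb.exists_bound_approxFrom (P := P) hU ho he hZ hZc hB hθ
  have h := (hΦ.leftUniformTendsto (P := P) hU ho he hZ hZc hB hθ).bddMeasOn ho he
    (J := Set.Ioi s₀) measurableSet_Ioi (fun u hu => ne_of_gt hu)
    (fun u hu => lt_of_le_of_lt (ho s₀) hu) hC
  exact h.congr fun u hu => Set.indicator_of_mem hu _

theorem measurable_indicator_of_Icc {f : Time T → ℝ} {a b : Time T}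
    (h : Measurable fun r : Set.Icc a b => f r) : Measurable ((Set.Ioc a b).indicator f) := by
  have h1 : Measurable ((Set.Icc a b).indicator f) := by
    refine measurable_of_restrict_of_restrict_compl (s := Set.Icc a b) measurableSet_Icc ?_ ?_
    · convert h using 1
      ext x
      simp
    · convert measurable_const (a := (0 : ℝ)) using 1
      ext x
      exact Set.indicator_of_notMem x.2 _
  have := h1.indicator (measurableSet_Ioc (a := a) (b := b))
  rwa [Set.indicator_indicator, Set.inter_eq_left.2 Set.Ioc_subset_Icc_self] at this

/-- The horizontal increments along the approximating paths are integrals that converge. -/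
theorem IsHorizontalDeriv.approx {F : Functional T d m} {D : Fin (m + 1) → Functional T d m}
    (hD : IsHorizontalDeriv U S F D) (hDc : ∀ i, ContinuousAtFixedTimes U S (D i))
    (hU : IsOpen U) (ho : IsBot o) (he : IsTop e) (hs₀ : ∀ n, s₀ ∈ P.pts n)
    (hZ : IsCadlag U Z) (hZc : Continuous fun u => Z (max s₀ u)) (hB : IsCBV S B) (t : Time T)
    (i : Fin (m + 1)) :
    BddMeasOn (fun u => D i u Z B) (Set.Ioc s₀ t) ∧
    Tendsto (fun n => ∑ r ∈ (P.pts n).filter (fun r => s₀ ≤ r ∧ r ≤ t),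
      lsIntegral (fun u => D i u (approxFrom s₀ (P.pts n) Z (succPt (P.pts n) r)) B)
        (withTime B i) (Set.Ioc r (succPt (P.pts n) r))) atTop
      (𝓝 (lsIntegral (fun u => D i u Z B) (withTime B i) (Set.Ioc s₀ t))) := by
  obtain ⟨K, hKU, hKc, hZK, hK, -⟩ := exists_compact_approxFrom (P := P) hU ho he hZ hZc
  obtain ⟨C, hC⟩ := hD.boundednessPreserving i B hB K hKU hKc
  have hP := P.isPartition ho he
  -- The integrands of all tiles, to be glued into one function of u. The sum of integrals becomes a
  -- single integral, open to dominated convergence.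
  let G : ℕ → Time T → Time T → ℝ := fun n r u => if s₀ ≤ r ∧ r ≤ t then
    D i u (approxFrom s₀ (P.pts n) Z (succPt (P.pts n) r)) B else 0
  have hGm : ∀ n, ∀ r ∈ P.pts n, BddMeasOn (G n r) (Set.Ioc r (succPt (P.pts n) r)) := by
    intro n r hr
    by_cases hc : s₀ ≤ r ∧ r ≤ t
    · simp only [G, hc, and_self, if_true]
      refine ⟨?_, C, fun u _ => hC u _ (hK n _)⟩
      rcases eq_or_lt_of_le (le_succPt (P.pts n) r) with h | h
      · rw [← h]
        simp
      · have := hD.measurable i r _ _ B h ((hK n (succPt (P.pts n) r)).mono hKU) hB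
        rw [stopped_approxFrom_succPt hc.1] at this
        exact measurable_indicator_of_Icc this
    · simp only [G, hc, if_false]
      exact BddMeasOn.const measurableSet_Ioc 0
  have hsum : ∀ n, ∑ r ∈ (P.pts n).filter (fun r => s₀ ≤ r ∧ r ≤ t),
      lsIntegral (fun u => D i u (approxFrom s₀ (P.pts n) Z (succPt (P.pts n) r)) B)
        (withTime B i) (Set.Ioc r (succPt (P.pts n) r))
      = lsIntegral (fun u => G n (prevPt (P.pts n) u) u) (withTime B i) (Set.Ioi o) := by
    intro n
    rw [(hP n).lsIntegral_piecewise (hGm n), Finset.sum_filter]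
    refine Finset.sum_congr rfl fun r _ => ?_
    by_cases hc : s₀ ≤ r ∧ r ≤ t
    · simp only [G, hc, and_self, if_true]
    · simp only [G, hc, if_false, lsIntegral_zero_left]
  have hGb : ∀ n u, |G n (prevPt (P.pts n) u) u| ≤ max C 0 := by
    intro n u
    simp only [G]
    split_ifs
    · exact (hC u _ (hK n _)).trans (le_max_left _ _)
    · simp
  have hlim : ∀ u ∈ Set.Ioi o, Tendsto (fun n => G n (prevPt (P.pts n) u) u) atTop
      (𝓝 ((Set.Ioc s₀ t).indicator (fun u => D i u Z B) u)) := by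
    intro u hu
    by_cases hus : u ≤ s₀
    · refine tendsto_const_nhds.congr fun n => ?_
      have h1 : ¬ s₀ ≤ prevPt (P.pts n) u := (((hP n).prevPt_lt hu).trans_le hus).not_ge
      simp [G, h1, hus.not_gt]
    · rw [not_le] at hus
      have hsp : ∀ n, s₀ ≤ prevPt (P.pts n) u := fun n => le_prevPt (hs₀ n) hus
      by_cases hut : u ≤ t
      · rw [Set.indicator_of_mem (show u ∈ Set.Ioc s₀ t from ⟨hus, hut⟩), Metric.tendsto_nhds]
        intro ε hε
        obtain ⟨δ₁, hδ₁, h1⟩ := hDc i ε hε u Z B hZ hB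
        obtain ⟨δ₂, hδ₂, hω⟩ := exists_modulus hZc (half_pos hδ₁)
        filter_upwards [P.mesh_all hδ₂] with n hn
        have hc : s₀ ≤ prevPt (P.pts n) u ∧ prevPt (P.pts n) u ≤ t :=
          ⟨hsp n, (prevPt_le _ u).trans hut⟩
        simp only [G, hc, and_self, if_true]
        rw [dist_comm, Real.dist_eq]
        refine h1 _ ((hK n _).mono hKU) ?_
        refine (supNorm_le (half_pos hδ₁).le fun v => ?_).trans_lt (half_lt_self hδ₁)
        exact norm_stopped_sub_stopped_approxFrom_le hδ₂ (half_pos hδ₁).le hω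
          (fun u => (hn u).1) ((hP n).le_succPt_prevPt u) v
      · refine tendsto_const_nhds.congr' ?_
        filter_upwards [(P.tendsto_prevPt u).eventually (lt_mem_nhds (not_le.1 hut))] with n hn
        simp [G, hn.not_ge, hut]
  constructor
  -- The definition of a horizontal derivative grants measurability only along stopped paths; along
  -- Z it follows by passing to the limit in the glued integrands.
  · refine ⟨?_, C, fun u _ => hC u Z hZK⟩
    refine measurable_of_tendsto_metrizable
      (fun n => (hP n).measurable_piecewise fun r hr => (hGm n r hr).meas)
      (tendsto_pi_nhds.2 fun u => ?_)
    by_cases hu : u ∈ Set.Ioi o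
    · simpa only [Set.indicator_of_mem hu] using hlim u hu
    · have h1 : u ∉ Set.Ioc s₀ t := fun h => hu (lt_of_le_of_lt (ho s₀) h.1)
      simp only [Set.indicator_of_notMem hu, Set.indicator_of_notMem h1]
      exact tendsto_const_nhds
  · simp only [hsum]
    have h1 : lsIntegral (fun u => D i u Z B) (withTime B i) (Set.Ioc s₀ t)
        = lsIntegral ((Set.Ioc s₀ t).indicator fun u => D i u Z B) (withTime B i) (Set.Ioi o) := by
      rw [lsIntegral_indicator measurableSet_Ioi measurableSet_Ioc, Set.inter_eq_right.2]
      exact fun u hu => lt_of_le_of_lt (ho s₀) hu.1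
    rw [h1]
    exact tendsto_lsIntegral (hB.isContBV_withTime i) measurableSet_Ioi Set.countable_empty
      (Eventually.of_forall fun n => (hP n).measurable_piecewise fun r hr => (hGm n r hr).meas)
      (Eventually.of_forall fun n u _ => hGb n u) fun u hu _ => hlim u hu

/-- Along a stopped path, a functional with a horizontal derivative is right-continuous in time. -/
theorem IsHorizontalDeriv.tendsto_right {F : Functional T d m}
    {D : Fin (m + 1) → Functional T d m} (hD : IsHorizontalDeriv U S F D) {X : PathFn T d}
    (hX : IsCadlag U X) (hB : IsCBV S B) (t : Time T) :
    Tendsto (fun u => F u (stopped X t) B) (𝓝[≥] t) (𝓝 (F t (stopped X t) B)) := by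
  have hT : 0 ≤ T := t.2.1.trans t.2.2
  set e : Time T := ⟨T, hT, le_rfl⟩
  have he : IsTop e := fun x => x.2.2
  have h1 : ∀ i, Tendsto (fun u => lsIntegral (fun r => D i r (stopped X t) B) (withTime B i)
      (Set.Ioc t u)) (𝓝[≥] t) (𝓝 0) := by
    intro i
    obtain ⟨K, hKU, hKc, hXK⟩ := (hX.stopped t).exists_compact
    obtain ⟨C, hC⟩ := hD.boundednessPreserving i B hB K hKU hKc
    have hm : Measurable ((Set.Ioc t e).indicator fun r => D i r (stopped X t) B) := by
      rcases eq_or_lt_of_le (he t) with h | h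
      · simp [h]
      · exact measurable_indicator_of_Icc (hD.measurable i t e X B h hX hB)
    have h2 : ∀ u, lsIntegral (fun r => D i r (stopped X t) B) (withTime B i) (Set.Ioc t u)
        = lsIntegral ((Set.Ioc t u).indicator fun r => D i r (stopped X t) B) (withTime B i)
          Set.univ := fun u => by
      rw [lsIntegral_indicator MeasurableSet.univ measurableSet_Ioc, Set.univ_inter]
    simp only [h2]
    have h3 := lsIntegral_zero_left (withTime B i) Set.univ
    suffices hz : Tendsto (fun u => lsIntegral ((Set.Ioc t u).indicator
        fun r => D i r (stopped X t) B) (withTime B i) Set.univ) (𝓝[≥] t)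
        (𝓝 (lsIntegral (fun _ => 0) (withTime B i) Set.univ)) by rwa [h3] at hz
    refine tendsto_lsIntegral (hB.isContBV_withTime i) MeasurableSet.univ Set.countable_empty
      (C := max C 0) (Eventually.of_forall fun u => ?_) (Eventually.of_forall fun u r _ => ?_) ?_
    · rw [Set.indicator_univ]
      have := hm.indicator (measurableSet_Ioc (a := t) (b := u))
      rwa [Set.indicator_indicator, Set.inter_eq_left.2 (Set.Ioc_subset_Ioc_right (he u))] at this
    · by_cases hr : r ∈ Set.Ioc t u
      · rw [Set.indicator_of_mem hr]
        exact (hC r _ hXK).trans (le_max_left _ _)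
      · rw [Set.indicator_of_notMem hr]
        simp
    · intro r _ _
      refine tendsto_const_nhds.congr' ?_
      by_cases hr : t < r
      · filter_upwards [mem_nhdsWithin_of_mem_nhds (Iio_mem_nhds hr)] with u hu
        simp [not_le.2 (Set.mem_Iio.1 hu)]
      · exact Eventually.of_forall fun u => by simp [hr]
  have h4 : Tendsto (fun u => F t (stopped X t) B + ∑ i, lsIntegral
      (fun r => D i r (stopped X t) B) (withTime B i) (Set.Ioc t u)) (𝓝[≥] t)
      (𝓝 (F t (stopped X t) B)) := by
    simpa using (tendsto_finsetSum Finset.univ fun i _ => h1 i).const_add (F t (stopped X t) B)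
  refine h4.congr' ?_
  filter_upwards [self_mem_nhdsWithin] with u hu
  rcases eq_or_lt_of_le (show t ≤ u from hu) with h | h
  · subst h
    simp [lsIntegral]
  · rw [← hD.integral_eq t u X B h hX hB]
    ring

/-- The telescoping sum ends at the successor t' rather than at t. Moving time from t' to t along
Z^t is harmless by horizontal right-continuity, and replacing the approximating path by Z^t by
locally uniform continuity. -/
theorem tendsto_approxFrom_endpoint {F : Functional T d m} (hF : NonAnticipative U S F)
    (hFc : ContinuousLocallyUniformly U S F) {D : Fin (m + 1) → Functional T d m}
    (hD : IsHorizontalDeriv U S F D) (ho : IsBot o) (he : IsTop e)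
    (hZ : IsCadlag U Z) (hZc : Continuous fun u => Z (max s₀ u)) (hB : IsCBV S B) {t : Time T}
    (hst : s₀ ≤ t) :
    Tendsto (fun n => F (succPt (P.pts n) t)
      (approxFrom s₀ (P.pts n) Z (succPt (P.pts n) t)) B) atTop (𝓝 (F t Z B)) := by
  have h1 : Tendsto (fun n => F (succPt (P.pts n) t) (stopped Z t) B) atTop (𝓝 (F t Z B)) := by
    rw [← hF.stopped_left hZ hB]
    refine (hD.tendsto_right hZ hB t).comp (tendsto_nhdsWithin_of_tendsto_nhds_of_eventually_within
      _ (P.tendsto_succPt t) (Eventually.of_forall fun n => le_succPt _ t))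
  have h2 : Tendsto (fun n => F (succPt (P.pts n) t) (stopped Z t) B
      - F (succPt (P.pts n) t) (approxFrom s₀ (P.pts n) Z (succPt (P.pts n) t)) B) atTop
      (𝓝 0) := by
    rw [Metric.tendsto_nhds]
    intro ε hε
    obtain ⟨δ₁, hδ₁, h⟩ := hFc ε hε t (stopped Z t) B (hZ.stopped t) hB
    obtain ⟨δ₂, hδ₂, hω⟩ := exists_modulus hZc (half_pos hδ₁)
    filter_upwards [P.mesh_all hδ₁, P.mesh_all hδ₂] with n hn1 hn2
    rw [Real.dist_eq, sub_zero]
    have hle : (t : ℝ) ≤ succPt (P.pts n) t := le_succPt _ t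
    have habs : |(t : ℝ) - succPt (P.pts n) t| = succPt (P.pts n) t - t := by
      rw [abs_sub_comm, abs_of_nonneg (by linarith)]
    refine h _ _ (isCadlag_approxFrom (P.isPartition ho he n) hZ _) ?_
      (habs ▸ (hn1 t).1)
    refine (supNorm_le (half_pos hδ₁).le fun v => ?_).trans_lt (half_lt_self hδ₁)
    exact norm_stopped_sub_approxFrom_le (half_pos hδ₁).le hω (fun u => (hn2 u).1) hst
      (hst.trans (le_succPt _ t)) (habs ▸ (hn2 t).1) v
  simpa using h1.sub h2

/-- The pathwise functional Itô formula on `[s₀, t]` for a path that is continuous from `s₀` on. -/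
theorem ito_formula {F : Functional T d m} (hF : MemC12c U S F)
    {D : Fin (m + 1) → Functional T d m} (hD : IsHorizontalDeriv U S F D)
    (hDc : ∀ i, ContinuousAtFixedTimes U S (D i)) (hU : IsOpen U) (ho : IsBot o) (he : IsTop e)
    (hs₀ : ∀ n, s₀ ∈ P.pts n) (hZ : IsCadlag U Z) (hZc : Continuous fun u => Z (max s₀ u))
    (hB : IsCBV S B) {Q : Fin d → Fin d → Time T → ℝ}
    (hQ : HasCovariation P (fun u => Z (max s₀ u)) Q) {t : Time T} (hst : s₀ ≤ t) :
    Tendsto (fun n => ∑ r ∈ (P.pts n).filter (· ≤ t),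
      inner ℝ (vgrad F r (approxFrom s₀ (P.pts n) Z r) B)
        (Z (max s₀ (succPt (P.pts n) r)) - Z (max s₀ r))) atTop
      (𝓝 (F t Z B - F s₀ Z B
        - ∑ i, lsIntegral (fun u => D i u Z B) (withTime B i) (Set.Ioc s₀ t)
        - (1 / 2) * ∑ i, ∑ j, lsIntegral (fun u => vpartial i (vpartial j F) u Z B) (Q i j)
          (Set.Ioc s₀ t))) := by
  have hP := P.isPartition ho he
  obtain ⟨K, hKU, hKc, hZK, hKa, hK⟩ := exists_compact_approxFrom (P := P) hU ho he hZ hZc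
  -- Taylor expansion at every partition point
  have htaylor : ∀ n r, ∃ θ ∈ Set.Icc (0 : ℝ) 1,
      (∀ θ ∈ Set.Icc (0 : ℝ) 1, IsCadlag K
        (bump (approxFrom s₀ (P.pts n) Z r) r (θ • (Z (succPt (P.pts n) r) - Z r)))) →
      F r (bump (approxFrom s₀ (P.pts n) Z r) r (Z (succPt (P.pts n) r) - Z r)) B
        - F r (approxFrom s₀ (P.pts n) Z r) B
      = inner ℝ (vgrad F r (approxFrom s₀ (P.pts n) Z r) B) (Z (succPt (P.pts n) r) - Z r)
        + (1 / 2) * ∑ i, ∑ j, vpartial i (vpartial j F) r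
          (bump (approxFrom s₀ (P.pts n) Z r) r (θ • (Z (succPt (P.pts n) r) - Z r))) B
          * ((Z (succPt (P.pts n) r) - Z r) i * (Z (succPt (P.pts n) r) - Z r) j) := by
    intro n r
    by_cases h : ∀ θ ∈ Set.Icc (0 : ℝ) 1, IsCadlag K
        (bump (approxFrom s₀ (P.pts n) Z r) r (θ • (Z (succPt (P.pts n) r) - Z r)))
    · obtain ⟨θ, hθ, h1⟩ := exists_vertical_taylor hF.vertical hF.vertical₂ hB
        (Z (succPt (P.pts n) r) - Z r) (fun θ hθ => (h θ hθ).mono hKU)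
      refine ⟨θ, Set.Ioo_subset_Icc_self hθ, fun _ => ?_⟩
      have h2 := (h 1 (by simp)).mono hKU
      rw [one_smul] at h2
      rwa [hF.nonAnticipative.stopped_right h2 hB,
        hF.nonAnticipative.stopped_right ((hKa n r).mono hKU) hB] at h1
    -- If some bumped path leaves K, any θ would do; 0 keeps θ in [0,1] for all n and r, as the
    -- convergence lemmas require.
    · exact ⟨0, by simp, fun h' => absurd h' h⟩
  choose θ hθ hθ' using htaylor
  let f : Fin d → Fin d → ℕ → Time T → ℝ := fun i j n r => if s₀ ≤ r then
    vpartial i (vpartial j F) r (bump (approxFrom s₀ (P.pts n) Z r) r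
      (θ n r • (Z (succPt (P.pts n) r) - Z r))) B else 0
  -- the second order terms
  have hsecond : ∀ i j, Tendsto (fun n => ∑ r ∈ P.pts n, (if r ≤ t then f i j n r else 0) *
      ((Z (max s₀ (succPt (P.pts n) r)) - Z (max s₀ r)) i
        * (Z (max s₀ (succPt (P.pts n) r)) - Z (max s₀ r)) j)) atTop
      (𝓝 (lsIntegral (fun u => vpartial i (vpartial j F) u Z B) (Q i j) (Set.Ioc s₀ t))) := by
    intro i j
    have hlu := (hF.vpartial₂_leftContinuous i j).leftUniformTendsto (P := P) hU ho he hZ hZc hB hθ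
    obtain ⟨C, hC⟩ := (hF.vpartial₂_boundednessPreserving i j).exists_bound_approxFrom (P := P)
      hU ho he hZ hZc hB hθ
    have hbm := bddMeasOn_of_leftContinuous (hF.vpartial₂_leftContinuous i j)
      (hF.vpartial₂_boundednessPreserving i j) P hU ho he hZ hZc hB
    have hind : (fun u => if u ≤ t then (Set.Ioi s₀).indicator
        (fun u => vpartial i (vpartial j F) u Z B) u else 0)
        = (Set.Ioc s₀ t).indicator (fun u => vpartial i (vpartial j F) u Z B) := by
      ext u
      by_cases h1 : u ≤ t <;> by_cases h2 : s₀ < u <;> simp [h1, h2]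
    have hsub : Set.Ioc s₀ t ⊆ Set.Ioi o := fun u hu => lt_of_le_of_lt (ho s₀) hu.1
    have hbm' : BddMeasOn ((Set.Ioc s₀ t).indicator
        (fun u => vpartial i (vpartial j F) u Z B)) (Set.Ioi o) := by
      obtain ⟨C', hC'⟩ := hbm.bdd
      refine ⟨?_, |C'|, fun u _ => ?_⟩
      · rw [Set.indicator_indicator, Set.inter_eq_right.2 hsub]
        exact (hbm.mono measurableSet_Ioc Set.Ioc_subset_Ioi_self).meas
      · by_cases hu : u ∈ Set.Ioc s₀ t
        · rw [Set.indicator_of_mem hu]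
          exact (hC' u hu.1).trans (le_abs_self _)
        · rw [Set.indicator_of_notMem hu]
          simp
    have hlu' := hlu.cutoff t
    rw [hind] at hlu'
    have hC2 : ∀ᶠ n in atTop, ∀ r ∈ P.pts n, |if r ≤ t then f i j n r else 0| ≤ max C 0 := by
      filter_upwards [hC] with n hn r hr
      split_ifs
      · exact (hn r hr).trans (le_max_left _ _)
      · simp
    have := hQ.tendsto_sum hZc ho he (Set.countable_singleton s₀) hlu' hC2 hbm' i j
    rwa [lsIntegral_indicator measurableSet_Ioi measurableSet_Ioc,
      Set.inter_eq_right.2 hsub] at this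
  have hfirst := fun i => (hD.approx hDc (P := P) hU ho he hs₀ hZ hZc hB t i).2
  have hend := tendsto_approxFrom_endpoint (P := P) hF.nonAnticipative
    hF.continuousLocallyUniformly hD ho he hZ hZc hB hst
  have hlim := ((hend.sub_const (F s₀ Z B)).sub (tendsto_finsetSum Finset.univ
    fun i _ => hfirst i)).sub ((tendsto_finsetSum Finset.univ fun i _ =>
      tendsto_finsetSum Finset.univ fun j _ => hsecond i j).const_mul (1 / 2))
  refine hlim.congr' ?_
  filter_upwards [hK] with n hn
  -- Up to time s₀ the approximating path started at s₀ is Z itself, so the telescoping sum begins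
  -- at the right value.
  have hstart : F s₀ Z B = F s₀ (approxFrom s₀ (P.pts n) Z s₀) B := by
    refine hF.nonAnticipative.congr hZ ((hKa n s₀).mono hKU) hB ?_
    ext u : 1
    rcases le_total s₀ u with h | h
    · simp [stopped, approxFrom, approxLeft, h]
    · rcases eq_or_lt_of_le h with h' | h'
      · simp [stopped, approxFrom, approxLeft, h']
      · simp [stopped, approxFrom, h, h']
  rw [hstart, ← (hP n).sum_telescope (hs₀ n) hst
    (fun r => F r (approxFrom s₀ (P.pts n) Z r) B)]
  have hfilter : ∀ g : Time T → ℝ, (∀ r, r < s₀ → g r = 0) →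
      ∑ r ∈ (P.pts n).filter (· ≤ t), g r
        = ∑ r ∈ (P.pts n).filter (fun r => s₀ ≤ r ∧ r ≤ t), g r := by
    intro g hg
    rw [Finset.sum_filter, Finset.sum_filter]
    refine Finset.sum_congr rfl fun r _ => ?_
    by_cases h : s₀ ≤ r
    · simp [h]
    · simp [h, hg r (not_le.1 h)]
  -- Since s₀ is a partition point, no partition interval straddles it.
  have hzero : ∀ r, r < s₀ → Z (max s₀ (succPt (P.pts n) r)) - Z (max s₀ r) = 0 := by
    intro r hr
    rw [max_eq_left hr.le, max_eq_left (succPt_le (hs₀ n) hr), sub_self]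
  rw [hfilter _ fun r hr => by rw [hzero r hr, inner_zero_right]]
  have hsec : ∀ i j, ∑ r ∈ P.pts n, (if r ≤ t then f i j n r else 0) *
      ((Z (max s₀ (succPt (P.pts n) r)) - Z (max s₀ r)) i
        * (Z (max s₀ (succPt (P.pts n) r)) - Z (max s₀ r)) j)
      = ∑ r ∈ (P.pts n).filter (fun r => s₀ ≤ r ∧ r ≤ t), f i j n r *
      ((Z (max s₀ (succPt (P.pts n) r)) - Z (max s₀ r)) i
        * (Z (max s₀ (succPt (P.pts n) r)) - Z (max s₀ r)) j) := by
    intro i j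
    rw [← hfilter _ fun r hr => by rw [hzero r hr]; simp, Finset.sum_filter]
    exact Finset.sum_congr rfl fun r _ => by split_ifs <;> simp
  simp only [hsec]
  rw [Finset.sum_comm, ← Finset.sum_sub_distrib]
  have hswap : ∑ i, ∑ j, ∑ r ∈ (P.pts n).filter (fun r => s₀ ≤ r ∧ r ≤ t), f i j n r *
      ((Z (max s₀ (succPt (P.pts n) r)) - Z (max s₀ r)) i
        * (Z (max s₀ (succPt (P.pts n) r)) - Z (max s₀ r)) j)
      = ∑ r ∈ (P.pts n).filter (fun r => s₀ ≤ r ∧ r ≤ t), ∑ i, ∑ j, f i j n r *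
      ((Z (max s₀ (succPt (P.pts n) r)) - Z (max s₀ r)) i
        * (Z (max s₀ (succPt (P.pts n) r)) - Z (max s₀ r)) j) := by
    rw [Finset.sum_congr rfl fun i _ => Finset.sum_comm, Finset.sum_comm]
  rw [hswap, Finset.mul_sum, ← Finset.sum_sub_distrib]
  -- On each interval the increment of F is a jump at r, given by Taylor, plus a horizontal move
  -- from r to r'.
  refine Finset.sum_congr rfl fun r hr => ?_
  obtain ⟨-, hsr, -⟩ := Finset.mem_filter.1 hr
  have hvert := hθ' n r (hn r hsr)
  rw [max_eq_right hsr, max_eq_right (hsr.trans (le_succPt (P.pts n) r))]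
  simp only [f, hsr, if_true]
  rw [← approxFrom_succPt hsr] at hvert
  have hhor : F (succPt (P.pts n) r) (approxFrom s₀ (P.pts n) Z (succPt (P.pts n) r)) B
      - F r (approxFrom s₀ (P.pts n) Z (succPt (P.pts n) r)) B
      = ∑ i, lsIntegral (fun u => D i u (approxFrom s₀ (P.pts n) Z (succPt (P.pts n) r)) B)
        (withTime B i) (Set.Ioc r (succPt (P.pts n) r)) := by
    rcases eq_or_lt_of_le (le_succPt (P.pts n) r) with h | h
    · rw [← h]
      simp [lsIntegral]
    · have := hD.integral_eq r _ _ B h ((hKa n (succPt (P.pts n) r)).mono hKU) hB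
      rwa [stopped_approxFrom_succPt hsr] at this
  linarith

end Ito

end FunctionalIto

namespace FunctionalIto

variable {T : ℝ} {d m ν p : ℕ} {U : Set (E d)} {S : Set (E m)}

/-! ### Algebra of regular functionals -/

/-- Non-anticipative and boundedness-preserving functionals. -/
structure Tame (U : Set (E d)) (S : Set (E m)) (Φ : Functional T d m) : Prop where
  nonAnticipative : NonAnticipative U S Φ
  boundednessPreserving : BoundednessPreserving U S Φ

/-- The filter of pairs `(s, Y)` with `s ↑ t` and `Y^s → X^t`. -/
def leftFilter (U : Set (E d)) (t : Time T) (X : PathFn T d) : Filter (Time T × PathFn T d) :=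
  ⨅ δ ∈ Set.Ioi (0 : ℝ), 𝓟 {q | q.1 ≤ t ∧ (t : ℝ) - q.1 < δ ∧ IsCadlag U q.2 ∧
    supNorm (stopped X t - stopped q.2 q.1) < δ}

/-- The filter of paths `Y` with `Y^t → X^t`. -/
def fixedFilter (U : Set (E d)) (t : Time T) (X : PathFn T d) : Filter (PathFn T d) :=
  ⨅ δ ∈ Set.Ioi (0 : ℝ), 𝓟 {Y | IsCadlag U Y ∧ supNorm (stopped X t - stopped Y t) < δ}

theorem leftFilter_hasBasis (U : Set (E d)) (t : Time T) (X : PathFn T d) :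
    (leftFilter U t X).HasBasis (fun δ : ℝ => δ ∈ Set.Ioi (0 : ℝ)) fun δ =>
      {q | q.1 ≤ t ∧ (t : ℝ) - q.1 < δ ∧ IsCadlag U q.2 ∧
        supNorm (stopped X t - stopped q.2 q.1) < δ} := by
  refine hasBasis_biInf_principal' (fun δ hδ δ' hδ' => ⟨min δ δ', Set.mem_Ioi.2 (lt_min hδ hδ'), ?_, ?_⟩)
    ⟨1, Set.mem_Ioi.2 one_pos⟩
  · exact fun q hq => ⟨hq.1, hq.2.1.trans_le (min_le_left _ _), hq.2.2.1,
      hq.2.2.2.trans_le (min_le_left _ _)⟩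
  · exact fun q hq => ⟨hq.1, hq.2.1.trans_le (min_le_right _ _), hq.2.2.1,
      hq.2.2.2.trans_le (min_le_right _ _)⟩

theorem fixedFilter_hasBasis (U : Set (E d)) (t : Time T) (X : PathFn T d) :
    (fixedFilter U t X).HasBasis (fun δ : ℝ => δ ∈ Set.Ioi (0 : ℝ)) fun δ =>
      {Y | IsCadlag U Y ∧ supNorm (stopped X t - stopped Y t) < δ} := by
  refine hasBasis_biInf_principal' (fun δ hδ δ' hδ' => ⟨min δ δ', Set.mem_Ioi.2 (lt_min hδ hδ'), ?_, ?_⟩)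
    ⟨1, Set.mem_Ioi.2 one_pos⟩
  · exact fun q hq => ⟨hq.1, hq.2.trans_le (min_le_left _ _)⟩
  · exact fun q hq => ⟨hq.1, hq.2.trans_le (min_le_right _ _)⟩

/-- In filter form, stability under sums, products and composition is inherited from `Tendsto`. -/
theorem leftContinuous_iff {Φ : Functional T d m} : LeftContinuous U S Φ ↔
    ∀ (t : Time T) X A, (0 : ℝ) < t → IsCadlag U X → IsCBV S A →
      Tendsto (fun q : Time T × PathFn T d => Φ q.1 q.2 A) (leftFilter U t X) (𝓝 (Φ t X A)) := by
  constructor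
  · intro h t X A ht hX hA
    refine ((leftFilter_hasBasis U t X).tendsto_iff Metric.nhds_basis_ball).2 fun ε hε => ?_
    obtain ⟨δ, hδ, h⟩ := h t ht ε hε X A hX hA
    refine ⟨δ, hδ, fun q hq => ?_⟩
    rw [Metric.mem_ball, dist_comm, Real.dist_eq]
    exact h q.1 hq.1 hq.2.1 q.2 hq.2.2.1 hq.2.2.2
  · intro h t ht ε hε X A hX hA
    obtain ⟨δ, hδ, h⟩ := ((leftFilter_hasBasis U t X).tendsto_iff Metric.nhds_basis_ball).1
      (h t X A ht hX hA) ε hε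
    refine ⟨δ, hδ, fun s hs hs' Y hY hXY => ?_⟩
    have := h (s, Y) ⟨hs, hs', hY, hXY⟩
    rwa [Metric.mem_ball, dist_comm, Real.dist_eq] at this

theorem continuousAtFixedTimes_iff {Φ : Functional T d m} : ContinuousAtFixedTimes U S Φ ↔
    ∀ (t : Time T) X A, IsCadlag U X → IsCBV S A →
      Tendsto (fun Y : PathFn T d => Φ t Y A) (fixedFilter U t X) (𝓝 (Φ t X A)) := by
  constructor
  · intro h t X A hX hA
    refine ((fixedFilter_hasBasis U t X).tendsto_iff Metric.nhds_basis_ball).2 fun ε hε => ?_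
    obtain ⟨δ, hδ, h⟩ := h ε hε t X A hX hA
    refine ⟨δ, hδ, fun Y hY => ?_⟩
    rw [Metric.mem_ball, dist_comm, Real.dist_eq]
    exact h Y hY.1 hY.2
  · intro h ε hε t X A hX hA
    obtain ⟨δ, hδ, h⟩ := ((fixedFilter_hasBasis U t X).tendsto_iff Metric.nhds_basis_ball).1
      (h t X A hX hA) ε hε
    refine ⟨δ, hδ, fun Y hY hXY => ?_⟩
    have := h Y ⟨hY, hXY⟩
    rwa [Metric.mem_ball, dist_comm, Real.dist_eq] at this

section Algebra

variable {Φ Ψ : Functional T d m}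

theorem NonAnticipative.sum_mul {ι : Type*} (s : Finset ι) {Φ Ψ : ι → Functional T d m}
    (hΦ : ∀ l ∈ s, NonAnticipative U S (Φ l)) (hΨ : ∀ l ∈ s, NonAnticipative U S (Ψ l)) :
    NonAnticipative U S fun t X A => ∑ l ∈ s, Φ l t X A * Ψ l t X A :=
  fun t X A hX hA => Finset.sum_congr rfl fun l hl => by
    rw [← hΦ l hl t X A hX hA, ← hΨ l hl t X A hX hA]

theorem NonAnticipative.add (hΦ : NonAnticipative U S Φ) (hΨ : NonAnticipative U S Ψ) :
    NonAnticipative U S fun t X A => Φ t X A + Ψ t X A :=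
  fun t X A hX hA => congrArg₂ (· + ·) (hΦ t X A hX hA) (hΨ t X A hX hA)

theorem BoundednessPreserving.sum_mul {ι : Type*} (s : Finset ι) {Φ Ψ : ι → Functional T d m}
    (hΦ : ∀ l ∈ s, BoundednessPreserving U S (Φ l))
    (hΨ : ∀ l ∈ s, BoundednessPreserving U S (Ψ l)) :
    BoundednessPreserving U S fun t X A => ∑ l ∈ s, Φ l t X A * Ψ l t X A := by
  intro A hA K hK hKc
  choose! C hC using fun l hl => hΦ l hl A hA K hK hKc
  choose! C' hC' using fun l hl => hΨ l hl A hA K hK hKc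
  refine ⟨∑ l ∈ s, C l * C' l, fun t X hX => (Finset.abs_sum_le_sum_abs _ _).trans
    (Finset.sum_le_sum fun l hl => ?_)⟩
  rw [abs_mul]
  exact mul_le_mul (hC l hl t X hX) (hC' l hl t X hX) (abs_nonneg _)
    ((abs_nonneg _).trans (hC l hl t X hX))

theorem BoundednessPreserving.add (hΦ : BoundednessPreserving U S Φ)
    (hΨ : BoundednessPreserving U S Ψ) :
    BoundednessPreserving U S fun t X A => Φ t X A + Ψ t X A := by
  intro A hA K hK hKc
  obtain ⟨C, hC⟩ := hΦ A hA K hK hKc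
  obtain ⟨C', hC'⟩ := hΨ A hA K hK hKc
  exact ⟨C + C', fun t X hX => (abs_add_le _ _).trans (add_le_add (hC t X hX) (hC' t X hX))⟩

theorem BoundednessPreserving.congr (hΦ : BoundednessPreserving U S Φ)
    (h : ∀ t X A, IsCadlag U X → IsCBV S A → Ψ t X A = Φ t X A) : BoundednessPreserving U S Ψ := by
  intro A hA K hK hKc
  obtain ⟨C, hC⟩ := hΦ A hA K hK hKc
  exact ⟨C, fun t X hX => by rw [h t X A (hX.mono hK) hA]; exact hC t X hX⟩

theorem Tame.sum_mul {ι : Type*} (s : Finset ι) {Φ Ψ : ι → Functional T d m}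
    (hΦ : ∀ l ∈ s, Tame U S (Φ l)) (hΨ : ∀ l ∈ s, Tame U S (Ψ l)) :
    Tame U S fun t X A => ∑ l ∈ s, Φ l t X A * Ψ l t X A :=
  ⟨.sum_mul s (fun l hl => (hΦ l hl).1) fun l hl => (hΨ l hl).1,
    .sum_mul s (fun l hl => (hΦ l hl).2) fun l hl => (hΨ l hl).2⟩

theorem Tame.add (hΦ : Tame U S Φ) (hΨ : Tame U S Ψ) :
    Tame U S fun t X A => Φ t X A + Ψ t X A :=
  ⟨hΦ.1.add hΨ.1, hΦ.2.add hΨ.2⟩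

theorem LeftContinuous.sum_mul {ι : Type*} (s : Finset ι) {Φ Ψ : ι → Functional T d m}
    (hΦ : ∀ l ∈ s, LeftContinuous U S (Φ l)) (hΨ : ∀ l ∈ s, LeftContinuous U S (Ψ l)) :
    LeftContinuous U S fun t X A => ∑ l ∈ s, Φ l t X A * Ψ l t X A :=
  leftContinuous_iff.2 fun t X A ht hX hA => tendsto_finsetSum _ fun l hl =>
    (leftContinuous_iff.1 (hΦ l hl) t X A ht hX hA).mul
      (leftContinuous_iff.1 (hΨ l hl) t X A ht hX hA)

theorem LeftContinuous.add (hΦ : LeftContinuous U S Φ) (hΨ : LeftContinuous U S Ψ) :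
    LeftContinuous U S fun t X A => Φ t X A + Ψ t X A :=
  leftContinuous_iff.2 fun t X A ht hX hA =>
    (leftContinuous_iff.1 hΦ t X A ht hX hA).add (leftContinuous_iff.1 hΨ t X A ht hX hA)

theorem LeftContinuous.congr (hΦ : LeftContinuous U S Φ)
    (h : ∀ t X A, IsCadlag U X → IsCBV S A → Ψ t X A = Φ t X A) : LeftContinuous U S Ψ := by
  intro t ht ε hε X A hX hA
  obtain ⟨δ, hδ, H⟩ := hΦ t ht ε hε X A hX hA
  refine ⟨δ, hδ, fun s hs hs' Y hY hXY => ?_⟩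
  rw [h t X A hX hA, h s Y A hY hA]
  exact H s hs hs' Y hY hXY

theorem ContinuousAtFixedTimes.sum_mul {ι : Type*} (s : Finset ι) {Φ Ψ : ι → Functional T d m}
    (hΦ : ∀ l ∈ s, ContinuousAtFixedTimes U S (Φ l))
    (hΨ : ∀ l ∈ s, ContinuousAtFixedTimes U S (Ψ l)) :
    ContinuousAtFixedTimes U S fun t X A => ∑ l ∈ s, Φ l t X A * Ψ l t X A :=
  continuousAtFixedTimes_iff.2 fun t X A hX hA => tendsto_finsetSum _ fun l hl =>
    (continuousAtFixedTimes_iff.1 (hΦ l hl) t X A hX hA).mul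
      (continuousAtFixedTimes_iff.1 (hΨ l hl) t X A hX hA)

theorem ContinuousAtFixedTimes.add (hΦ : ContinuousAtFixedTimes U S Φ)
    (hΨ : ContinuousAtFixedTimes U S Ψ) :
    ContinuousAtFixedTimes U S fun t X A => Φ t X A + Ψ t X A :=
  continuousAtFixedTimes_iff.2 fun t X A hX hA =>
    (continuousAtFixedTimes_iff.1 hΦ t X A hX hA).add
      (continuousAtFixedTimes_iff.1 hΨ t X A hX hA)

/-- A non-anticipative, left-continuous, vertically differentiable functional is continuous at
fixed times; at time `0` this uses the vertical differentiability. -/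
theorem LeftContinuous.continuousAtFixedTimes (hΦ : LeftContinuous U S Φ)
    (hΦn : NonAnticipative U S Φ) (hΦv : VerticallyDifferentiable U S Φ) :
    ContinuousAtFixedTimes U S Φ := by
  intro ε hε t X A hX hA
  rcases eq_or_lt_of_le t.2.1 with ht | ht
  · have hbot : ∀ u : Time T, t ≤ u := fun u => by
      rw [← Subtype.coe_le_coe, ← ht]; exact u.2.1
    have hc := (hΦv t (stopped X t) A (hX.stopped t) hA).continuousAt
    obtain ⟨δ, hδ, hc⟩ := Metric.continuousAt_iff.1 hc ε hε
    refine ⟨δ, hδ, fun Y hY hXY => ?_⟩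
    have h0 := (hX.stopped t).norm_sub_le_supNorm (hY.stopped t) t
    have h1 := @hc (Y t - X t) (by
      rw [dist_zero_right, norm_sub_rev]
      simpa [stopped] using h0.trans_lt hXY)
    have h2 : bump (stopped X t) t (Y t - X t) = stopped Y t := by
      ext u : 1
      simp [bump, stopped, hbot u]
    rw [h2, bump_zero, dist_comm, Real.dist_eq, ← hΦn t X A hX hA, ← hΦn t Y A hY hA] at h1
    exact h1
  · obtain ⟨δ, hδ, h⟩ := hΦ t ht ε hε X A hX hA
    exact ⟨δ, hδ, fun Y hY hXY => h t le_rfl (by simpa using hδ) Y hY hXY⟩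

end Algebra

/-! ### The image path -/

theorem exists_pos_forall {ι : Type*} [Finite ι] {p : ι → ℝ → Prop}
    (hm : ∀ l δ δ', δ' ≤ δ → p l δ → p l δ') (h : ∀ l, ∃ δ > 0, p l δ) :
    ∃ δ > 0, ∀ l, p l δ := by
  choose δ hδ hp using h
  have h1 : ∀ᶠ x in 𝓝[>] (0 : ℝ), ∀ l, x ≤ δ l := eventually_all.2 fun l =>
    (eventually_le_nhds (hδ l)).filter_mono nhdsWithin_le_nhds
  obtain ⟨x, hx, hx0⟩ := (h1.and self_mem_nhdsWithin).exists
  exact ⟨x, hx0, fun l => hm l _ _ (hx l) (hp l)⟩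

theorem exists_norm_le_of_coord {ε : ℝ} (hε : 0 < ε) :
    ∃ ε' > 0, ∀ x : E ν, (∀ i, |x i| < ε') → ‖x‖ < ε := by
  have hc := (PiLp.continuous_toLp 2 (fun _ : Fin ν => ℝ)).continuousAt (x := 0)
  obtain ⟨ε', hε', h⟩ := Metric.continuousAt_iff.1 hc ε hε
  refine ⟨ε', hε', fun x hx => ?_⟩
  have := @h x.ofLp ((dist_pi_lt_iff hε').2 fun i => by simpa using hx i)
  simpa using this

theorem IsCadlag.of_isClosed {K : Set (E d)} (hK : IsClosed K) {X : PathFn T d}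
    (hX : IsCadlag U X) (h : ∀ u, X u ∈ K) : IsCadlag K X := by
  refine ⟨h, hX.right, fun t => ?_⟩
  rcases (𝓝[<] t).eq_or_neBot with hb | hb
  · exact ⟨X t, h t, by rw [hb]; exact tendsto_bot⟩
  · obtain ⟨l, -, hl⟩ := hX.left t
    exact ⟨l, hK.mem_of_tendsto hl (Eventually.of_forall h), hl⟩

/-- Finitely many of the time neighbourhoods cover [0,T], and the smallest of their radii works for
all times. -/
theorem ContinuousLocallyUniformly.uniform {F : Functional T d m}
    (hF : ContinuousLocallyUniformly U S F) {X : PathFn T d} {A : PathFn T m}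
    (hX : IsCadlag U X) (hA : IsCBV S A) {ε : ℝ} (hε : 0 < ε) :
    ∃ δ > 0, ∀ Z, IsCadlag U Z → supNorm (X - Z) < δ → ∀ u, |F u X A - F u Z A| < ε := by
  have := (isCompact_univ (X := Time T)).induction_on
    (p := fun s => ∃ δ > 0, ∀ Z, IsCadlag U Z → supNorm (X - Z) < δ →
      ∀ u ∈ s, |F u X A - F u Z A| < ε)
    ⟨1, one_pos, fun _ _ _ u hu => absurd hu (Set.notMem_empty u)⟩
    (fun s t hst ⟨δ, hδ, h⟩ => ⟨δ, hδ, fun Z hZ hXZ u hu => h Z hZ hXZ u (hst hu)⟩)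
    (fun s t ⟨δ, hδ, h⟩ ⟨δ', hδ', h'⟩ => ⟨min δ δ', lt_min hδ hδ', fun Z hZ hXZ u hu =>
      hu.elim (h Z hZ (hXZ.trans_le (min_le_left _ _)) u)
        (h' Z hZ (hXZ.trans_le (min_le_right _ _)) u)⟩)
    (fun t _ => by
      obtain ⟨δ, hδ, h⟩ := hF ε hε t X A hX hA
      refine ⟨Metric.ball t δ, mem_nhdsWithin_of_mem_nhds (Metric.ball_mem_nhds t hδ), δ, hδ,
        fun Z hZ hXZ u hu => h u Z hZ hXZ ?_⟩
      rw [Metric.mem_ball, dist_comm, Subtype.dist_eq, Real.dist_eq] at hu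
      exact hu)
  simpa using this

section Image

variable {F : Fin ν → Functional T d m} {X : PathFn T d} {A : PathFn T m}

@[simp]
theorem imagePath_apply (F : Fin ν → Functional T d m) (X : PathFn T d) (A : PathFn T m)
    (t : Time T) (l : Fin ν) : imagePath F X A t l = F l t X A := rfl

theorem tendsto_imagePath {ι : Type*} {f : Filter ι} {t : ι → Time T} {Z : ι → PathFn T d}
    {y : Fin ν → ℝ} (h : ∀ l, Tendsto (fun i => F l (t i) (Z i) A) f (𝓝 (y l))) :
    Tendsto (fun i => imagePath F (Z i) A (t i)) f (𝓝 (WithLp.toLp 2 y)) :=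
  ((PiLp.continuous_toLp 2 (fun _ : Fin ν => ℝ)).tendsto y).comp (tendsto_pi_nhds.2 h)

theorem nhdsLT_eq_bot_of_zero {t : Time T} (ht : (t : ℝ) = 0) : 𝓝[<] t = ⊥ := by
  have : Set.Iio t = ∅ := Set.eq_empty_of_forall_notMem fun u (hu : u < t) => by
    have h1 : (u : ℝ) < t := hu
    linarith [u.2.1]
  rw [this, nhdsWithin_empty]

/-- The limit is the value at the path that follows X before t and stays at the left limit
afterwards. As s ↑ t, the path X^s approaches it uniformly, because X is close to x just before t.
This provides the left limits of the image path. -/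
theorem LeftContinuous.tendsto_left {F : Functional T d m} (hF : LeftContinuous U S F)
    (hX : IsCadlag U X) (hA : IsCBV S A) {t : Time T} (ht : (0 : ℝ) < t) {x : E d} (hx : x ∈ U)
    (hl : Tendsto X (𝓝[<] t) (𝓝 x)) :
    Tendsto (fun s => F s X A) (𝓝[<] t) (𝓝 (F t (fun u => if u < t then X u else x) A)) := by
  set Y : PathFn T d := fun u => if u < t then X u else x with hY
  have hYc : IsCadlag U Y := hX.ite_lt (IsCadlag.const hx) t
  refine Metric.tendsto_nhds.2 fun ε hε => ?_
  obtain ⟨δ, hδ, h⟩ := hF t ht ε hε Y A hYc hA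
  have h1 : ∀ᶠ s in 𝓝[<] t, dist (X s) x < δ / 4 := Metric.tendsto_nhds.1 hl _ (by linarith)
  have ht0 : (⟨0, le_rfl, t.2.1.trans t.2.2⟩ : Time T) < t := ht
  obtain ⟨a, ha, hax⟩ := (mem_nhdsLT_iff_exists_Ioo_subset' ht0).1 h1
  have h2 : ∀ᶠ s : Time T in 𝓝[<] t, (t : ℝ) - s < δ := by
    have : Tendsto (fun s : Time T => (t : ℝ) - s) (𝓝[<] t) (𝓝 ((t : ℝ) - t)) :=
      ((continuous_const.sub continuous_subtype_val).tendsto t).mono_left nhdsWithin_le_nhds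
    rw [sub_self] at this
    exact this.eventually_lt_const hδ
  filter_upwards [h2, Ioo_mem_nhdsLT ha] with s hs has
  rw [dist_comm, Real.dist_eq]
  refine h s has.2.le hs X hX ?_
  refine lt_of_le_of_lt (supNorm_le (C := δ / 2) (by linarith) fun u => ?_) (by linarith)
  have hs' : dist (X s) x < δ / 4 := hax has
  simp only [Pi.sub_apply, stopped, hY]
  rcases le_or_gt u s with hus | hus
  · have hut : u < t := hus.trans_lt has.2
    simp only [min_eq_right hut.le, min_eq_right hus, hut, if_true, sub_self, norm_zero]
    linarith
  · rw [min_eq_left hus.le]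
    rcases lt_or_ge u t with hut | hut
    · have hu' : dist (X u) x < δ / 4 := hax ⟨has.1.trans hus, hut⟩
      rw [min_eq_right hut.le, if_pos hut, ← dist_eq_norm]
      linarith [dist_triangle_right (X u) (X s) x]
    · rw [min_eq_left hut, if_neg (lt_irrefl t), ← dist_eq_norm, dist_comm]
      linarith

/-- Along X^t right-continuity in time comes from the horizontal derivative. Replacing X^t by X^u
costs little, by right-continuity of X and locally uniform continuity of the functional. -/
theorem MemC12c.tendsto_right {F : Functional T d m} (hF : MemC12c U S F)
    (hX : IsCadlag U X) (hA : IsCBV S A) (t : Time T) :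
    Tendsto (fun u => F u X A) (𝓝[≥] t) (𝓝 (F t X A)) := by
  obtain ⟨D, hD, -⟩ := hF.horizontal
  have h1 := hD.tendsto_right hX hA t
  rw [hF.nonAnticipative.stopped_left hX hA] at h1
  suffices Tendsto (fun u => F u (stopped X t) A - F u X A) (𝓝[≥] t) (𝓝 0) by
    simpa using h1.sub this
  refine Metric.tendsto_nhds.2 fun ε hε => ?_
  obtain ⟨δ, hδ, h⟩ := hF.continuousLocallyUniformly ε hε t _ A (hX.stopped t) hA
  have h2 : ∀ᶠ u in 𝓝[≥] t, dist (X u) (X t) < δ / 2 :=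
    Metric.tendsto_nhds.1 (hX.right t) _ (by linarith)
  obtain ⟨η, hη, hb⟩ := Metric.mem_nhdsWithin_iff.1 h2
  have h3 : ∀ᶠ u in 𝓝[≥] t, dist u t < min η δ :=
    nhdsWithin_le_nhds (Metric.ball_mem_nhds t (lt_min hη hδ))
  filter_upwards [h3, self_mem_nhdsWithin] with u hu (htu : t ≤ u)
  rw [dist_zero_right, Real.norm_eq_abs, ← hF.nonAnticipative.stopped_left hX hA (t := u)]
  have hu' : |(u : ℝ) - t| < min η δ := by rwa [Subtype.dist_eq, Real.dist_eq] at hu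
  refine h u _ (hX.stopped u) ?_ (by rw [abs_sub_comm]; exact hu'.trans_le (min_le_right _ _))
  refine lt_of_le_of_lt (supNorm_le (C := δ / 2) (by linarith) fun v => ?_) (by linarith)
  simp only [Pi.sub_apply, stopped]
  rcases le_total v t with hvt | hvt
  · rw [min_eq_right hvt, min_eq_right (hvt.trans htu), sub_self, norm_zero]; linarith
  · rw [min_eq_left hvt, ← dist_eq_norm, dist_comm]
    refine le_of_lt (hb ⟨?_, le_min htu hvt⟩)
    rw [Metric.mem_ball, Subtype.dist_eq, Real.dist_eq]
    have h4 : (t : ℝ) ≤ (min u v : Time T) := Subtype.coe_le_coe.2 (le_min htu hvt)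
    have h5 : ((min u v : Time T) : ℝ) ≤ u := Subtype.coe_le_coe.2 (min_le_left u v)
    rw [abs_of_nonneg (by linarith)]
    have := (abs_lt.1 hu').2
    linarith [min_le_left η δ]

theorem isCadlag_imagePath (hF : ∀ l, MemC12c U S (F l)) (hX : IsCadlag U X) (hA : IsCBV S A) :
    IsCadlag Set.univ (imagePath F X A) := by
  refine ⟨fun _ => Set.mem_univ _, fun t => ?_, fun t => ?_⟩
  · exact tendsto_imagePath (t := fun u => u) (Z := fun _ => X)
      fun l => (hF l).tendsto_right hX hA t
  · rcases eq_or_lt_of_le t.2.1 with ht | ht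
    · exact ⟨0, Set.mem_univ _, by rw [nhdsLT_eq_bot_of_zero ht.symm]; exact tendsto_bot⟩
    · obtain ⟨x, hx, hl⟩ := hX.left t
      exact ⟨_, Set.mem_univ _, tendsto_imagePath (t := fun u => u) (Z := fun _ => X)
        fun l => (hF l).leftContinuous.tendsto_left hX hA ht hx hl⟩

/-- For continuous X the left-limit path at t agrees with X up to t, so the left limit of each
coordinate is its value. -/
theorem continuous_imagePath (hF : ∀ l, MemC12c U S (F l)) (hXc : Continuous X)
    (hXU : ∀ t, X t ∈ U) (hA : IsCBV S A) : Continuous (imagePath F X A) := by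
  have hX := IsCadlag.of_continuous hXc hXU
  refine continuous_iff_continuousAt.2 fun t => ?_
  rw [ContinuousAt, ← nhdsLT_sup_nhdsGE_time, tendsto_sup]
  refine ⟨?_, (isCadlag_imagePath hF hX hA).right t⟩
  rcases eq_or_lt_of_le t.2.1 with ht | ht
  · rw [nhdsLT_eq_bot_of_zero ht.symm]; exact tendsto_bot
  · refine tendsto_imagePath (t := fun u => u) (Z := fun _ => X) fun l => ?_
    have h := (hF l).leftContinuous.tendsto_left hX hA ht (hXU t)
      ((hXc.tendsto t).mono_left nhdsWithin_le_nhds)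
    rwa [(hF l).nonAnticipative.congr (hX.ite_lt (IsCadlag.const (hXU t)) t) hX hA
      (by
        ext u : 1
        rcases lt_or_ge u t with hu | hu <;> simp [stopped, hu, le_of_lt])] at h

theorem exists_compact_imagePath (hF : ∀ l, MemC12c U S (F l)) (hA : IsCBV S A) {K : Set (E d)}
    (hK : K ⊆ U) (hKc : IsCompact K) :
    ∃ K' : Set (E ν), IsCompact K' ∧ ∀ X, IsCadlag K X → IsCadlag K' (imagePath F X A) := by
  choose C hC using fun l => (hF l).boundednessPreserving A hA K hK hKc
  have hK' : IsCompact ((WithLp.toLp 2 : (Fin ν → ℝ) → E ν) ''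
      Set.univ.pi fun l => Set.Icc (-C l) (C l)) :=
    (isCompact_univ_pi fun l => isCompact_Icc).image (PiLp.continuous_toLp 2 _)
  exact ⟨_, hK', fun X hX => (isCadlag_imagePath hF (hX.mono hK) hA).of_isClosed hK'.isClosed
    fun u => ⟨_, fun l _ => abs_le.1 (hC l u X hX), rfl⟩⟩

theorem stopped_imagePath (hF : ∀ l, NonAnticipative U S (F l)) (hX : IsCadlag U X)
    (hA : IsCBV S A) {Y : PathFn T d} (hY : IsCadlag U Y) {B : PathFn T m} (hB : IsCBV S B)
    {t : Time T} (hXY : stopped X t = stopped Y t) (hAB : stopped A t = stopped B t) :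
    stopped (imagePath F X A) t = stopped (imagePath F Y B) t := by
  ext u l
  simp only [stopped, imagePath_apply]
  have h : ∀ {n : ℕ} {x y : PathFn T n}, stopped x t = stopped y t →
      stopped x (min t u) = stopped y (min t u) := fun {n x y} hxy => by
    have := congrArg (fun z => stopped z (min t u)) hxy
    simpa [stopped_stopped, ← min_assoc] using this
  rw [hF l _ X A hX hA, hF l _ Y B hY hB, h hXY, h hAB]

theorem exists_imagePath_close (hF : ∀ l, MemC12c U S (F l)) (hX : IsCadlag U X) (hA : IsCBV S A)
    {ε : ℝ} (hε : 0 < ε) :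
    ∃ δ > 0, ∀ Z, IsCadlag U Z → supNorm (X - Z) < δ →
      ∀ u l, |F l u X A - F l u Z A| < ε := by
  obtain ⟨δ, hδ, h⟩ := exists_pos_forall (p := fun l δ => ∀ Z, IsCadlag U Z →
      supNorm (X - Z) < δ → ∀ u, |F l u X A - F l u Z A| < ε)
    (fun l δ δ' hle h Z hZ hXZ => h Z hZ (hXZ.trans_le hle))
    fun l => (hF l).continuousLocallyUniformly.uniform hX hA hε
  exact ⟨δ, hδ, fun Z hZ hXZ u l => h l Z hZ hXZ u⟩

theorem tendsto_imagePath_fixedFilter (hF : ∀ l, MemC12c U S (F l)) (hX : IsCadlag U X)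
    (hA : IsCBV S A) (t : Time T) :
    Tendsto (fun Z => imagePath F Z A) (fixedFilter U t X)
      (fixedFilter Set.univ t (imagePath F X A)) := by
  refine ((fixedFilter_hasBasis U t X).tendsto_iff (fixedFilter_hasBasis _ t _)).2 fun ε hε => ?_
  obtain ⟨ε', hε', hn⟩ := exists_norm_le_of_coord (ν := ν) (half_pos (Set.mem_Ioi.1 hε))
  obtain ⟨δ, hδ, h⟩ := exists_imagePath_close hF (hX.stopped t) hA hε'
  refine ⟨δ, hδ, fun Z hZ => ⟨isCadlag_imagePath hF hZ.1 hA, ?_⟩⟩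
  refine lt_of_le_of_lt (supNorm_le (half_pos hε).le fun u => ?_) (half_lt_self hε)
  refine (hn _ fun l => ?_).le
  have := h _ (hZ.1.stopped t) hZ.2 (min t u) l
  have h' : ∀ W : PathFn T d, IsCadlag U W →
      F l (min t u) (stopped W t) A = F l (min t u) W A := fun W hW =>
    (hF l).nonAnticipative.congr (hW.stopped t) hW hA (by simp [stopped_stopped])
  rwa [h' X hX, h' Z hZ.1] at this

/-- Up to s the image paths are close uniformly in time. Between s and t, the image of X at time v
and the image of Z at time s are both close to the image of X at t, by left-continuity at t. -/
theorem tendsto_imagePath_leftFilter (hF : ∀ l, MemC12c U S (F l)) (hX : IsCadlag U X)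
    (hA : IsCBV S A) {t : Time T} (ht : (0 : ℝ) < t) :
    Tendsto (fun q : Time T × PathFn T d => (q.1, imagePath F q.2 A)) (leftFilter U t X)
      (leftFilter Set.univ t (imagePath F X A)) := by
  refine ((leftFilter_hasBasis U t X).tendsto_iff (leftFilter_hasBasis _ t _)).2 fun ε hε => ?_
  obtain ⟨ε', hε', hn⟩ := exists_norm_le_of_coord (ν := ν) (half_pos (Set.mem_Ioi.1 hε))
  obtain ⟨δ₁, hδ₁, h₁⟩ := exists_imagePath_close hF (hX.stopped t) hA hε'
  obtain ⟨δ₂, hδ₂, h₂⟩ := exists_pos_forall (p := fun l δ => ∀ s ≤ t, (t : ℝ) - s < δ →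
      ∀ Y, IsCadlag U Y → supNorm (stopped X t - stopped Y s) < δ →
      |F l t X A - F l s Y A| < ε' / 2)
    (fun l δ δ' hle h s hs hs' Z hZ hXZ => h s hs (hs'.trans_le hle) Z hZ (hXZ.trans_le hle))
    fun l => (hF l).leftContinuous t ht (ε' / 2) (half_pos hε') X A hX hA
  refine ⟨min ε (min δ₁ (δ₂ / 3)), lt_min hε (lt_min hδ₁ (by linarith)), ?_⟩
  rintro ⟨s, Z⟩ ⟨hs, hs', hZ, hXZ⟩
  simp only at hs hs' hZ hXZ
  simp only [lt_min_iff] at hs' hXZ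
  refine ⟨hs, hs'.1, isCadlag_imagePath hF hZ hA, ?_⟩
  refine lt_of_le_of_lt (supNorm_le (half_pos hε).le fun u => ?_) (half_lt_self hε)
  refine (hn _ fun l => ?_).le
  simp only [Pi.sub_apply, stopped, PiLp.sub_apply, imagePath_apply]
  have hst : ∀ (W : PathFn T d) (r v : Time T), v ≤ r → IsCadlag U W →
      F l v (stopped W r) A = F l v W A := fun W r v hv hW =>
    (hF l).nonAnticipative.congr (hW.stopped r) hW hA (by rw [stopped_stopped, min_eq_right hv])
  rcases le_or_gt u s with hus | hus
  · rw [min_eq_right hus, min_eq_right (hus.trans hs)]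
    have := h₁ _ (hZ.stopped s) hXZ.2.1 u l
    rwa [hst X t u (hus.trans hs) hX, hst Z s u hus hZ] at this
  · rw [min_eq_left hus.le]
    have hv1 : min t u ≤ t := min_le_left _ _
    have hv2 : s ≤ min t u := le_min hs hus.le
    generalize min t u = v at hv1 hv2
    have a1 := h₂ l s hs (by linarith [hs'.2.2]) Z hZ (by linarith [hXZ.2.2])
    have a2 := h₂ l v hv1 (by
      have : (s : ℝ) ≤ v := hv2
      linarith [hs'.2.2]) X hX (by
      refine lt_of_le_of_lt (supNorm_le (C := 2 * (δ₂ / 3)) (by linarith) fun w => ?_)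
        (by linarith)
      -- After s the stopped path Z^s equals the vector Z(s), so X stays near one vector on [s, t]
      -- and oscillates there by at most 2δ₂/3.
      have hb : ∀ w', s ≤ w' → w' ≤ t → ‖X w' - Z s‖ ≤ δ₂ / 3 := fun w' h1 h2 => by
        have := ((hX.stopped t).norm_sub_le_supNorm (hZ.stopped s) w').trans hXZ.2.2.le
        simpa [stopped, min_eq_right h2, min_eq_left h1] using this
      simp only [Pi.sub_apply, stopped]
      rcases le_total w v with hw | hw
      · rw [min_eq_right hw, min_eq_right (hw.trans hv1), sub_self, norm_zero]; linarith
      · rw [min_eq_left hw]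
        have b1 := hb (min t w) (hv2.trans (le_min hv1 hw)) (min_le_left _ _)
        have b2 := hb v hv2 hv1
        calc ‖X (min t w) - X v‖ = ‖(X (min t w) - Z s) - (X v - Z s)‖ := by congr 1; abel
          _ ≤ _ := (norm_sub_le _ _).trans (by linarith))
    rw [abs_lt] at a1 a2 ⊢
    constructor <;> linarith [a1.1, a1.2, a2.1, a2.2]

end Image

end FunctionalIto

namespace FunctionalIto

variable {T : ℝ} {d m ν p : ℕ} {U : Set (E d)} {S : Set (E m)} {W : Set (E p)}

/-! ### Pairs of paths of bounded variation -/

/-- The first `m` coordinates of a vector in `ℝ^(m+p)`. -/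
def fstPart (c : E (m + p)) : E m := WithLp.toLp 2 fun i => c (Fin.castAdd p i)

/-- The last `p` coordinates of a vector in `ℝ^(m+p)`. -/
def sndPart (c : E (m + p)) : E p := WithLp.toLp 2 fun j => c (Fin.natAdd m j)

/-- The vector in `ℝ^(m+p)` with parts `a` and `b`. -/
def pairVec (a : E m) (b : E p) : E (m + p) := WithLp.toLp 2 (Fin.append a b)

@[simp]
theorem fstPart_apply (c : E (m + p)) (i : Fin m) : fstPart c i = c (Fin.castAdd p i) := rfl

@[simp]
theorem sndPart_apply (c : E (m + p)) (j : Fin p) : sndPart c j = c (Fin.natAdd m j) := rfl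

@[simp]
theorem fstPart_pairVec (a : E m) (b : E p) : fstPart (pairVec a b) = a := by
  ext i; simp [pairVec]

@[simp]
theorem sndPart_pairVec (a : E m) (b : E p) : sndPart (pairVec a b) = b := by
  ext i; simp [pairVec]

theorem continuous_fstPart : Continuous (fstPart : E (m + p) → E m) :=
  (PiLp.continuous_toLp 2 _).comp (continuous_pi fun i => by fun_prop)

theorem continuous_sndPart : Continuous (sndPart : E (m + p) → E p) :=
  (PiLp.continuous_toLp 2 _).comp (continuous_pi fun i => by fun_prop)

/-- The product of `S` and `W` as a subset of `ℝ^(m+p)`. -/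
def pairSet (S : Set (E m)) (W : Set (E p)) : Set (E (m + p)) :=
  {c | fstPart c ∈ S ∧ sndPart c ∈ W}

theorem isOpen_pairSet (hS : IsOpen S) (hW : IsOpen W) : IsOpen (pairSet S W) :=
  (hS.preimage continuous_fstPart).inter (hW.preimage continuous_sndPart)

theorem IsCBV.fstPart {C : PathFn T (m + p)} (hC : IsCBV (pairSet S W) C) :
    IsCBV S fun u => fstPart (C u) :=
  ⟨fun t => (hC.mem t).1, continuous_fstPart.comp hC.cont, fun _ => hC.bv _⟩

theorem IsCBV.sndPart {C : PathFn T (m + p)} (hC : IsCBV (pairSet S W) C) :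
    IsCBV W fun u => sndPart (C u) :=
  ⟨fun t => (hC.mem t).2, continuous_sndPart.comp hC.cont, fun _ => hC.bv _⟩

theorem IsCBV.pairVec {A : PathFn T m} {B : PathFn T p} (hA : IsCBV S A) (hB : IsCBV W B) :
    IsCBV (pairSet S W) fun u => pairVec (A u) (B u) := by
  refine ⟨fun t => ⟨by simpa using hA.mem t, by simpa using hB.mem t⟩,
    (PiLp.continuous_toLp 2 _).comp (continuous_pi fun i => ?_), fun i => ?_⟩
  · refine Fin.addCases (fun i => ?_) (fun j => ?_) i
    · simpa using continuous_coord hA.cont i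
    · simpa using continuous_coord hB.cont j
  · refine Fin.addCases (fun i => ?_) (fun j => ?_) i
    · simpa [FunctionalIto.pairVec] using hA.bv i
    · simpa [FunctionalIto.pairVec] using hB.bv j

/-! ### Composition of functionals -/

/-- A functional of `(t, X, A)` regarded as a functional of `(t, X, (A, B))`. -/
def liftFunctional (p : ℕ) (Φ : Functional T d m) : Functional T d (m + p) :=
  fun t X C => Φ t X fun u => fstPart (C u)

/-- The functional `(t, X, (A, B)) ↦ Φ(t, F(·, X, A), B)`. -/
def compFunctional (Φ : Functional T ν p) (F : Fin ν → Functional T d m) :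
    Functional T d (m + p) :=
  fun t X C => Φ t (imagePath F X fun u => fstPart (C u)) fun u => sndPart (C u)

section Lift

variable {Φ : Functional T d m}

theorem Tame.lift (h : Tame U S Φ) (W : Set (E p)) : Tame U (pairSet S W) (liftFunctional p Φ) :=
  ⟨fun t X _ hX hC => h.1 t X _ hX hC.fstPart, fun _ hC => h.2 _ hC.fstPart⟩

theorem LeftContinuous.lift (h : LeftContinuous U S Φ) (W : Set (E p)) :
    LeftContinuous U (pairSet S W) (liftFunctional p Φ) :=
  fun t ht ε hε X _ hX hC => h t ht ε hε X _ hX hC.fstPart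

theorem ContinuousAtFixedTimes.lift (h : ContinuousAtFixedTimes U S Φ) (W : Set (E p)) :
    ContinuousAtFixedTimes U (pairSet S W) (liftFunctional p Φ) :=
  fun ε hε t X _ hX hC => h ε hε t X _ hX hC.fstPart

theorem VerticallyDifferentiable.lift (h : VerticallyDifferentiable U S Φ) (W : Set (E p)) :
    VerticallyDifferentiable U (pairSet S W) (liftFunctional p Φ) :=
  fun t X _ hX hC => h t X _ hX hC.fstPart

end Lift

section Comp

variable {Φ : Functional T ν p} {F : Fin ν → Functional T d m}

theorem Tame.comp (h : Tame Set.univ W Φ) (hF : ∀ l, MemC12c U S (F l)) :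
    Tame U (pairSet S W) (compFunctional Φ F) := by
  refine ⟨fun t X C hX hC => ?_, fun C hC K hK hKc => ?_⟩
  · have h1 := isCadlag_imagePath hF hX hC.fstPart
    have h2 := isCadlag_imagePath hF (hX.stopped t) (hC.stopped t).fstPart
    have h3 := stopped_imagePath (fun l => (hF l).nonAnticipative) hX hC.fstPart (hX.stopped t)
      (hC.stopped t).fstPart (t := t) (stopped_stopped_self X t).symm
      (stopped_stopped_self (fun u => FunctionalIto.fstPart (C u)) t).symm
    change Φ t _ _ = Φ t _ (stopped (fun u => FunctionalIto.sndPart (C u)) t)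
    rw [h.1.stopped_right h2 hC.sndPart]
    exact h.1.congr h1 h2 hC.sndPart h3
  · obtain ⟨K', hK', hKK'⟩ := exists_compact_imagePath hF hC.fstPart hK hKc
    obtain ⟨M, hM⟩ := h.2 _ hC.sndPart K' (Set.subset_univ _) hK'
    exact ⟨M, fun t X hX => hM t _ (hKK' X hX)⟩

theorem LeftContinuous.comp (h : LeftContinuous Set.univ W Φ) (hF : ∀ l, MemC12c U S (F l)) :
    LeftContinuous U (pairSet S W) (compFunctional Φ F) :=
  leftContinuous_iff.2 fun t _ _ ht hX hC =>
    (leftContinuous_iff.1 h t _ _ ht (isCadlag_imagePath hF hX hC.fstPart) hC.sndPart).comp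
      (tendsto_imagePath_leftFilter hF hX hC.fstPart ht)

theorem ContinuousAtFixedTimes.comp (h : ContinuousAtFixedTimes Set.univ W Φ)
    (hF : ∀ l, MemC12c U S (F l)) :
    ContinuousAtFixedTimes U (pairSet S W) (compFunctional Φ F) :=
  continuousAtFixedTimes_iff.2 fun t _ _ hX hC =>
    (continuousAtFixedTimes_iff.1 h t _ _ (isCadlag_imagePath hF hX hC.fstPart) hC.sndPart).comp
      (tendsto_imagePath_fixedFilter hF hX hC.fstPart t)

theorem ContinuousLocallyUniformly.comp (h : ContinuousLocallyUniformly Set.univ W Φ)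
    (hF : ∀ l, MemC12c U S (F l)) :
    ContinuousLocallyUniformly U (pairSet S W) (compFunctional Φ F) := by
  intro ε hε t X C hX hC
  obtain ⟨δ, hδ, h⟩ := h ε hε t _ _ (isCadlag_imagePath hF hX hC.fstPart) hC.sndPart
  obtain ⟨ε', hε', hn⟩ := exists_norm_le_of_coord (ν := ν) (half_pos hδ)
  obtain ⟨δ', hδ', h'⟩ := exists_imagePath_close hF hX hC.fstPart hε'
  refine ⟨min δ δ', lt_min hδ hδ', fun u Y hY hXY htu => h u _
    (isCadlag_imagePath hF hY hC.fstPart) ?_ (htu.trans_le (min_le_left _ _))⟩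
  refine lt_of_le_of_lt (supNorm_le (half_pos hδ).le fun v => ?_) (half_lt_self hδ)
  exact (hn _ fun l => h' Y hY (hXY.trans_le (min_le_right _ _)) v l).le

/-! ### Vertical derivatives of compositions -/

/-- The inner functions enter as increments because the outer functional is differentiated at a bump
of size zero of the image path. -/
theorem hasGradientAt_comp_sub {g : E ν → ℝ} {f : Fin ν → E d → ℝ} (hg : DifferentiableAt ℝ g 0)
    (hf : ∀ l, DifferentiableAt ℝ (f l) 0) :
    HasGradientAt (fun v => g (WithLp.toLp 2 fun l => f l v - f l 0))
      (∑ l, gradient g 0 l • gradient (f l) 0) 0 := by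
  have h1 : HasFDerivAt (fun v => fun l => f l v - f l 0)
      (ContinuousLinearMap.pi fun l => InnerProductSpace.toDual ℝ (E d) (gradient (f l) 0)) 0 :=
    hasFDerivAt_pi.2 fun l => (hf l).hasGradientAt.hasFDerivAt.sub_const _
  have h2 := (PiLp.hasFDerivAt_toLp 2 (𝕜 := ℝ) (fun l => f l 0 - f l 0)).comp
    (0 : E d) h1
  have h3 : HasFDerivAt g (InnerProductSpace.toDual ℝ (E ν) (gradient g 0))
      (WithLp.toLp 2 fun l => f l 0 - f l 0) := by
    have h0 : (WithLp.toLp 2 fun l => f l 0 - f l 0 : E ν) = 0 := by ext l; simp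
    rw [h0]
    exact hg.hasGradientAt.hasFDerivAt
  have h4 := h3.comp (0 : E d) h2
  rw [hasGradientAt_iff_hasFDerivAt]
  refine HasFDerivAt.congr_fderiv h4 (ContinuousLinearMap.ext fun v => ?_)
  have hgv : ∀ w, fderiv ℝ g 0 w = inner ℝ (gradient g 0) w := fun w => by simp
  simp [hgv, inner_eq_sum (gradient g 0)]

theorem hasGradientAt_sum_mul {f g : Fin ν → E d → ℝ} (hf : ∀ l, DifferentiableAt ℝ (f l) 0)
    (hg : ∀ l, DifferentiableAt ℝ (g l) 0) :
    HasGradientAt (fun v => ∑ l, f l v * g l v)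
      (∑ l, (f l 0 • gradient (g l) 0 + g l 0 • gradient (f l) 0)) 0 := by
  have h := HasFDerivAt.fun_sum (u := Finset.univ) fun l _ =>
    (hf l).hasGradientAt.hasFDerivAt.mul (hg l).hasGradientAt.hasFDerivAt
  rw [hasGradientAt_iff_hasFDerivAt]
  refine HasFDerivAt.congr_fderiv h (ContinuousLinearMap.ext fun v => ?_)
  simp

/-- Bumping X at t leaves the image path unchanged before t and shifts its value at t by the
increments of the F l. Up to time t it is thus a bump of the image path; what happens later is
invisible to a non-anticipative functional. -/
theorem hasGradientAt_compFunctional (hU : IsOpen U) (hΦ : NonAnticipative Set.univ W Φ)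
    (hΦv : VerticallyDifferentiable Set.univ W Φ) (hF : ∀ l, MemC12c U S (F l)) {t : Time T}
    {X : PathFn T d} {C : PathFn T (m + p)} (hX : IsCadlag U X) (hC : IsCBV (pairSet S W) C) :
    HasGradientAt (fun v => compFunctional Φ F t (bump X t v) (stopped C t))
      (∑ l, compFunctional (vpartial l Φ) F t X C •
        vgrad (F l) t X fun u => fstPart (C u)) 0 := by
  have hY := isCadlag_imagePath hF hX hC.fstPart
  have h := hasGradientAt_comp_sub (hΦv t _ _ hY hC.sndPart)
    fun l => (hF l).vertical t X _ hX hC.fstPart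
  refine h.congr_of_eventuallyEq ?_
  filter_upwards [hX.eventually_bump hU t] with v hv
  refine hΦ.congr (isCadlag_imagePath hF hv (hC.stopped t).fstPart)
    (hY.bump (U := Set.univ) t _ (Set.subset_univ _) fun _ _ => Set.mem_univ _)
    (hC.stopped t).sndPart ?_
  ext u l
  simp only [stopped, bump, imagePath_apply, bump_zero]
  rcases lt_or_ge u t with hu | hu
  · simp only [min_eq_right hu.le, hu.not_ge, if_false, add_zero, imagePath_apply]
    have h1 : stopped (bump X t v) u = stopped X u := by
      ext w : 1
      simp [stopped, bump, hu]
    have h2 := (hF l).nonAnticipative u _ _ hv (hC.stopped t).fstPart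
    have h3 := (hF l).nonAnticipative u _ _ hX hC.fstPart
    rw [h1] at h2
    have h4 : stopped (fun w => fstPart (stopped C t w)) u
        = stopped (fun w => fstPart (C w)) u := by
      ext w : 1
      simp [stopped, ← min_assoc, min_eq_right hu.le]
    rw [h4, ← h3] at h2
    exact h2
  · have h3 := (hF l).nonAnticipative.stopped_right (t := t) hX hC.fstPart
    simp only [min_eq_left hu, le_refl, if_true, PiLp.add_apply, imagePath_apply]
    change F l t (bump X t v) (stopped (fun w => fstPart (C w)) t) = _ +
      (F l t (bump X t v) (stopped (fun w => fstPart (C w)) t) -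
        F l t X (stopped (fun w => fstPart (C w)) t))
    rw [h3]
    ring

theorem VerticallyDifferentiable.comp (hU : IsOpen U) (hΦ : NonAnticipative Set.univ W Φ)
    (hΦv : VerticallyDifferentiable Set.univ W Φ) (hF : ∀ l, MemC12c U S (F l)) :
    VerticallyDifferentiable U (pairSet S W) (compFunctional Φ F) :=
  fun _ _ _ hX hC => (hasGradientAt_compFunctional hU hΦ hΦv hF hX hC).differentiableAt

theorem vgrad_compFunctional (hU : IsOpen U) (hΦ : NonAnticipative Set.univ W Φ)
    (hΦv : VerticallyDifferentiable Set.univ W Φ) (hF : ∀ l, MemC12c U S (F l)) {t : Time T}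
    {X : PathFn T d} {C : PathFn T (m + p)} (hX : IsCadlag U X) (hC : IsCBV (pairSet S W) C) :
    vgrad (compFunctional Φ F) t X C
      = ∑ l, compFunctional (vpartial l Φ) F t X C • vgrad (F l) t X fun u => fstPart (C u) :=
  (hasGradientAt_compFunctional hU hΦ hΦv hF hX hC).gradient

theorem vpartial_compFunctional (hU : IsOpen U) (hΦ : NonAnticipative Set.univ W Φ)
    (hΦv : VerticallyDifferentiable Set.univ W Φ) (hF : ∀ l, MemC12c U S (F l)) (k : Fin d)
    {t : Time T} {X : PathFn T d} {C : PathFn T (m + p)} (hX : IsCadlag U X)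
    (hC : IsCBV (pairSet S W) C) :
    vpartial k (compFunctional Φ F) t X C
      = ∑ l, compFunctional (vpartial l Φ) F t X C * liftFunctional p (vpartial k (F l)) t X C := by
  simp only [vpartial, vgrad_compFunctional hU hΦ hΦv hF hX hC]
  simp [liftFunctional, compFunctional, vpartial]

end Comp

/-! ### Second vertical derivatives of compositions -/

section SecondOrder

variable {Φ Ψ : Functional T d m}

/-- Identities known only on admissible paths can still be differentiated vertically, since small
bumps stay admissible. -/
theorem hasGradientAt_congr (hU : IsOpen U)
    (h : ∀ t X A, IsCadlag U X → IsCBV S A → Φ t X A = Ψ t X A) {t : Time T}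
    {X : PathFn T d} {A : PathFn T m} (hX : IsCadlag U X) (hA : IsCBV S A) {g : E d}
    (hg : HasGradientAt (fun v => Ψ t (bump X t v) (stopped A t)) g 0) :
    HasGradientAt (fun v => Φ t (bump X t v) (stopped A t)) g 0 := by
  refine hg.congr_of_eventuallyEq ?_
  filter_upwards [hX.eventually_bump hU t] with v hv
  exact h t _ _ hv (hA.stopped t)

variable {G : Functional T ν p} {F : Fin ν → Functional T d m}

theorem hasGradientAt_vpartial_compFunctional (hU : IsOpen U) (hG : MemC12c Set.univ W G)
    (hF : ∀ l, MemC12c U S (F l)) (j : Fin d) {t : Time T} {X : PathFn T d}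
    {C : PathFn T (m + p)} (hX : IsCadlag U X) (hC : IsCBV (pairSet S W) C) :
    HasGradientAt (fun v => vpartial j (compFunctional G F) t (bump X t v) (stopped C t))
      (∑ l, (compFunctional (vpartial l G) F t X C •
          vgrad (vpartial j (F l)) t X (fun u => fstPart (C u))
        + liftFunctional p (vpartial j (F l)) t X C •
          ∑ k, compFunctional (vpartial k (vpartial l G)) F t X C •
            vgrad (F k) t X fun u => fstPart (C u))) 0 := by
  have hGn := fun l => hG.nonAnticipative.vpartial isOpen_univ l
  refine hasGradientAt_congr hU (Ψ := fun t X C => ∑ l, compFunctional (vpartial l G) F t X C *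
    liftFunctional p (vpartial j (F l)) t X C)
    (fun t X C hX hC => vpartial_compFunctional hU hG.nonAnticipative hG.vertical hF j hX hC)
    hX hC ?_
  have h := hasGradientAt_sum_mul
    (fun l => VerticallyDifferentiable.comp hU (hGn l) (hG.vertical₂ l) hF t X C hX hC)
    (fun l => ((hF l).vertical₂ j).lift W t X C hX hC)
  convert h using 1
  refine Finset.sum_congr rfl fun l _ => ?_
  have h1 : Tame Set.univ W (vpartial l G) := ⟨hGn l, hG.vpartial_boundednessPreserving l⟩
  have h2 : Tame U S (vpartial j (F l)) :=
    ⟨(hF l).nonAnticipative.vpartial hU j, (hF l).vpartial_boundednessPreserving j⟩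
  rw [bump_zero, (h1.comp hF).1.stopped_right hX hC, (h2.lift W).1.stopped_right hX hC]
  congr 2
  exact (vgrad_compFunctional hU (hGn l) (hG.vertical₂ l) hF hX hC).symm

theorem vpartial_vpartial_compFunctional (hU : IsOpen U) (hG : MemC12c Set.univ W G)
    (hF : ∀ l, MemC12c U S (F l)) (i j : Fin d) {t : Time T} {X : PathFn T d}
    {C : PathFn T (m + p)} (hX : IsCadlag U X) (hC : IsCBV (pairSet S W) C) :
    vpartial i (vpartial j (compFunctional G F)) t X C
      = (∑ l, compFunctional (vpartial l G) F t X C *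
          liftFunctional p (vpartial i (vpartial j (F l))) t X C)
        + ∑ l, liftFunctional p (vpartial j (F l)) t X C *
          ∑ k, compFunctional (vpartial k (vpartial l G)) F t X C *
            liftFunctional p (vpartial i (F k)) t X C := by
  rw [vpartial, vgrad, (hasGradientAt_vpartial_compFunctional hU hG hF j hX hC).gradient,
    ← Finset.sum_add_distrib]
  simp [liftFunctional, compFunctional, vpartial]

end SecondOrder

end FunctionalIto

namespace FunctionalIto

variable {T : ℝ} {d m ν p : ℕ} {U : Set (E d)} {S : Set (E m)} {W : Set (E p)}

/-! ### The horizontal derivative of a composition -/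

theorem exists_bot_top (P : PartitionSeq T) : ∃ o e : Time T, IsBot o ∧ IsTop e := by
  obtain ⟨o, -, ho⟩ := P.zero_mem 0
  obtain ⟨e, -, he⟩ := P.top_mem 0
  exact ⟨o, e, fun u => by rw [← Subtype.coe_le_coe, ho]; exact u.2.1,
    fun u => by rw [← Subtype.coe_le_coe, he]; exact u.2.2⟩

/-- The sequence of partitions with the point `s` added. -/
def PartitionSeq.insertPt (P : PartitionSeq T) (s : Time T) : PartitionSeq T where
  pts n := insert s (P.pts n)
  zero_mem n := (P.zero_mem n).imp fun _ h => ⟨Finset.mem_insert_of_mem h.1, h.2⟩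
  top_mem n := (P.top_mem n).imp fun _ h => ⟨Finset.mem_insert_of_mem h.1, h.2⟩
  mono _ _ h := Finset.insert_subset_insert s (P.mono h)
  mesh ε hε := by
    obtain ⟨o, e, ho, he⟩ := exists_bot_top P
    filter_upwards [P.mesh_all hε] with n hn r _
    -- Adding a point can only bring successors closer.
    refine lt_of_le_of_lt (sub_le_sub_right (Subtype.coe_le_coe.2 ?_) _) (hn r).1
    have hP := P.isPartition ho he n
    rcases (he r).lt_or_eq with hr | rfl
    · exact succPt_le (Finset.mem_insert_of_mem (hP.succPt_mem r)) (hP.lt_succPt hr)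
    · exact (he _).trans (le_succPt _ _)

theorem PartitionSeq.mem_insertPt (P : PartitionSeq T) (s : Time T) (n : ℕ) :
    s ∈ (P.insertPt s).pts n := Finset.mem_insert_self _ _

theorem lsIntegral_zero_right (f : Time T → ℝ) (J : Set (Time T)) (hJ : MeasurableSet J)
    (hf : BddMeasOn f J) {o : Time T} (ho : IsBot o) : lsIntegral f (fun _ => 0) J = 0 := by
  have h : IsContBV (fun _ : Time T => (0 : ℝ)) :=
    isContBV_of_monotone monotone_const continuous_const
  rw [lsIntegral_assoc (ι := Fin 0) (s := Finset.univ) (k := fun _ _ => 0) (g := fun _ _ => 0) ho h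
    (fun i => i.elim0) (fun i => i.elim0) (by simp) hJ hf]
  simp

/-! ### Compositions along a path stopped at s -/

section Frozen

variable {F : Fin ν → Functional T d m} {D : Fin ν → Fin (m + 1) → Functional T d m}
  {X : PathFn T d} {A : PathFn T m} {o e s : Time T}

theorem IsHorizontalDeriv.bddMeasOn_stopped {F : Functional T d m}
    {D : Fin (m + 1) → Functional T d m} (hD : IsHorizontalDeriv U S F D)
    (hX : IsCadlag U X) (hA : IsCBV S A) (he : IsTop e) (hse : s < e) (i : Fin (m + 1)) :
    BddMeasOn (fun r => D i r (stopped X s) A) (Set.Ioi s) := by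
  have h := measurable_indicator_of_Icc (f := fun r => D i r (stopped X s) A)
    (hD.measurable i s e X A hse hX hA)
  have hset : Set.Ioc s e = Set.Ioi s := by ext u; simp [he u]
  obtain ⟨K, hK, hKc, hXK⟩ := hX.exists_compact
  obtain ⟨C, hC⟩ := hD.boundednessPreserving i A hA K hK hKc
  exact ⟨hset ▸ h, C, fun r _ => hC r _ (hXK.stopped s)⟩

theorem lsIntegral_indicator_Ioi {f g : Time T → ℝ} (hos : o ≤ s) (b : Time T) :
    lsIntegral ((Set.Ioi s).indicator f) g (Set.Ioc o b) = lsIntegral f g (Set.Ioc s b) := by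
  rw [lsIntegral_indicator measurableSet_Ioc measurableSet_Ioi]
  congr 1
  ext u
  simp only [Set.mem_inter_iff, Set.mem_Ioc, Set.mem_Ioi]
  exact ⟨fun h => ⟨h.2, h.1.2⟩, fun h => ⟨⟨hos.trans_lt h.1, h.2⟩, h.1⟩⟩

theorem BddMeasOn.indicator {f : Time T → ℝ} {J : Set (Time T)} (h : BddMeasOn f J) :
    BddMeasOn (J.indicator f) Set.univ := by
  obtain ⟨C, hC⟩ := h.bdd
  refine ⟨by simpa using h.meas, |C|, fun x _ => ?_⟩
  by_cases hx : x ∈ J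
  · rw [Set.indicator_of_mem hx]; exact (hC x hx).trans (le_abs_self C)
  · rw [Set.indicator_of_notMem hx]; simp

/-- Making the function constant before s turns the horizontal formula on [s, b] into an integral
from the bottom point, the form that `isContBV_of_integral` and `lsIntegral_assoc` take. -/
theorem IsHorizontalDeriv.integral_eq_max {F : Functional T d m}
    {D : Fin (m + 1) → Functional T d m} (hD : IsHorizontalDeriv U S F D)
    (hX : IsCadlag U X) (hA : IsCBV S A) (ho : IsBot o) (b : Time T) :
    F (max s b) (stopped X s) A - F (max s o) (stopped X s) A
      = ∑ i, lsIntegral ((Set.Ioi s).indicator fun r => D i r (stopped X s) A) (withTime A i)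
        (Set.Ioc o b) := by
  simp only [lsIntegral_indicator_Ioi (ho s), max_eq_left (ho s)]
  rcases lt_or_ge s b with hb | hb
  · rw [max_eq_right hb.le, hD.integral_eq s b X A hb hX hA]
  · rw [max_eq_left hb, sub_self, Set.Ioc_eq_empty hb.not_gt]
    refine (Finset.sum_eq_zero fun i _ => ?_).symm
    rw [lsIntegral_congr (f₂ := fun _ => 0) _ (fun x hx => absurd hx (Set.notMem_empty x)),
      lsIntegral_zero_left]

theorem isContBV_frozen {F : Functional T d m}
    {D : Fin (m + 1) → Functional T d m} (hD : IsHorizontalDeriv U S F D)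
    (hX : IsCadlag U X) (hA : IsCBV S A) (ho : IsBot o) (he : IsTop e) (hse : s < e) :
    IsContBV fun u => F (max s u) (stopped X s) A :=
  isContBV_of_integral (fun i _ => hA.isContBV_withTime i)
    (fun i _ => (hD.bddMeasOn_stopped hX hA he hse i).indicator) ho
    fun b => hD.integral_eq_max hX hA ho b

theorem continuous_frozen (hD : ∀ l, IsHorizontalDeriv U S (F l) (D l))
    (hX : IsCadlag U X) (hA : IsCBV S A) (ho : IsBot o) (he : IsTop e) (hse : s < e) :
    Continuous fun u => imagePath F (stopped X s) A (max s u) :=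
  (PiLp.continuous_toLp 2 _).comp
    (continuous_pi fun l => (isContBV_frozen (hD l) hX hA ho he hse).cont)

/-- The change of variables formula for a functional `G` of the frozen path
`u ↦ F(u, X^s, A)`, which is of bounded variation on `[s,T]`. -/
theorem comp_frozen_eq (P : PartitionSeq T) {G : Functional T ν p}
    {DG : Fin (p + 1) → Functional T ν p} (hG : MemC12c Set.univ W G)
    (hDG : IsHorizontalDeriv Set.univ W G DG)
    (hDGc : ∀ i, ContinuousAtFixedTimes Set.univ W (DG i)) (hF : ∀ l, MemC12c U S (F l))
    (hD : ∀ l, IsHorizontalDeriv U S (F l) (D l)) (hX : IsCadlag U X) (hA : IsCBV S A)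
    {B : PathFn T p} (hB : IsCBV W B) {t : Time T} (hst : s < t) :
    G t (imagePath F (stopped X s) A) B - G s (imagePath F (stopped X s) A) B
      = (∑ l, ∑ i, lsIntegral (fun u => vpartial l G u (imagePath F (stopped X s) A) B
          * D l i u (stopped X s) A) (withTime A i) (Set.Ioc s t))
        + ∑ j, lsIntegral (fun u => DG j u (imagePath F (stopped X s) A) B) (withTime B j)
          (Set.Ioc s t) := by
  obtain ⟨o, e, ho, he⟩ := exists_bot_top P
  have hse : s < e := hst.trans_le (he t)
  set Z := imagePath F (stopped X s) A with hZdef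
  have hZ : IsCadlag Set.univ Z := isCadlag_imagePath hF (hX.stopped s) hA
  have hZc : Continuous fun u => Z (max s u) := continuous_frozen hD hX hA ho he hse
  have hZbv : ∀ l, IsContBV fun u => Z (max s u) l := fun l =>
    isContBV_frozen (hD l) hX hA ho he hse
  -- Bounded variation from s on removes the second-order term of the Itô formula. The point s is
  -- added to the partitions so that the formula can start there.
  have hQ : HasCovariation (P.insertPt s) (fun u => Z (max s u)) (fun _ _ _ => 0) :=
    hasCovariation_zero_of_isContBV hZbv ho he
  have h1 := ito_formula hG hDG hDGc isOpen_univ ho he (P.mem_insertPt s) hZ hZc hB hQ hst.le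
  have hmeas : ∀ {Φ : Functional T ν p}, LeftContinuous Set.univ W Φ →
      BoundednessPreserving Set.univ W Φ → BddMeasOn (fun u => Φ u Z B) (Set.Ioi s) :=
    fun hΦ hΦb => bddMeasOn_of_leftContinuous hΦ hΦb P isOpen_univ ho he hZ hZc hB
  have h0 : ∑ i, ∑ j, lsIntegral (fun u => vpartial i (vpartial j G) u Z B) (fun _ => 0)
      (Set.Ioc s t) = 0 := Finset.sum_eq_zero fun i _ => Finset.sum_eq_zero fun j _ =>
    lsIntegral_zero_right _ _ measurableSet_Ioc
      ((hmeas (hG.vpartial₂_leftContinuous i j) (hG.vpartial₂_boundednessPreserving i j)).mono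
        measurableSet_Ioc Set.Ioc_subset_Ioi_self) ho
  rw [h0, mul_zero, sub_zero] at h1
  have hθ : ∀ (n : ℕ) (r : Time T), (0 : ℝ) ∈ Set.Icc (0 : ℝ) 1 := fun _ _ => by simp
  have h2 : ∀ l, Tendsto (fun n => ∑ r ∈ (P.insertPt s).pts n,
      (if r ≤ t then (if s ≤ r then
        vpartial l G r (approxFrom s ((P.insertPt s).pts n) Z r) B else 0) else 0)
      * (Z (max s (succPt ((P.insertPt s).pts n) r)) l - Z (max s r) l)) atTop
      (𝓝 (∑ i, lsIntegral (fun u => vpartial l G u Z B * D l i u (stopped X s) A)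
        (withTime A i) (Set.Ioc s t))) := by
    intro l
    obtain ⟨C, hC⟩ := (hG.vpartial_boundednessPreserving l).exists_bound_approxFrom
      (P := P.insertPt s) (s₀ := s) isOpen_univ ho he hZ hZc hB hθ
    have h3 := ((hG.vpartial_leftContinuous l).leftUniformTendsto (P := P.insertPt s)
      (s₀ := s) isOpen_univ ho he hZ hZc hB hθ).cutoff t
    simp only [zero_smul, bump_zero] at h3 hC
    have h4 := h3.tendsto_sum_stieltjes (Set.countable_singleton s) ho he (C := C) (by
      filter_upwards [hC] with n hn r hr
      by_cases h5 : r ≤ t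
      · rw [if_pos h5]
        exact hn r hr
      · rw [if_neg h5, abs_zero]
        exact (abs_nonneg _).trans (hn r hr)) (hZbv l)
    convert h4 using 2
    have h6 : (fun u => if u ≤ t then (Set.Ioi s).indicator (fun u => vpartial l G u Z B) u else 0)
        = (Set.Ioc s t).indicator fun u => vpartial l G u Z B := by
      ext u
      by_cases h7 : u ≤ t <;> by_cases h8 : s < u <;> simp [Set.indicator, h7, h8]
    rw [h6, lsIntegral_indicator measurableSet_Ioi measurableSet_Ioc,
      Set.inter_eq_right.2 (fun u (hu : u ∈ Set.Ioc s t) => Set.mem_Ioi.2 ((ho s).trans_lt hu.1))]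
    -- The l-th coordinate of the frozen image path has differential ∑_i D_{l,i} dA_i.
    rw [lsIntegral_assoc ho (hZbv l) (fun i _ => hA.isContBV_withTime i)
      (fun i _ => ((hD l).bddMeasOn_stopped hX hA he hse i).indicator)
      (fun b => (hD l).integral_eq_max hX hA ho b) measurableSet_Ioc
      ((hmeas (hG.vpartial_leftContinuous l) (hG.vpartial_boundednessPreserving l)).mono
        measurableSet_Ioc Set.Ioc_subset_Ioi_self)]
    refine Finset.sum_congr rfl fun i _ => lsIntegral_congr _ fun u hu => ?_
    simp only [Set.indicator_of_mem (Set.mem_Ioi.2 hu.1)]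
  have h3 := tendsto_finsetSum Finset.univ fun l _ => h2 l
  -- The first-order sums have two limits, one from the Itô formula and one from Stieltjes
  -- integration; equating them is the claim.
  have h4 := tendsto_nhds_unique (h1.congr fun n => ?_) h3
  · linarith
  · rw [Finset.sum_comm, Finset.sum_filter]
    refine Finset.sum_congr rfl fun r _ => ?_
    split_ifs with h5 h6
    · rw [inner_eq_sum]; rfl
    · have h7 : succPt ((P.insertPt s).pts n) r ≤ s :=
        succPt_le (P.mem_insertPt s n) (not_le.1 h6)
      rw [max_eq_left h7, max_eq_left (not_le.1 h6).le]
      simp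
    · simp

end Frozen

/-- The horizontal derivative of `(t, X, (A, B)) ↦ G(t, F(·, X, A), B)`. -/
def compDeriv (G : Functional T ν p) (DG : Fin (p + 1) → Functional T ν p)
    (F : Fin ν → Functional T d m) (D : Fin ν → Fin (m + 1) → Functional T d m) :
    Fin (m + p + 1) → Functional T d (m + p) :=
  Fin.cons
    (fun t X C => (∑ l, compFunctional (vpartial l G) F t X C * liftFunctional p (D l 0) t X C)
      + compFunctional (DG 0) F t X C)
    (Fin.addCases
      (fun i t X C => ∑ l, compFunctional (vpartial l G) F t X C
        * liftFunctional p (D l i.succ) t X C)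
      fun j => compFunctional (DG j.succ) F)

/-! ### Stability of the class ℂ^{1,2}_c under composition -/

section CompDeriv

variable {G : Functional T ν p} {DG : Fin (p + 1) → Functional T ν p}
  {F : Fin ν → Functional T d m} {D : Fin ν → Fin (m + 1) → Functional T d m}

/-- A component belongs to A, to B, or to time; only the time component mixes both kinds, hence the
closure of the motive under addition. -/
theorem compDeriv_cases {motive : Functional T d (m + p) → Prop}
    (h₁ : ∀ i, motive fun t X C => ∑ l, compFunctional (vpartial l G) F t X C
      * liftFunctional p (D l i) t X C)
    (h₂ : ∀ j, motive (compFunctional (DG j) F))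
    (hadd : ∀ Φ Ψ : Functional T d (m + p), motive Φ → motive Ψ →
      motive fun t X C => Φ t X C + Ψ t X C) (i : Fin (m + p + 1)) :
    motive (compDeriv G DG F D i) := by
  refine Fin.cases ?_ (fun i => ?_) i
  · exact hadd _ _ (h₁ 0) (h₂ 0)
  · refine Fin.addCases (fun i => ?_) (fun j => ?_) i
    · simpa [compDeriv] using h₁ i.succ
    · simpa [compDeriv] using h₂ j.succ

/-- Time is an integrator for F and for G but occurs only once in the pair (A, B). Splitting its
component restores the two full sets of integrators. -/
theorem sum_lsIntegral_compDeriv {t : Set (Time T)} (ht : MeasurableSet t) {Z : PathFn T d}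
    {C : PathFn T (m + p)}
    (h₁ : ∀ i, BddMeasOn (fun u => ∑ l, compFunctional (vpartial l G) F u Z C
      * liftFunctional p (D l i) u Z C) t)
    (h₂ : ∀ j, BddMeasOn (fun u => compFunctional (DG j) F u Z C) t) :
    ∑ i, lsIntegral (fun u => compDeriv G DG F D i u Z C) (withTime C i) t
      = (∑ i, lsIntegral (fun u => ∑ l, compFunctional (vpartial l G) F u Z C
          * liftFunctional p (D l i) u Z C) (withTime (fun u => fstPart (C u)) i) t)
        + ∑ j, lsIntegral (fun u => compFunctional (DG j) F u Z C)
          (withTime (fun u => sndPart (C u)) j) t := by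
  rw [Fin.sum_univ_succ, Fin.sum_univ_add, Fin.sum_univ_succ (n := m), Fin.sum_univ_succ (n := p)]
  simp only [compDeriv, withTime, Fin.cons_zero, Fin.cons_succ, Fin.addCases_left,
    Fin.addCases_right, fstPart_apply, sndPart_apply]
  rw [lsIntegral_add _ ht (h₁ 0) (h₂ 0)]
  ring

/-- Along X^s the composition is G along the frozen image path, so the integral identity is
`comp_frozen_eq` regrouped by integrator. -/
theorem isHorizontalDeriv_compDeriv (P : PartitionSeq T)
    (hG : MemC12c Set.univ W G) (hDG : IsHorizontalDeriv Set.univ W G DG)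
    (hDGc : ∀ i, ContinuousAtFixedTimes Set.univ W (DG i)) (hF : ∀ l, MemC12c U S (F l))
    (hD : ∀ l, IsHorizontalDeriv U S (F l) (D l)) :
    IsHorizontalDeriv U (pairSet S W) (compFunctional G F) (compDeriv G DG F D) := by
  obtain ⟨o, e, ho, he⟩ := exists_bot_top P
  have htame : ∀ i, Tame U (pairSet S W) (compDeriv G DG F D i) :=
    compDeriv_cases (fun i => .sum_mul _
        (fun l _ => Tame.comp ⟨hG.nonAnticipative.vpartial isOpen_univ l,
          hG.vpartial_boundednessPreserving l⟩ hF)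
        fun l _ => Tame.lift ⟨(hD l).nonAnticipative i, (hD l).boundednessPreserving i⟩ W)
      (fun j => Tame.comp ⟨hDG.nonAnticipative j, hDG.boundednessPreserving j⟩ hF)
      fun _ _ => Tame.add
  have hbm : ∀ s t X C, s < t → IsCadlag U X → IsCBV (pairSet S W) C →
      (∀ i, BddMeasOn (fun u => ∑ l, compFunctional (vpartial l G) F u (stopped X s) C
        * liftFunctional p (D l i) u (stopped X s) C) (Set.Ioc s t)) ∧
      ∀ j, BddMeasOn (fun u => compFunctional (DG j) F u (stopped X s) C) (Set.Ioc s t) := by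
    intro s t X C hst hX hC
    have hse : s < e := hst.trans_le (he t)
    have hZ := isCadlag_imagePath hF (hX.stopped s) hC.fstPart
    have hZc := continuous_frozen hD hX hC.fstPart ho he hse
    refine ⟨fun i => .sum _ measurableSet_Ioc fun l _ => .mul ?_ ?_, fun j => ?_⟩
    · exact (bddMeasOn_of_leftContinuous (hG.vpartial_leftContinuous l)
        (hG.vpartial_boundednessPreserving l) P isOpen_univ ho he hZ hZc hC.sndPart).mono
        measurableSet_Ioc Set.Ioc_subset_Ioi_self
    · exact ((hD l).bddMeasOn_stopped hX hC.fstPart he hse i).mono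
        measurableSet_Ioc Set.Ioc_subset_Ioi_self
    · exact (hDG.approx hDGc isOpen_univ ho he (P.mem_insertPt s) hZ hZc hC.sndPart t j).1
  refine ⟨fun i => (htame i).1, fun i => (htame i).2, fun i s t X C hst hX hC => ?_,
    fun s t X C hst hX hC => ?_⟩
  · obtain ⟨h₁, h₂⟩ := hbm s t X C hst hX hC
    have h := compDeriv_cases (G := G) (DG := DG) (F := F) (D := D)
      (motive := fun Φ => BddMeasOn (fun u => Φ u (stopped X s) C) (Set.Ioc s t)) h₁ h₂
      (fun _ _ => BddMeasOn.add) i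
    -- The left end point, missing from (s, t], is added back to get measurability on [s, t].
    exact (h.insert s).measurable_comp fun u hu => by
      rcases eq_or_lt_of_le hu.1 with h | h
      · exact Or.inl h.symm
      · exact Or.inr ⟨h, hu.2⟩
  · obtain ⟨h₁, h₂⟩ := hbm s t X C hst hX hC
    rw [sum_lsIntegral_compDeriv measurableSet_Ioc h₁ h₂]
    have h := comp_frozen_eq P hG hDG hDGc hF hD hX hC.fstPart hC.sndPart hst
    refine h.trans (congrArg (· + _) ?_)
    rw [Finset.sum_comm]
    refine Finset.sum_congr rfl fun i _ => (lsIntegral_sum _ _ measurableSet_Ioc fun l _ => ?_).symm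
    have hse : s < e := hst.trans_le (he t)
    have hZ := isCadlag_imagePath hF (hX.stopped s) hC.fstPart
    have hZc := continuous_frozen hD hX hC.fstPart ho he hse
    exact .mul ((bddMeasOn_of_leftContinuous (hG.vpartial_leftContinuous l)
        (hG.vpartial_boundednessPreserving l) P isOpen_univ ho he hZ hZc hC.sndPart).mono
        measurableSet_Ioc Set.Ioc_subset_Ioi_self)
      (((hD l).bddMeasOn_stopped hX hC.fstPart he hse i).mono
        measurableSet_Ioc Set.Ioc_subset_Ioi_self)

/-- The factors ∂_l G are only assumed left-continuous; continuity at fixed times, including time 0,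
comes from their own vertical differentiability. -/
theorem continuousAtFixedTimes_compDeriv (hG : MemC12c Set.univ W G)
    (hDGc : ∀ i, ContinuousAtFixedTimes Set.univ W (DG i)) (hF : ∀ l, MemC12c U S (F l))
    (hDc : ∀ l i, ContinuousAtFixedTimes U S (D l i)) (i : Fin (m + p + 1)) :
    ContinuousAtFixedTimes U (pairSet S W) (compDeriv G DG F D i) :=
  compDeriv_cases (fun i => .sum_mul _
      (fun l _ => ((hG.vpartial_leftContinuous l).continuousAtFixedTimes
        (hG.nonAnticipative.vpartial isOpen_univ l) (hG.vertical₂ l)).comp hF)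
      fun l _ => (hDc l i).lift W)
    (fun j => (hDGc j).comp hF) (fun _ _ => ContinuousAtFixedTimes.add) i

/-- The first two vertical derivatives are sums of products of composed derivatives of G with lifted
derivatives of the F l, and each regularity property survives these operations. -/
theorem MemC12c.comp (P : PartitionSeq T) (hU : IsOpen U) (hG : MemC12c Set.univ W G)
    (hF : ∀ l, MemC12c U S (F l)) : MemC12c U (pairSet S W) (compFunctional G F) := by
  obtain ⟨DG, hDG, hDGc⟩ := hG.horizontal
  choose D hD hDc using fun l => (hF l).horizontal
  have hv : VerticallyDifferentiable U (pairSet S W) (compFunctional G F) :=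
    .comp hU hG.nonAnticipative hG.vertical hF
  have hG₁ : ∀ l, Tame U (pairSet S W) (compFunctional (vpartial l G) F) := fun l =>
    Tame.comp ⟨hG.nonAnticipative.vpartial isOpen_univ l, hG.vpartial_boundednessPreserving l⟩ hF
  have hG₂ : ∀ k l, Tame U (pairSet S W) (compFunctional (vpartial k (vpartial l G)) F) :=
    fun k l => Tame.comp
      ⟨(hG.nonAnticipative.vpartial isOpen_univ l).vpartial isOpen_univ k,
        hG.vpartial₂_boundednessPreserving k l⟩ hF
  have hF₁ : ∀ j l, Tame U (pairSet S W) (liftFunctional p (vpartial j (F l))) := fun j l =>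
    Tame.lift ⟨(hF l).nonAnticipative.vpartial hU j, (hF l).vpartial_boundednessPreserving j⟩ W
  have hF₂ : ∀ i j l, Tame U (pairSet S W) (liftFunctional p (vpartial i (vpartial j (F l)))) :=
    fun i j l => Tame.lift ⟨((hF l).nonAnticipative.vpartial hU j).vpartial hU i,
      (hF l).vpartial₂_boundednessPreserving i j⟩ W
  have htame := Tame.comp ⟨hG.nonAnticipative, hG.boundednessPreserving⟩ hF
  refine
    { nonAnticipative := htame.1
      leftContinuous := hG.leftContinuous.comp hF
      horizontal := ⟨_, isHorizontalDeriv_compDeriv P hG hDG hDGc hF hD,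
        continuousAtFixedTimes_compDeriv hG hDGc hF hDc⟩
      vertical := hv
      vertical₂ := fun j t X C hX hC =>
        (hasGradientAt_vpartial_compFunctional hU hG hF j hX hC).differentiableAt
      vpartial_leftContinuous := fun i => ?_
      vpartial_boundednessPreserving := fun i => ?_
      vpartial₂_leftContinuous := fun i j => ?_
      vpartial₂_boundednessPreserving := fun i j => ?_
      continuousLocallyUniformly := hG.continuousLocallyUniformly.comp hF
      boundednessPreserving := htame.2 }
  · exact (LeftContinuous.sum_mul Finset.univ
      (fun l _ => (hG.vpartial_leftContinuous l).comp hF)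
      fun l _ => ((hF l).vpartial_leftContinuous i).lift W).congr
      fun t X C hX hC => vpartial_compFunctional hU hG.nonAnticipative hG.vertical hF i hX hC
  · exact (Tame.sum_mul Finset.univ (fun l _ => hG₁ l) fun l _ => hF₁ i l).2.congr
      fun t X C hX hC => vpartial_compFunctional hU hG.nonAnticipative hG.vertical hF i hX hC
  · exact ((LeftContinuous.sum_mul Finset.univ
      (fun l _ => (hG.vpartial_leftContinuous l).comp hF)
      fun l _ => ((hF l).vpartial₂_leftContinuous i j).lift W).add
      (LeftContinuous.sum_mul Finset.univ
        (fun l _ => ((hF l).vpartial_leftContinuous j).lift W)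
        fun l _ => LeftContinuous.sum_mul Finset.univ
          (fun k _ => (hG.vpartial₂_leftContinuous k l).comp hF)
          fun k _ => ((hF k).vpartial_leftContinuous i).lift W)).congr
      fun t X C hX hC => vpartial_vpartial_compFunctional hU hG hF i j hX hC
  · exact ((Tame.sum_mul Finset.univ (fun l _ => hG₁ l) fun l _ => hF₂ i j l).add
      (Tame.sum_mul Finset.univ (fun l _ => hF₁ j l) fun l _ =>
        Tame.sum_mul Finset.univ (fun k _ => hG₂ k l) fun k _ => hF₁ i k)).2.congr
      fun t X C hX hC => vpartial_vpartial_compFunctional hU hG hF i j hX hC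

end CompDeriv

end FunctionalIto

namespace FunctionalIto

variable {T : ℝ} {d m ν p : ℕ} {U : Set (E d)} {S : Set (E m)} {W : Set (E p)}

/-! ### Itô integrals from time zero -/

section FromZero

variable {P : PartitionSeq T} {o e : Time T} {X : PathFn T d} {A : PathFn T m}

theorem lsIntegral_Iic {f g : Time T → ℝ} (hg : IsContBV g) (ho : IsBot o) (t : Time T) :
    lsIntegral f g (Set.Iic t) = lsIntegral f g (Set.Ioc o t) :=
  lsIntegral_congr_set hg measurableSet_Iic measurableSet_Ioc (Set.countable_singleton o)
    fun u hu => ⟨fun h => ⟨lt_of_le_of_ne (ho u) (Ne.symm hu), h⟩, fun h => h.2⟩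

theorem BddMeasOn.univ_of_Ioi {f : Time T → ℝ} (h : BddMeasOn f (Set.Ioi o)) (ho : IsBot o) :
    BddMeasOn f Set.univ :=
  (h.insert o).mono .univ fun u _ => (eq_or_lt_of_le (ho u)).imp Eq.symm id

theorem max_bot_comp (ho : IsBot o) (X : PathFn T d) : (fun u => X (max o u)) = X :=
  funext fun u => by rw [max_eq_right (ho u)]

theorem LeftContinuous.bddMeasOn_univ {Φ : Functional T d m} (hΦ : LeftContinuous U S Φ)
    (hΦb : BoundednessPreserving U S Φ) (P : PartitionSeq T) (hU : IsOpen U) (hX : Continuous X)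
    (hXU : ∀ t, X t ∈ U) (hA : IsCBV S A) : BddMeasOn (fun u => Φ u X A) Set.univ := by
  obtain ⟨o, e, ho, he⟩ := exists_bot_top P
  exact (bddMeasOn_of_leftContinuous hΦ hΦb P hU ho he (.of_continuous hX hXU)
    (by rwa [max_bot_comp ho]) hA).univ_of_Ioi ho

theorem IsHorizontalDeriv.bddMeasOn_univ {F : Functional T d m}
    {D : Fin (m + 1) → Functional T d m} (hD : IsHorizontalDeriv U S F D)
    (hDc : ∀ i, ContinuousAtFixedTimes U S (D i)) (P : PartitionSeq T) (hU : IsOpen U)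
    (hX : Continuous X) (hXU : ∀ t, X t ∈ U) (hA : IsCBV S A) (i : Fin (m + 1)) :
    BddMeasOn (fun u => D i u X A) Set.univ := by
  obtain ⟨o, e, ho, he⟩ := exists_bot_top P
  have h := (hD.approx hDc hU ho he (fun n => (P.isPartition ho he n).bot_mem)
    (.of_continuous hX hXU) (by rwa [max_bot_comp ho]) hA e i).1
  exact (h.mono measurableSet_Ioi fun u hu => ⟨hu, he u⟩).univ_of_Ioi ho

/-- The functional Itô formula along a continuous path with continuous quadratic variation. -/
theorem hasItoIntegral_vgrad {F : Functional T d m} (hF : MemC12c U S F)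
    {D : Fin (m + 1) → Functional T d m} (hD : IsHorizontalDeriv U S F D)
    (hDc : ∀ i, ContinuousAtFixedTimes U S (D i)) (hU : IsOpen U) (ho : IsBot o)
    (hX : Continuous X) (hXU : ∀ t, X t ∈ U) (hA : IsCBV S A) {Q : Fin d → Fin d → Time T → ℝ}
    (hQ : HasCovariation P X Q) {ξ : Time T → PathFn T d → E d}
    (hξ : ∀ t Z, IsCadlag U Z → ξ t Z = vgrad F t Z A) (t : Time T) :
    HasItoIntegral P ξ X t (F t X A - F o X A
      - ∑ i, lsIntegral (fun u => D i u X A) (withTime A i) (Set.Iic t)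
      - (1 / 2) * ∑ i, ∑ j, lsIntegral (fun u => vpartial i (vpartial j F) u X A) (Q i j)
        (Set.Iic t)) := by
  obtain ⟨-, e, -, he⟩ := exists_bot_top P
  have h := ito_formula (P := P) hF hD hDc hU ho he
    (fun n => (P.isPartition ho he n).bot_mem) (.of_continuous hX hXU)
    (by rwa [max_bot_comp ho]) hA (by rwa [max_bot_comp ho]) (ho t)
  simp only [lsIntegral_Iic (hA.isContBV_withTime _) ho, lsIntegral_Iic (hQ.isContBV hX ho he _ _) ho]
  refine h.congr fun n => Finset.sum_congr rfl fun r _ => ?_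
  rw [hξ r _ (isCadlag_approxLeft (P.isPartition ho he n) hXU r), approxFrom_bot ho,
    max_eq_right (ho _), max_eq_right (ho _)]

end FromZero

/-! ### Associativity for covariations and the final bookkeeping -/

section Associativity

variable {P : PartitionSeq T} {X : PathFn T d} {A : PathFn T m} {F : Fin ν → Functional T d m}
  {Q : Fin d → Fin d → Time T → ℝ}

/-- Integration against the quadratic variation of the image path. -/
theorem lsIntegral_covariation_imagePath (hU : IsOpen U) (hX : Continuous X)
    (hXU : ∀ t, X t ∈ U) (hQ : HasCovariation P X Q) (hA : IsCBV S A)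
    (hF : ∀ l, MemC12c U S (F l)) {QY : Fin ν → Fin ν → Time T → ℝ}
    (hY : HasCovariation P (imagePath F X A) QY)
    (hQY : ∀ i j t, QY i j t = ∑ k, ∑ l, lsIntegral
      (fun s => vpartial k (F i) s X A * vpartial l (F j) s X A) (Q k l) (Set.Iic t))
    {f : Time T → ℝ} (hf : BddMeasOn f Set.univ) (i j : Fin ν) (t : Time T) :
    lsIntegral f (QY i j) (Set.Iic t) = ∑ k, ∑ l, lsIntegral
      (fun s => f s * (vpartial k (F i) s X A * vpartial l (F j) s X A)) (Q k l) (Set.Iic t) := by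
  obtain ⟨o, e, ho, he⟩ := exists_bot_top P
  have hQc := fun k l => hQ.isContBV hX ho he k l
  have hb : ∀ k i, BddMeasOn (fun s => vpartial k (F i) s X A) Set.univ := fun k i =>
    ((hF i).vpartial_leftContinuous k).bddMeasOn_univ ((hF i).vpartial_boundednessPreserving k)
      P hU hX hXU hA
  have hY0 : QY i j o = 0 := by
    rw [hQY]
    refine Finset.sum_eq_zero fun k _ => Finset.sum_eq_zero fun l _ => ?_
    rw [lsIntegral_Iic (hQc k l) ho, Set.Ioc_self,
      lsIntegral_congr (f₂ := fun _ => 0) _ (fun x hx => absurd hx (Set.notMem_empty x)),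
      lsIntegral_zero_left]
  -- The assumed covariation is a sum over pairs (k, l) of integrals against [X_k, X_l], hence the
  -- product index.
  rw [lsIntegral_assoc (ι := Fin d × Fin d) (s := Finset.univ)
    (k := fun q s => vpartial q.1 (F i) s X A * vpartial q.2 (F j) s X A)
    (g := fun q => Q q.1 q.2) ho
    (hY.isContBV (continuous_imagePath hF hX hXU hA) ho he i j) (fun q _ => hQc q.1 q.2)
    (fun q _ => (hb q.1 i).mul (hb q.2 j))
    (fun b => by
      rw [hY0, sub_zero, hQY, Fintype.sum_prod_type]
      simp only [lsIntegral_Iic (hQc _ _) ho])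
    measurableSet_Iic (hf.mono measurableSet_Iic (Set.subset_univ _)), Fintype.sum_prod_type]

end Associativity

theorem sum_comm_three {ι κ lam : Type*} [Fintype ι] [Fintype κ] [Fintype lam]
    (f : ι → κ → lam → ℝ) : ∑ i, ∑ j, ∑ l, f i j l = ∑ l, ∑ i, ∑ j, f i j l :=
  (Finset.sum_congr rfl fun _ _ => Finset.sum_comm).trans Finset.sum_comm

/-- Here x − y is the common increment, z the horizontal part of G, a the horizontal part of F, b
the terms with ∂_{ij}F, and c those with ∂_{kl}G. Both z and c cancel. -/
theorem sum_rearrange {ι κ lam : Type*} [Fintype ι] [Fintype κ] [Fintype lam] (x y z : ℝ)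
    (a : κ → lam → ℝ) (b : ι → ι → lam → ℝ) (c : lam → lam → ι → ι → ℝ) :
    x - y - z - (1 / 2) * ∑ k, ∑ l, ∑ i, ∑ j, c k l i j
      = x - y - ((∑ i, ∑ l, a i l) + z)
        - (1 / 2) * ∑ i, ∑ j, ((∑ l, b i j l) + ∑ k, ∑ l, c k l i j)
        + ∑ l, ((∑ i, a i l) + (1 / 2) * ∑ i, ∑ j, b i j l) := by
  have h₁ : ∑ i, ∑ j, ∑ k, ∑ l, c k l i j = ∑ k, ∑ l, ∑ i, ∑ j, c k l i j :=
    (sum_comm_three _).trans (Finset.sum_congr rfl fun _ _ => sum_comm_three _)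
  simp only [Finset.sum_add_distrib, ← Finset.mul_sum]
  rw [h₁, sum_comm_three b, Finset.sum_comm (f := a)]
  ring

end FunctionalIto

end

/-! ### The change of integrator for pathwise Itô integrals -/

theorem corollary2p1 {T : ℝ} (hT : 0 < T) (P : PartitionSeq T) {d m ν : ℕ}
    {U : Set (E d)} (hU : IsOpen U) {S : Set (E m)} (hS : IsOpen S)
    {X : PathFn T d} (hX : Continuous X) (hXU : ∀ t, X t ∈ U)
    {Q : Fin d → Fin d → Time T → ℝ} (hQ : HasCovariation P X Q)
    {A : PathFn T m} (hA : IsCBV S A)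
    {F : Fin ν → Functional T d m} (hF : ∀ l, MemC12c U S (F l))
    {D : Fin ν → Fin (m + 1) → Functional T d m}
    (hD : ∀ l, IsHorizontalDeriv U S (F l) (D l))
    (hDc : ∀ l i, ContinuousAtFixedTimes U S (D l i))
    (hY : HasCovariation P (imagePath F X A) fun i j t =>
      ∑ k, ∑ l, lsIntegral (fun s => vpartial k (F i) s X A * vpartial l (F j) s X A)
        (Q k l) (Set.Iic t))
    {η : Time T → PathFn T ν → E ν} (hη : IsAdmissible Set.univ η) :
    IsAdmissible U (pullbackIntegrand η F A) ∧
    (∀ t : Time T,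
      (∀ l i, LSIntegrable (fun s => η s (imagePath F X A) l * D l i s X A)
        (withTime A i) (Set.Iic t)) ∧
      (∀ l i j, LSIntegrable
        (fun s => η s (imagePath F X A) l * vpartial i (vpartial j (F l)) s X A)
        (Q i j) (Set.Iic t)) ∧
      ∃ IY IX : ℝ,
        HasItoIntegral P η (imagePath F X A) t IY ∧
        HasItoIntegral P (pullbackIntegrand η F A) X t IX ∧
        IY = IX + ∑ l,
          (∑ i, lsIntegral (fun s => η s (imagePath F X A) l * D l i s X A)
              (withTime A i) (Set.Iic t)
            + (1 / 2) * ∑ i, ∑ j,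
              lsIntegral (fun s => η s (imagePath F X A) l * vpartial i (vpartial j (F l)) s X A)
                (Q i j) (Set.Iic t))) := by
  obtain ⟨p, W, B, G, hW, hB, hG, hηG⟩ := hη
  obtain ⟨DG, hDG, hDGc⟩ := hG.horizontal
  obtain ⟨o, e, ho, he⟩ := exists_bot_top P
  have hC := hA.pairVec hB
  have hCA : (fun u => fstPart (pairVec (A u) (B u))) = A := funext fun u => fstPart_pairVec _ _
  have hCB : (fun u => sndPart (pairVec (A u) (B u))) = B := funext fun u => sndPart_pairVec _ _
  have hH := MemC12c.comp P hU hG hF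
  have hDH := isHorizontalDeriv_compDeriv P hG hDG hDGc hF hD
  have hpull : ∀ t Z, IsCadlag U Z → pullbackIntegrand η F A t Z
      = vgrad (compFunctional G F) t Z fun u => pairVec (A u) (B u) := fun t Z hZ => by
    rw [vgrad_compFunctional hU hG.nonAnticipative hG.vertical hF hZ hC]
    simp only [pullbackIntegrand, hηG t _ (isCadlag_imagePath hF hZ hA), compFunctional, hCA, hCB,
      vpartial]
  refine ⟨⟨m + p, pairSet S W, _, compFunctional G F, isOpen_pairSet hS hW, hC, hH, hpull⟩,
    fun t => ?_⟩
  have hXc : IsCadlag U X := .of_continuous hX hXU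
  have hYc : Continuous (imagePath F X A) := continuous_imagePath hF hX hXU hA
  have hYU : ∀ t, imagePath F X A t ∈ Set.univ := fun _ => Set.mem_univ _
  set Y := imagePath F X A with hYdef
  have hηY : ∀ s l, η s Y l = vpartial l G s Y B := fun s l => by
    rw [hηG s Y (.of_continuous hYc hYU), vpartial]
  simp only [hηY]
  have bG : ∀ l, BddMeasOn (fun s => vpartial l G s Y B) Set.univ := fun l =>
    (hG.vpartial_leftContinuous l).bddMeasOn_univ (hG.vpartial_boundednessPreserving l)
      P isOpen_univ hYc hYU hB
  have bG₂ : ∀ k l, BddMeasOn (fun s => vpartial k (vpartial l G) s Y B) Set.univ := fun k l =>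
    (hG.vpartial₂_leftContinuous k l).bddMeasOn_univ (hG.vpartial₂_boundednessPreserving k l)
      P isOpen_univ hYc hYU hB
  have bDG : ∀ j, BddMeasOn (fun s => DG j s Y B) Set.univ :=
    hDG.bddMeasOn_univ hDGc P isOpen_univ hYc hYU hB
  have bF : ∀ k l, BddMeasOn (fun s => vpartial k (F l) s X A) Set.univ := fun k l =>
    ((hF l).vpartial_leftContinuous k).bddMeasOn_univ ((hF l).vpartial_boundednessPreserving k)
      P hU hX hXU hA
  have bF₂ : ∀ i j l, BddMeasOn (fun s => vpartial i (vpartial j (F l)) s X A) Set.univ :=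
    fun i j l => ((hF l).vpartial₂_leftContinuous i j).bddMeasOn_univ
      ((hF l).vpartial₂_boundednessPreserving i j) P hU hX hXU hA
  have bD : ∀ l i, BddMeasOn (fun s => D l i s X A) Set.univ := fun l =>
    (hD l).bddMeasOn_univ (hDc l) P hU hX hXU hA
  have hres : ∀ {f : Time T → ℝ}, BddMeasOn f Set.univ → BddMeasOn f (Set.Iic t) := fun h =>
    h.mono measurableSet_Iic (Set.subset_univ _)
  -- The values of the two Itô integrals are filled in by the Itô formula for G along Y and for the
  -- composition along X.
  refine ⟨fun l i => (hres ((bG l).mul (bD l i))).integrableOn measurableSet_Iic _,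
    fun l i j => (hres ((bG l).mul (bF₂ i j l))).integrableOn measurableSet_Iic _, _, _,
    hasItoIntegral_vgrad hG hDG hDGc isOpen_univ ho hYc hYU hB hY hηG t,
    hasItoIntegral_vgrad hH hDH (continuousAtFixedTimes_compDeriv hG hDGc hF hDc) hU ho hX hXU hC
      hQ hpull t, ?_⟩
  have hhor := sum_lsIntegral_compDeriv (G := G) (DG := DG) (F := F) (D := D)
    (measurableSet_Iic (a := t)) (Z := X) (C := fun u => pairVec (A u) (B u))
    (fun i => by
      simp only [compFunctional, liftFunctional, hCA, hCB]
      exact .sum _ measurableSet_Iic fun l _ => (hres (bG l)).mul (hres (bD l i)))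
    (fun j => by
      simp only [compFunctional, hCA, hCB]
      exact hres (bDG j))
  rw [hhor]
  simp only [vpartial_vpartial_compFunctional hU hG hF _ _ hXc hC]
  simp only [compFunctional, liftFunctional, hCA, hCB, ← hYdef]
  have h₁ : ∀ i, lsIntegral (fun u => ∑ l, vpartial l G u Y B * D l i u X A) (withTime A i)
      (Set.Iic t) = ∑ l, lsIntegral (fun u => vpartial l G u Y B * D l i u X A) (withTime A i)
      (Set.Iic t) := fun i => lsIntegral_sum _ _ measurableSet_Iic
    fun l _ => (hres (bG l)).mul (hres (bD l i))
  have h₂ : ∀ i j, lsIntegral (fun u =>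
        (∑ l, vpartial l G u Y B * vpartial i (vpartial j (F l)) u X A)
        + ∑ l, vpartial j (F l) u X A * ∑ k, vpartial k (vpartial l G) u Y B
          * vpartial i (F k) u X A) (Q i j) (Set.Iic t)
      = (∑ l, lsIntegral (fun u => vpartial l G u Y B * vpartial i (vpartial j (F l)) u X A)
          (Q i j) (Set.Iic t))
        + ∑ k, ∑ l, lsIntegral (fun u => vpartial k (vpartial l G) u Y B
          * (vpartial i (F k) u X A * vpartial j (F l) u X A)) (Q i j) (Set.Iic t) := by
    intro i j
    rw [lsIntegral_add _ measurableSet_Iic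
      (.sum _ measurableSet_Iic fun l _ => (hres (bG l)).mul (hres (bF₂ i j l)))
      (.sum _ measurableSet_Iic fun l _ => (hres (bF j l)).mul
        (.sum _ measurableSet_Iic fun k _ => (hres (bG₂ k l)).mul (hres (bF i k)))),
      lsIntegral_sum _ _ measurableSet_Iic fun l _ => (hres (bG l)).mul (hres (bF₂ i j l)),
      lsIntegral_sum _ _ measurableSet_Iic fun l _ => (hres (bF j l)).mul
        (.sum _ measurableSet_Iic fun k _ => (hres (bG₂ k l)).mul (hres (bF i k)))]
    congr 1
    rw [Finset.sum_comm]
    refine Finset.sum_congr rfl fun l _ => ?_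
    rw [← lsIntegral_sum _ _ measurableSet_Iic fun k _ =>
      (hres (bG₂ k l)).mul ((hres (bF i k)).mul (hres (bF j l)))]
    refine lsIntegral_congr _ fun u _ => ?_
    simp only [Finset.mul_sum]
    exact Finset.sum_congr rfl fun k _ => by ring
  -- Second-order terms of G along Y, rewritten against [X_i, X_j]; they match the last double sum
  -- in `h₂`.
  have h₃ : ∀ k l, _ := fun k l => lsIntegral_covariation_imagePath hU hX hXU hQ hA hF hY
    (fun _ _ _ => rfl) (bG₂ k l) k l t
  simp only [h₁, h₂, h₃]
  exact sum_rearrange _ _ _ _ _ _
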